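/- Let $\Omega\subset[0,\pi/2]$. Let $\mathcal A_\Omega$ be the family of (closed, nondegenerate) rectangles in the plane having a side that makes an angle $\phi\in\Omega$ with the $x$-axis. Let $\mathcal A'_\Omega$ be either (a) the set of $R\in\mathcal A_\Omega$ with $R\subset[0,1]^2$, or (b) the set of $R\in\mathcal A_\Omega$ with $\mathrm{diam}(R)\le 1$, where $[0,1]^2$ is viewed as the torus $\mathbb R^2/\mathbb Z^2$ and $R$ is taken modulo $\mathbb Z^2$. For a set $\mathcal P\subset[0,1]^2$ with $\#\mathcal P=N$ put $D_\Omega(\mathcal P,R)=\#(\mathcal P\cap R)-N|R|$, and let $\log N$ stand for $\max\{1,\log_2 N\}$. In each of the cases (a) and (b) the following holds. 1) Let $\Omega=\{\omega_n\}_{n\ge 0}$ be a lacunary sequence, i.e. $\omega_n>0$ and, for some $A<1$, $\omega_{n+1}/\omega_n<A$ for all $n$. Then there is a constant $C=C(\Omega)$ such that for every $N\ge 1$ and every probability measure $\mu$ on $\mathcal A'_\Omega$ there is $\mathcal P\subset[0,1]^2$ with $\#\mathcal P=N$ and $$\left(\int_{\mathcal A'_\Omega}|D_\Omega(\mathcal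 P,R)|^2\,d\mu(R)\right)^{1/2}\le C\log^{5/2}N .$$ 2) Let $M>1$ be an integer and let $\Omega$ be a lacunary set of order $M$. Then there is a constant $C=C(\Omega,M)$ such that for every $N\ge 1$ and every probability measure $\mu$ on $\mathcal A'_\Omega$ there is $\mathcal P\subset[0,1]^2$ with $\#\mathcal P=N$ and $$\left(\int_{\mathcal A'_\Omega}|D_\Omega(\mathcal P,R)|^2\,d\mu(R)\right)^{1/2}\le C\log^{2M+1/2}N .$$ Here a lacunary set of order $1$ is a lacunary sequence, and a set of reals is lacunary of order $M+1$ if it can be covered by the union of a lacunary set $\Omega'$ of order $M$ and of (possibly finite or absent) sequences $p-a_{p,n}$ and $p+b_{p,n}$ $(n\ge 0)$, for $p\in\Omega'$, where $a_{p,n},b_{p,n}\ge 0$, $a_{p,n+1}\le A\,a_{p,n}$ and $b_{p,n+1}\le A\,b_{p,n}$ with some $A<1$ not depending on $p$ and $n$, and where no point of $\Omega'$ lies strictly between $p$ and $p-a_{p,n}$, or strictly between $p$ and $p+b_{p,n}$. 3) Let $d$ be the upper Minkowski dimension of $\Omega$, i.e. the infimum of the exponents $s\ge 0$ such that for all small $\delta>0$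 the set $\Omega$ can be covered by $O(\delta^{-s})$ intervals of length $\delta$. Assume that $0\le d<1$ and that $\tau=\frac{2}{(1-d)^2}-2$ satisfies $\tau<1$. Then there are constants $C_\varepsilon=C_\varepsilon(\Omega)$, $\varepsilon>0$, such that for every $N\ge 1$ and every probability measure $\mu$ on $\mathcal A'_\Omega$ there is $\mathcal P\subset[0,1]^2$ with $\#\mathcal P=N$ and, for all $\varepsilon>0$, $$\left(\int_{\mathcal A'_\Omega}|D_\Omega(\mathcal P,R)|^2\,d\mu(R)\right)^{1/2}\le C_\varepsilon N^{\frac{\tau}{2(\tau+1)}+\varepsilon}.$$ -/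

import Mathlib

open MeasureTheory Set

/-- The Euclidean plane. -/
abbrev Plane : Type := EuclideanSpace ℝ (Fin 2)

/-- The closed unit square `[0,1]²`. -/
def unitSquare : Set Plane := {x | ∀ i, x i ∈ Icc (0 : ℝ) 1}

/-- The unit vector making the angle `φ` with the `x`-axis. -/
noncomputable def dir (φ : ℝ) : Plane := !₂[Real.cos φ, Real.sin φ]

/-- A nondegenerate rectangle in the plane, given by a vertex, the angle that one of the two sides
starting at this vertex makes with the `x`-axis, and the two side lengths.  The other side starting
at the vertex has the direction turned counterclockwise by `π / 2`.  Every rectangle which has a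
side of direction `φ` is of this form with `angle = φ`. -/
structure Rect where
  vertex : Plane
  angle : ℝ
  width : ℝ
  height : ℝ
  width_pos : 0 < width
  height_pos : 0 < height

/-- The closed set of points of the rectangle. -/
noncomputable def Rect.toSet (R : Rect) : Set Plane :=
  {x | ∃ s ∈ Icc (0 : ℝ) R.width, ∃ t ∈ Icc (0 : ℝ) R.height,
    x = R.vertex + s • dir R.angle + t • dir (R.angle + Real.pi / 2)}

/-- The Borel σ-algebra on the space of rectangles, in the above parameters. -/
instance Rect.instMeasurableSpace : MeasurableSpace Rect :=
  MeasurableSpace.comap (fun R : Rect => (R.vertex, R.angle, R.width, R.height)) inferInstance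

/-- The rectangles with a side making an angle `φ ∈ Ω` with the `x`-axis. -/
def rectangles (Ω : Set ℝ) : Set Rect := {R | R.angle ∈ Ω}

/-- The rectangles with a side of direction in `Ω` that are contained in the unit square. -/
def squareRectangles (Ω : Set ℝ) : Set Rect := {R | R ∈ rectangles Ω ∧ R.toSet ⊆ unitSquare}

/-- The rectangles with a side of direction in `Ω` and with diameter at most `1`
(to be regarded modulo `ℤ²`). -/
def torusRectangles (Ω : Set ℝ) : Set Rect :=
  {R | R ∈ rectangles Ω ∧ Metric.diam R.toSet ≤ 1}

/-- The discrepancy `#(P ∩ R) - N |R|` of an `N`-point set `P` with respect to `R`. -/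
noncomputable def discrepancy (P : Finset Plane) (R : Rect) : ℝ :=
  (((P : Set Plane) ∩ R.toSet).ncard : ℝ) - (P.card : ℝ) * volume.real R.toSet

/-- The points of the plane that lie in `S` modulo `ℤ²`. -/
def modIntegers (S : Set Plane) : Set Plane :=
  {x | ∃ z : Fin 2 → ℤ, x + WithLp.toLp 2 (fun i => (z i : ℝ)) ∈ S}

/-- The discrepancy of an `N`-point set `P ⊆ [0,1]²` with respect to `R`, where `[0,1]²` is viewed
as the torus `ℝ² / ℤ²`. -/
noncomputable def torusDiscrepancy (P : Finset Plane) (R : Rect) : ℝ :=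
  (((P : Set Plane) ∩ modIntegers R.toSet).ncard : ℝ) - (P.card : ℝ) * volume.real R.toSet

/-- The convention `log n = max {1, log₂ n}`. -/
noncomputable def lg (n : ℕ) : ℝ := max 1 (Real.logb 2 n)

/-- Lacunary sequences of positive reals. -/
def IsLacunarySeq (ω : ℕ → ℝ) : Prop :=
  (∀ n, 0 < ω n) ∧ ∃ A : ℝ, A < 1 ∧ ∀ n, ω (n + 1) / ω n < A

/-- Lacunary sets of finite order.  A lacunary set of order one is a lacunary sequence.  A set is
lacunary of order `M + 1` if it is covered by a lacunary set `Ω'` of order `M` together with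
sequences `p - a p n` and `p + b p n` converging lacunarily, with a common ratio `A < 1`, to the
points `p` of `Ω'` from the left and from the right, the sequences at `p` having no point of `Ω'`
between them and `p`.  (Offsets may vanish from some index on: a sequence may be finite or
absent.) -/
def IsLacunaryOfOrder : ℕ → Set ℝ → Prop
  | 0, _ => False
  | 1, Ω => ∃ ω : ℕ → ℝ, IsLacunarySeq ω ∧ Ω = range ω
  | M + 2, Ω => ∃ Ω' : Set ℝ, IsLacunaryOfOrder (M + 1) Ω' ∧
      ∃ A : ℝ, A < 1 ∧ ∃ a b : ℝ → ℕ → ℝ,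
        (∀ p ∈ Ω', ∀ n,
          0 ≤ a p n ∧ a p (n + 1) ≤ A * a p n ∧ Disjoint Ω' (Ioo (p - a p n) p) ∧
          0 ≤ b p n ∧ b p (n + 1) ≤ A * b p n ∧ Disjoint Ω' (Ioo p (p + b p n))) ∧
        Ω ⊆ Ω' ∪ ⋃ p ∈ Ω', (range (fun n => p - a p n) ∪ range (fun n => p + b p n))

/-- `Ω` can be covered by `O(δ ^ (-s))` intervals of length `δ`, for all small `δ > 0`. -/
def HasCoveringExponent (Ω : Set ℝ) (s : ℝ) : Prop :=
  ∃ C : ℝ, ∃ δ₀ : ℝ, 0 < δ₀ ∧ ∀ δ : ℝ, 0 < δ → δ < δ₀ →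
    ∃ F : Finset ℝ, (F.card : ℝ) ≤ C * δ ^ (-s) ∧ Ω ⊆ ⋃ x ∈ F, Icc x (x + δ)

/-- The upper Minkowski dimension of a bounded set of reals. -/
noncomputable def upperMinkowskiDim (Ω : Set ℝ) : ℝ :=
  sInf {s : ℝ | 0 ≤ s ∧ HasCoveringExponent Ω s}

/-! The point set is the lattice `N ^ (-1/2) ℤ²`, turned by an angle `α` that depends only on `Ω`
and shifted along its rows by a fraction `u` of the spacing. It is cut with the unit square, and
points are then added or removed to make their number exactly `N`.

Fix a rectangle. Its part in the unit square is, in the turned frame, an intersection of four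
strips. Each lattice row that meets it contributes the length of its section minus one sawtooth at
either end. The section length is a concave Lipschitz function of the row, so the lengths add up to
the area with a bounded error (`abs_sum_sub_integral_le_of_concave`). Along an edge of slope `θ` the
sawtooths are `saw (θ j + β - u)` or `saw (u - (θ j + β))`. The mean square over `u` of their sum is
`∑ (2π²h²)⁻¹ |∑ⱼ e(hθj)|²` (`hasSum_integral_sq_sum_saw`), which is at most `∑ h⁻² min (n², ‖hθ‖⁻²)`
with `n` of order `√N`. If `‖hθ‖ ≥ δ k` for `1 ≤ h ≤ 2 ^ k`, a pigeonhole argument on blocks of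
frequencies bounds this, for every `K`, by a multiple of `∑_{k ≤ K} 4⁻ᵏ (δ k)⁻² + n² 4⁻ᴷ`
(`sum_expWeight_le`).

It remains to find `α` such that all edges have uniformly badly approximable slopes, that is, such
that `α - ω` keeps away from the direction of every integer vector `v`, by an amount depending on
`|v|`. This is a Cantor construction (`exists_angle`). In an interval of length `l ≤ 1` only the
vectors with `4 l |v|² ≤ 1` are considered. Their directions are so far apart that each of the `m`
intervals covering `Ω` spoils at most one of `m + 1` candidate subintervals. So `l` shrinks to about
`l / m`, where `m` is the covering number of `Ω` at scale about `l / m`.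

For a lacunary set of order `M` one has `m = O(log^M (1/l))`; this leads to `δ k` of order `2⁻ᵏ
(k+1)^(-2M)` and to the mean square `log^(4M+1) N`. For a covering exponent `s < 1` one has `m =
O(l^(-s/(1-s)))`; this leads to `δ k` of order `2^(-k(1+t))` with `t = 2/(1-s)² - 2`, and `2 ^ K ≈
N^(1/(2(t+1)))` gives `N^(t/(t+1))` up to a logarithm.

Since the bound holds for each rectangle, Fubini for `μ` and `u` yields one shift that is good on
average over `μ`, and at the same time for the unit square, whose error is the number of points to
be corrected (`exists_pointSet`). On the torus a rectangle of diameter at most one is cut into nine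
parts, possibly empty, of the kind already treated. -/

/-! ### Sawtooth functions: covariances and Fourier series -/

/-- The sawtooth function. -/
noncomputable def saw (x : ℝ) : ℝ := Int.fract x - 1 / 2

theorem measurable_saw : Measurable saw := measurable_fract.sub_const _

theorem abs_saw_le (x : ℝ) : |saw x| ≤ 1 := by
  unfold saw
  rw [abs_le]
  constructor <;> linarith [Int.fract_nonneg x, Int.fract_lt_one x]

theorem saw_add_int (x : ℝ) (n : ℤ) : saw (x + n) = saw x := by
  simp [saw]

theorem saw_of_mem {x : ℝ} (n : ℤ) (h0 : n ≤ x) (h1 : x < n + 1) : saw x = x - n - 1 / 2 := by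
  have : ⌊x⌋ = n := Int.floor_eq_iff.2 ⟨h0, h1⟩
  rw [saw, Int.fract, this]

theorem intervalIntegrable_of_bounded {f : ℝ → ℝ} (hf : Measurable f) {C : ℝ} (hC : ∀ x, |f x| ≤ C)
    (a b : ℝ) : IntervalIntegrable f volume a b :=
  IntervalIntegrable.mono_fun' (g := fun _ => C) intervalIntegrable_const
    hf.aestronglyMeasurable (Filter.Eventually.of_forall hC)

theorem intervalIntegrable_saw_mul_saw {f g : ℝ → ℝ} (hf : Measurable f) (hg : Measurable g)
    (a b : ℝ) : IntervalIntegrable (fun u => saw (f u) * saw (g u)) volume a b := by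
  refine intervalIntegrable_of_bounded ((measurable_saw.comp hf).mul (measurable_saw.comp hg))
    (C := 1) (fun x => ?_) a b
  rw [Pi.mul_apply, abs_mul]
  exact mul_le_one₀ (abs_saw_le _) (abs_nonneg _) (abs_saw_le _)

theorem integral_saw_mul_saw_add {c : ℝ} (h0 : 0 ≤ c) (h1 : c < 1) :
    ∫ u in (0 : ℝ)..1, saw u * saw (u + c) = (c ^ 2 - c + 1 / 6) / 2 := by
  -- `saw (u + c)` jumps at `u = 1 - c`; on either side both factors are affine.
  rw [← intervalIntegral.integral_add_adjacent_intervals (b := 1 - c)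
    (intervalIntegrable_saw_mul_saw (f := fun u => u) (g := fun u => u + c) measurable_id
      (measurable_id.add_const c) _ _)
    (intervalIntegrable_saw_mul_saw (f := fun u => u) (g := fun u => u + c) measurable_id
      (measurable_id.add_const c) _ _)]
  have e1 : ∫ u in (0 : ℝ)..(1 - c), saw u * saw (u + c)
      = ∫ u in (0 : ℝ)..(1 - c), (u ^ 2 + (c - 1) * u + (1 / 4 - c / 2)) := by
    refine intervalIntegral.integral_congr_Ioo_of_le (by linarith) fun u hu => ?_
    have hu0 := hu.1
    have hu1 := hu.2
    rw [saw_of_mem (x := u) 0 (by simpa using hu0.le) (by push_cast; linarith),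
      saw_of_mem (x := u + c) 0 (by push_cast; linarith) (by push_cast; linarith)]
    push_cast
    ring
  have e2 : ∫ u in (1 - c)..(1 : ℝ), saw u * saw (u + c)
      = ∫ u in (1 - c)..(1 : ℝ), (u ^ 2 + (c - 2) * u + (3 / 4 - c / 2)) := by
    refine intervalIntegral.integral_congr_Ioo_of_le (by linarith) fun u hu => ?_
    have hu0 := hu.1
    have hu1 := hu.2
    rw [saw_of_mem (x := u) 0 (by push_cast; linarith) (by push_cast; linarith),
      saw_of_mem (x := u + c) 1 (by push_cast; linarith) (by push_cast; linarith)]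
    push_cast
    ring
  rw [e1, e2]
  have key : ∀ p q a b : ℝ, ∫ u in a..b, (u ^ 2 + p * u + q)
      = (b ^ 3 - a ^ 3) / 3 + p * ((b ^ 2 - a ^ 2) / 2) + q * (b - a) := by
    intro p q a b
    rw [intervalIntegral.integral_add (Continuous.intervalIntegrable (by fun_prop) _ _)
      (Continuous.intervalIntegrable (by fun_prop) _ _),
      intervalIntegral.integral_add (Continuous.intervalIntegrable (by fun_prop) _ _)
      (Continuous.intervalIntegrable (by fun_prop) _ _), intervalIntegral.integral_const_mul,
      integral_pow, integral_id, intervalIntegral.integral_const]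
    norm_num
    ring
  rw [key, key]
  ring

/-- By periodicity only `a - b` modulo `1` matters. The value is half the second Bernoulli
polynomial, whose Fourier series is known. -/
theorem integral_saw_add_mul_saw_add (a b : ℝ) :
    ∫ u in (0 : ℝ)..1, saw (u + a) * saw (u + b)
      = (Int.fract (a - b) ^ 2 - Int.fract (a - b) + 1 / 6) / 2 := by
  have hshift : ∀ (f : ℝ → ℝ) (_ : Function.Periodic f 1) (t : ℝ),
      ∫ u in (0 : ℝ)..1, f (u + t) = ∫ u in (0 : ℝ)..1, f u := by
    intro f hf t
    rw [intervalIntegral.integral_comp_add_right]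
    have := hf.intervalIntegral_add_eq (0 + t) 0
    rw [zero_add] at this ⊢
    rw [zero_add] at this
    rw [add_comm 1 t, this]
  have h1 := hshift (fun u => saw u * saw (u + (a - b))) (fun u => by
    have e1 := saw_add_int u 1
    have e2 := saw_add_int (u + (a - b)) 1
    push_cast at e1 e2
    simp only [e1]
    rw [add_right_comm, e2]) b
  have h2 : ∀ u : ℝ, saw (u + (a - b)) = saw (u + Int.fract (a - b)) := by
    intro u
    conv_lhs => rw [← Int.fract_add_floor (a - b)]
    rw [← add_assoc, saw_add_int]
  rw [← integral_saw_mul_saw_add (Int.fract_nonneg _) (Int.fract_lt_one (a - b))]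
  simp only [h2] at h1
  rw [← h1]
  refine intervalIntegral.integral_congr fun u _ => ?_
  rw [mul_comm, ← h2]
  congr 2
  ring

theorem integral_saw_sub_mul_saw_sub (a b : ℝ) :
    ∫ u in (0 : ℝ)..1, saw (a - u) * saw (b - u)
      = (Int.fract (a - b) ^ 2 - Int.fract (a - b) + 1 / 6) / 2 := by
  have := intervalIntegral.integral_comp_sub_left (a := 0) (b := 1)
    (fun u => saw (a - u) * saw (b - u)) 1
  rw [sub_self, sub_zero] at this
  rw [← this]
  have h := integral_saw_add_mul_saw_add (a - 1) (b - 1)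
  rw [show a - 1 - (b - 1) = a - b by ring] at h
  rw [← h]
  refine intervalIntegral.integral_congr fun u _ => ?_
  congr 2 <;> ring

/-- Fourier series of the periodic second Bernoulli function. The frequency `h = 0` contributes
nothing because `1 / 0 = 0`. -/
theorem hasSum_cos_div_sq (x : ℝ) :
    HasSum (fun h : ℕ => 1 / (2 * Real.pi ^ 2) * (1 / (h : ℝ) ^ 2 * Real.cos (2 * Real.pi * h * x)))
      ((Int.fract x ^ 2 - Int.fract x + 1 / 6) / 2) := by
  have h := hasSum_one_div_nat_pow_mul_cos one_ne_zero
    (x := Int.fract x) ⟨Int.fract_nonneg x, (Int.fract_lt_one x).le⟩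
  have h2 := h.mul_left (1 / (2 * Real.pi ^ 2))
  have hpi := Real.pi_ne_zero
  have hB : (Polynomial.map (algebraMap ℚ ℝ) (Polynomial.bernoulli 2)).eval (Int.fract x)
      = Int.fract x ^ 2 - Int.fract x + 1 / 6 := by
    simp [Polynomial.bernoulli, Finset.sum_range_succ, bernoulli, bernoulli'_two]
    ring
  rw [mul_one, hB] at h2
  have hv : (Int.fract x ^ 2 - Int.fract x + 1 / 6) / 2 = 1 / (2 * Real.pi ^ 2) *
      ((-1) ^ (1 + 1) * (2 * Real.pi) ^ 2 / 2 / (Nat.factorial 2 : ℕ) *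
        (Int.fract x ^ 2 - Int.fract x + 1 / 6)) := by
    rw [Nat.factorial_two]
    push_cast
    field_simp
  rw [hv]
  convert h2 using 2 with n
  congr 2
  have : (2 : ℝ) * Real.pi * n * x
      = 2 * Real.pi * n * Int.fract x + ((n * ⌊x⌋ : ℤ) : ℝ) * (2 * Real.pi) := by
    push_cast
    nth_rewrite 1 [← Int.fract_add_floor x]
    ring
  rw [this, Real.cos_add_int_mul_two_pi]

/-- The variance of a sum of sawtooth functions in terms of exponential sums. -/
theorem hasSum_integral_sq_sum_saw (J : Finset ℤ) (a : ℤ → ℝ) (f : ℤ → ℝ → ℝ)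
    (hf : (∀ j u, f j u = saw (a j - u)) ∨ (∀ j u, f j u = saw (u - a j))) :
    HasSum (fun h : ℕ => 1 / (2 * Real.pi ^ 2) * (1 / (h : ℝ) ^ 2 *
        ‖∑ j ∈ J, Complex.exp ((2 * Real.pi * h * a j : ℝ) * Complex.I)‖ ^ 2))
      (∫ u in (0 : ℝ)..1, (∑ j ∈ J, f j u) ^ 2) := by
  have hcov : ∀ i j, ∫ u in (0 : ℝ)..1, f i u * f j u
      = (Int.fract (a i - a j) ^ 2 - Int.fract (a i - a j) + 1 / 6) / 2 := by
    intro i j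
    rcases hf with hf | hf
    · simp only [hf, integral_saw_sub_mul_saw_sub]
    · have h := integral_saw_add_mul_saw_add (-a j) (-a i)
      rw [show -a j - -a i = a i - a j by ring] at h
      rw [← h]
      refine intervalIntegral.integral_congr fun u _ => ?_
      rw [hf, hf, mul_comm, sub_eq_add_neg, sub_eq_add_neg]
  have hint : ∀ i j, IntervalIntegrable (fun u => f i u * f j u) volume 0 1 := by
    intro i j
    rcases hf with hf | hf
    · simp only [hf]
      exact intervalIntegrable_saw_mul_saw (by fun_prop) (by fun_prop) _ _
    · simp only [hf]
      exact intervalIntegrable_saw_mul_saw (by fun_prop) (by fun_prop) _ _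
  have hI : ∫ u in (0 : ℝ)..1, (∑ j ∈ J, f j u) ^ 2
      = ∑ i ∈ J, ∑ j ∈ J, (Int.fract (a i - a j) ^ 2 - Int.fract (a i - a j) + 1 / 6) / 2 := by
    simp only [sq, Finset.sum_mul_sum]
    have hint' : ∀ i, IntervalIntegrable (fun u => ∑ j ∈ J, f i u * f j u) volume 0 1 := by
      intro i
      simpa only [Finset.sum_fn] using IntervalIntegrable.sum J fun j _ => hint i j
    rw [intervalIntegral.integral_finsetSum fun i _ => hint' i]
    refine Finset.sum_congr rfl fun i _ => ?_
    rw [intervalIntegral.integral_finsetSum fun j _ => hint i j]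
    refine Finset.sum_congr rfl fun j _ => ?_
    rw [hcov, sq]
  rw [hI]
  have hs := hasSum_sum (s := J) fun i _ => hasSum_sum (s := J) fun j _ => hasSum_cos_div_sq (a i - a j)
  convert hs using 1
  ext h
  have hnorm : ‖∑ j ∈ J, Complex.exp ((2 * Real.pi * h * a j : ℝ) * Complex.I)‖ ^ 2
      = ∑ i ∈ J, ∑ j ∈ J, Real.cos (2 * Real.pi * h * (a i - a j)) := by
    rw [Complex.sq_norm, Complex.normSq_apply, Complex.re_sum, Complex.im_sum]
    simp only [Complex.exp_ofReal_mul_I_re, Complex.exp_ofReal_mul_I_im, Finset.sum_mul_sum,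
      ← Finset.sum_add_distrib]
    refine Finset.sum_congr rfl fun i _ => Finset.sum_congr rfl fun j _ => ?_
    rw [mul_sub, Real.cos_sub]
  rw [hnorm]
  simp only [Finset.mul_sum]

/-! ### Exponential sums and the Diophantine sum -/

/-- Distance to the nearest integer. -/
noncomputable def nint (x : ℝ) : ℝ := |x - round x|

theorem nint_nonneg (x : ℝ) : 0 ≤ nint x := abs_nonneg _

theorem nint_le_abs_sub_int (x : ℝ) (n : ℤ) : nint x ≤ |x - n| := round_le x n

theorem two_mul_nint_le_abs_sin (x : ℝ) : 2 * nint x ≤ |Real.sin (Real.pi * x)| := by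
  have h1 : |Real.sin (Real.pi * x)| = |Real.sin (Real.pi * (x - round x))| := by
    rw [mul_sub, mul_comm Real.pi (round x : ℝ), Real.sin_sub_int_mul_pi, abs_mul]
    simp
  have h2 := Real.mul_abs_le_abs_sin (x := Real.pi * (x - round x)) (by
    rw [abs_mul, abs_of_pos Real.pi_pos]
    nlinarith [abs_sub_round x, Real.pi_pos])
  rw [h1]
  refine le_trans (le_of_eq ?_) h2
  rw [abs_mul, abs_of_pos Real.pi_pos, nint]
  field_simp

/-- Geometric sums of unimodular numbers. -/
theorem norm_sum_exp_mul_nint_le (a b : ℤ) (x β : ℝ) :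
    ‖∑ j ∈ Finset.Icc a b, Complex.exp ((2 * Real.pi * (x * j + β) : ℝ) * Complex.I)‖ * nint x
      ≤ 1 := by
  set z : ℂ := Complex.exp ((2 * Real.pi * x : ℝ) * Complex.I) with hz
  set F : ℤ → ℂ := fun j => Complex.exp ((2 * Real.pi * (x * j + β) : ℝ) * Complex.I) with hF
  have hF1 : ∀ j, ‖F j‖ = 1 := fun j => Complex.norm_exp_ofReal_mul_I _
  have hstep : ∀ j, F (j + 1) = F j * z := by
    intro j
    simp only [hF, hz]
    rw [← Complex.exp_add]
    congr 1
    push_cast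
    ring
  have htel : ∀ n : ℕ, (∑ k ∈ Finset.range n, F (a + k)) * (z - 1) = F (a + n) - F a := by
    intro n
    induction n with
    | zero => simp
    | succ n ih =>
      rw [Finset.sum_range_succ, add_mul, ih]
      push_cast
      rw [← add_assoc, hstep]
      ring
  have hsum : ∑ j ∈ Finset.Icc a b, F j = ∑ k ∈ Finset.range (b + 1 - a).toNat, F (a + k) := by
    rw [Int.Icc_eq_finset_map, Finset.sum_map]
    simp
  have hz1 : ‖z - 1‖ = 2 * |Real.sin (Real.pi * x)| := by
    rw [hz, mul_comm, Complex.norm_exp_I_mul_ofReal_sub_one, norm_mul, Real.norm_eq_abs,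
      Real.norm_eq_abs, abs_two]
    congr 3
    ring
  have h2 : ‖∑ j ∈ Finset.Icc a b, F j‖ * ‖z - 1‖ ≤ 2 := by
    rw [← norm_mul, hsum, htel]
    refine (norm_sub_le _ _).trans ?_
    rw [hF1, hF1]
    norm_num
  rw [hz1] at h2
  nlinarith [two_mul_nint_le_abs_sin x, norm_nonneg (∑ j ∈ Finset.Icc a b, F j), nint_nonneg x]

/-- The weight `min (n², 1 / ‖x‖²)`. -/
noncomputable def expWeight (n x : ℝ) : ℝ := if nint x * n ≤ 1 then n ^ 2 else 1 / nint x ^ 2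

theorem expWeight_nonneg (n x : ℝ) : 0 ≤ expWeight n x := by
  unfold expWeight; split_ifs <;> positivity

theorem expWeight_le_sq (n x : ℝ) : expWeight n x ≤ n ^ 2 := by
  unfold expWeight
  split_ifs with h
  · exact le_rfl
  · push Not at h
    have hp : 0 < nint x := by
      rcases (nint_nonneg x).eq_or_lt with h0 | h0
      · rw [← h0] at h; norm_num at h
      · exact h0
    rw [div_le_iff₀ (by positivity)]
    nlinarith

theorem expWeight_le_inv {n : ℝ} {x y : ℝ} (hn : 0 < n) (hy : 0 < y) (hxy : y ≤ nint x) :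
    expWeight n x ≤ 1 / y ^ 2 := by
  have hx : 0 < nint x := hy.trans_le hxy
  have h1 : 1 / nint x ^ 2 ≤ 1 / y ^ 2 :=
    one_div_le_one_div_of_le (by positivity) (pow_le_pow_left₀ hy.le hxy 2)
  refine le_trans ?_ h1
  unfold expWeight
  split_ifs with h
  · rw [le_div_iff₀ (by positivity)]
    nlinarith [mul_pos hx hn]
  · exact le_rfl

/-- The trivial bound and the bound for a geometric sum together; an order-connected finite set of
integers is an interval. -/
theorem sq_norm_sum_exp_le (J : Finset ℤ) (hJ : (J : Set ℤ).OrdConnected) {n : ℝ}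
    (hcard : (J.card : ℝ) ≤ n) (x β : ℝ) :
    ‖∑ j ∈ J, Complex.exp ((2 * Real.pi * (x * j + β) : ℝ) * Complex.I)‖ ^ 2 ≤ expWeight n x := by
  rcases J.eq_empty_or_nonempty with rfl | hne
  · simpa using expWeight_nonneg n x
  have hIcc : J = Finset.Icc (J.min' hne) (J.max' hne) := by
    ext j
    rw [Finset.mem_Icc]
    refine ⟨fun h => ⟨J.min'_le j h, J.le_max' j h⟩, fun h => ?_⟩
    exact hJ.out (J.min'_mem hne) (J.max'_mem hne) h
  unfold expWeight
  split_ifs with h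
  · refine pow_le_pow_left₀ (norm_nonneg _) ((norm_sum_le _ _).trans ?_) 2
    simp only [Complex.norm_exp_ofReal_mul_I]
    simpa using hcard
  · push Not at h
    have hp : 0 < nint x := by
      rcases (nint_nonneg x).eq_or_lt with h0 | h0
      · rw [← h0] at h; norm_num at h
      · exact h0
    rw [le_div_iff₀ (by positivity), ← mul_pow, hIcc]
    have := norm_sum_exp_mul_nint_le (J.min' hne) (J.max' hne) x β
    exact pow_le_one₀ (by positivity) this

/-- Indices of a block differ by less than `Q`, so their signed distances from `hθ` to the nearest
integer are at least `δ` apart and lie in different cells `[bδ, (b+1)δ)`. The two cells next to `0`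
cost at most `n²` each. In any other cell `‖hθ‖ ≥ δ|b|/2`, and the costs `4/(δb)²` are summable. -/
theorem sum_expWeight_block_le : ∃ C : ℝ, 0 < C ∧ ∀ (θ δ n : ℝ) (a Q : ℕ), 0 < δ → 0 < n →
    (∀ h : ℕ, 1 ≤ h → h ≤ Q → δ ≤ nint (h * θ)) →
    ∑ h ∈ (Finset.Ico a (a + Q) : Finset ℕ), expWeight n (h * θ) ≤ C * (n ^ 2 + 1 / δ ^ 2) := by
  have hsm : Summable (fun b : ℤ => 1 / (b : ℝ) ^ 2) := Real.summable_one_div_int_pow.2 one_lt_two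
  refine ⟨2 + 4 * ∑' b : ℤ, 1 / (b : ℝ) ^ 2, ?_, ?_⟩
  · have : 0 ≤ ∑' b : ℤ, 1 / (b : ℝ) ^ 2 := tsum_nonneg fun b => by positivity
    positivity
  intro θ δ n a Q hδ hn hsep
  set x : ℕ → ℝ := fun h => h * θ - round (h * θ) with hx
  set b : ℕ → ℤ := fun h => ⌊x h / δ⌋ with hb
  -- The cells `0` and `-1` are the ones that touch `0`; for `k = 0` the second summand is `0` by
  -- the convention on division.
  set f : ℤ → ℝ := fun k => (if k = 0 ∨ k = -1 then n ^ 2 else 0) + 4 / δ ^ 2 * (1 / (k : ℝ) ^ 2)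
    with hf
  have hxb : ∀ h, (b h : ℝ) * δ ≤ x h ∧ x h < (b h + 1) * δ := by
    intro h
    constructor
    · rw [← le_div_iff₀ hδ]; exact Int.floor_le _
    · rw [← div_lt_iff₀ hδ]; exact Int.lt_floor_add_one _
  have hinj' : ∀ h h', h < h' → h' < h + Q + 1 → b h ≠ b h' := by
    intro h h' hlt hQ heq
    have h1 := hsep (h' - h) (by omega) (by omega)
    have h2 := nint_le_abs_sub_int (((h' - h : ℕ) : ℝ) * θ) (round (h' * θ) - round (h * θ))
    have h3 : ((h' - h : ℕ) : ℝ) * θ - ((round (h' * θ) - round (h * θ) : ℤ) : ℝ) = x h' - x h := by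
      rw [Nat.cast_sub hlt.le]
      simp only [hx]
      push_cast
      ring
    rw [h3] at h2
    have h4 : |x h' - x h| < δ := by
      have e1 := hxb h
      have e2 := hxb h'
      rw [heq] at e1
      rw [abs_lt]
      constructor <;> nlinarith
    linarith
  have hinj : Set.InjOn b (Finset.Ico a (a + Q) : Finset ℕ) := by
    intro h hh h' hh' heq
    simp only [Finset.coe_Ico, Set.mem_Ico] at hh hh'
    rcases lt_trichotomy h h' with hlt | he | hlt
    · exact absurd heq (hinj' h h' hlt (by omega))
    · exact he
    · exact absurd heq.symm (hinj' h' h hlt (by omega))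
  have hle : ∀ h : ℕ, expWeight n (h * θ) ≤ f (b h) := by
    intro h
    have hnx : nint (h * θ) = |x h| := rfl
    have e := hxb h
    simp only [hf]
    split_ifs with hc
    · have := expWeight_le_sq n (h * θ)
      have h0 : 0 ≤ 4 / δ ^ 2 * (1 / (b h : ℝ) ^ 2) := by positivity
      linarith
    · push Not at hc
      rw [zero_add]
      have hb0 : (b h : ℝ) ≠ 0 := by exact_mod_cast hc.1
      have hlow : δ * |(b h : ℝ)| / 2 ≤ nint (h * θ) := by
        rw [hnx]
        rcases lt_or_ge 0 (b h) with hp | hp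
        · have hp' : (1 : ℝ) ≤ b h := by exact_mod_cast hp
          rw [abs_of_pos (by linarith : (0 : ℝ) < b h)]
          refine le_trans ?_ (le_abs_self _)
          nlinarith
        · have hp' : (b h : ℝ) ≤ -2 := by
            have : b h ≤ -2 := by omega
            exact_mod_cast this
          rw [abs_of_neg (by linarith : (b h : ℝ) < 0)]
          refine le_trans ?_ (neg_le_abs _)
          nlinarith
      have habs : 0 < |(b h : ℝ)| := abs_pos.2 hb0
      refine (expWeight_le_inv hn (by positivity) hlow).trans (le_of_eq ?_)
      rw [div_pow, mul_pow, sq_abs]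
      field_simp
      norm_num
  calc ∑ h ∈ (Finset.Ico a (a + Q) : Finset ℕ), expWeight n (h * θ)
      ≤ ∑ h ∈ (Finset.Ico a (a + Q) : Finset ℕ), f (b h) := Finset.sum_le_sum fun h _ => hle h
    _ = ∑ k ∈ (Finset.Ico a (a + Q)).image b, f k := (Finset.sum_image hinj).symm
    _ ≤ 2 * n ^ 2 + 4 / δ ^ 2 * ∑' b : ℤ, 1 / (b : ℝ) ^ 2 := by
        simp only [hf]
        rw [Finset.sum_add_distrib, ← Finset.mul_sum]
        gcongr
        · rw [← Finset.sum_filter, Finset.sum_const, nsmul_eq_mul]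
          gcongr
          have : ((Finset.Ico a (a + Q)).image b).filter (fun k => k = 0 ∨ k = -1) ⊆ {0, -1} := by
            intro k hk
            simpa using (Finset.mem_filter.1 hk).2
          exact_mod_cast (Finset.card_le_card this).trans (Finset.card_le_two)
        · exact hsm.sum_le_tsum _ fun k _ => by positivity
    _ ≤ _ := by
        have : 0 ≤ ∑' b : ℤ, 1 / (b : ℝ) ^ 2 := tsum_nonneg fun b => by positivity
        have h1 : 0 ≤ 1 / δ ^ 2 := by positivity
        have h2 : 4 / δ ^ 2 = 4 * (1 / δ ^ 2) := by ring
        rw [h2]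
        nlinarith [sq_nonneg n, mul_nonneg this (sq_nonneg n)]

/-- Where `‖x‖ ≥ δ`, the length `n` may be replaced by `1 / δ`; this frees the low frequencies from
any dependence on `n`. -/
theorem expWeight_le_expWeight_inv {n δ x : ℝ} (hn : 0 < n) (hδ : 0 < δ) (h : δ ≤ nint x) :
    expWeight n x ≤ expWeight (1 / δ) x := by
  have hx : 0 < nint x := hδ.trans_le h
  refine (expWeight_le_inv hn hx le_rfl).trans ?_
  unfold expWeight
  split_ifs with hc
  · rw [div_pow, one_pow]
    exact one_div_le_one_div_of_le (by positivity) (pow_le_pow_left₀ hδ.le h 2)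
  · exact le_rfl

theorem sum_weighted_block_le {f : ℕ → ℝ} (hf : ∀ h, 0 ≤ f h) {a b : ℕ} (ha : 0 < a) :
    ∑ h ∈ (Finset.Ico a b : Finset ℕ), 1 / (h : ℝ) ^ 2 * f h
      ≤ 1 / (a : ℝ) ^ 2 * ∑ h ∈ (Finset.Ico a b : Finset ℕ), f h := by
  rw [Finset.mul_sum]
  refine Finset.sum_le_sum fun h hh => ?_
  have h1 : (a : ℝ) ≤ h := by exact_mod_cast (Finset.mem_Ico.1 hh).1
  have h2 : (0 : ℝ) < a := by exact_mod_cast ha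
  exact mul_le_mul_of_nonneg_right
    (one_div_le_one_div_of_le (by positivity) (pow_le_pow_left₀ h2.le h1 2)) (hf h)

/-- The Diophantine sum governing the mean square discrepancy. -/
theorem sum_expWeight_le : ∃ C : ℝ, 0 < C ∧ ∀ (θ n : ℝ) (K : ℕ) (δ : ℕ → ℝ), 0 < n →
    (∀ k, 0 < δ k) → (∀ k, ∀ h : ℕ, 1 ≤ h → h ≤ 2 ^ k → δ k ≤ nint (h * θ)) →
    ∀ H : ℕ, ∑ h ∈ (Finset.Ico 1 H : Finset ℕ), 1 / (h : ℝ) ^ 2 * expWeight n (h * θ)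
      ≤ C * (∑ k ∈ Finset.range (K + 1), 1 / (4 ^ k * δ k ^ 2) + n ^ 2 / 4 ^ K) := by
  obtain ⟨C, hC, hblock⟩ := sum_expWeight_block_le
  have hsm : Summable (fun b : ℕ => 1 / (b : ℝ) ^ 2) := Real.summable_one_div_nat_pow.2 one_lt_two
  set Z : ℝ := ∑' b : ℕ, 1 / (b : ℝ) ^ 2 with hZ
  have hZ0 : 0 ≤ Z := tsum_nonneg fun b => by positivity
  refine ⟨8 * C + C * Z, by positivity, ?_⟩
  intro θ n K δ hn hδ hsep H
  set T : ℕ → ℝ := fun k => 1 / (4 ^ k * δ k ^ 2) with hT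
  have hT0 : ∀ k, 0 ≤ T k := fun k => by have := hδ k; positivity
  have hw : ∀ h : ℕ, 0 ≤ 1 / (h : ℝ) ^ 2 * expWeight n (h * θ) := fun h =>
    mul_nonneg (by positivity) (expWeight_nonneg _ _)
  -- All `h` of this dyadic block are at most `2 ^ (k + 1)`, so `δ (k + 1)` bounds `‖hθ‖` from below
  -- and also separates the block.
  have hdy : ∀ k : ℕ, ∑ h ∈ (Finset.Ico (2 ^ k) (2 ^ k + 2 ^ k) : Finset ℕ),
      1 / (h : ℝ) ^ 2 * expWeight n (h * θ) ≤ 8 * C * T (k + 1) := by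
    intro k
    have h1 : ∑ h ∈ (Finset.Ico (2 ^ k) (2 ^ k + 2 ^ k) : Finset ℕ), expWeight n (h * θ)
        ≤ C * ((1 / δ (k + 1)) ^ 2 + 1 / δ (k + 1) ^ 2) := by
      refine le_trans (Finset.sum_le_sum fun h hh => ?_) (hblock θ (δ (k + 1)) (1 / δ (k + 1)) (2 ^ k)
        (2 ^ k) (hδ _) (one_div_pos.2 (hδ _)) fun h h1 h2 => hsep _ h h1 (h2.trans ?_))
      · have hh' := Finset.mem_Ico.1 hh
        refine expWeight_le_expWeight_inv hn (hδ _) (hsep _ h ?_ ?_)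
        · exact le_trans Nat.one_le_two_pow hh'.1
        · rw [pow_succ]; omega
      · exact Nat.pow_le_pow_right two_pos (Nat.le_succ k)
    refine (sum_weighted_block_le (fun h => expWeight_nonneg n (h * θ)) (by positivity)).trans ?_
    refine (mul_le_mul_of_nonneg_left h1 (by positivity)).trans (le_of_eq ?_)
    have := (hδ (k + 1)).ne'
    have e4 : (4 : ℝ) ^ (k + 1) = 4 * ((2 : ℝ) ^ k) ^ 2 := by
      rw [pow_succ, ← pow_mul, mul_comm k 2, pow_mul]; norm_num; ring
    simp only [hT]
    rw [e4]
    push_cast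
    field_simp
    ring
  have hfirst : ∀ k : ℕ, ∑ h ∈ (Finset.Ico 1 (2 ^ k) : Finset ℕ),
      1 / (h : ℝ) ^ 2 * expWeight n (h * θ) ≤ 8 * C * ∑ i ∈ Finset.range k, T (i + 1) := by
    intro k
    induction k with
    | zero => simp
    | succ k ih =>
      rw [pow_succ, mul_two, ← Finset.sum_Ico_consecutive _ Nat.one_le_two_pow (Nat.le_add_right _ _),
        Finset.sum_range_succ, mul_add]
      exact add_le_add ih (hdy k)
  -- Above `2 ^ K` the blocks keep the length `2 ^ K` and each pays `n²`; the weight on the `i`-th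
  -- block is at most `4⁻ᴷ i⁻²`, which is summable. The term `i = 0` is zero.
  have hsecond : ∀ m : ℕ, ∑ h ∈ (Finset.Ico (2 ^ K) ((m + 1) * 2 ^ K) : Finset ℕ),
      1 / (h : ℝ) ^ 2 * expWeight n (h * θ)
        ≤ C * (n ^ 2 + 1 / δ K ^ 2) / 4 ^ K * ∑ i ∈ Finset.range (m + 1), 1 / (i : ℝ) ^ 2 := by
    intro m
    induction m with
    | zero => simp
    | succ m ih =>
      rw [← Finset.sum_Ico_consecutive _ (Nat.le_mul_of_pos_left _ (Nat.succ_pos m))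
        (Nat.mul_le_mul_right _ (Nat.le_succ (m + 1))), Finset.sum_range_succ, mul_add]
      refine add_le_add ih ?_
      refine (sum_weighted_block_le (fun h => expWeight_nonneg n (h * θ)) (by positivity)).trans ?_
      have h1 := hblock θ (δ K) n ((m + 1) * 2 ^ K) (2 ^ K) (hδ K) hn (hsep K)
      rw [show (m + 1) * 2 ^ K + 2 ^ K = (m + 1 + 1) * 2 ^ K by ring] at h1
      refine (mul_le_mul_of_nonneg_left h1 (by positivity)).trans (le_of_eq ?_)
      have e4 : (4 : ℝ) ^ K = ((2 : ℝ) ^ K) ^ 2 := by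
        rw [← pow_mul, mul_comm K 2, pow_mul]; norm_num
      rw [e4]
      push_cast
      field_simp
  have hH : H ≤ (H + 1) * 2 ^ K := by nlinarith [Nat.one_le_two_pow (n := K)]
  calc ∑ h ∈ (Finset.Ico 1 H : Finset ℕ), 1 / (h : ℝ) ^ 2 * expWeight n (h * θ)
      ≤ ∑ h ∈ (Finset.Ico 1 ((H + 1) * 2 ^ K) : Finset ℕ), 1 / (h : ℝ) ^ 2 * expWeight n (h * θ) :=
        Finset.sum_le_sum_of_subset_of_nonneg (Finset.Ico_subset_Ico_right hH) fun h _ _ => hw h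
    _ = _ := (Finset.sum_Ico_consecutive _ Nat.one_le_two_pow
          (Nat.le_mul_of_pos_left _ (Nat.succ_pos H))).symm
    _ ≤ 8 * C * ∑ i ∈ Finset.range K, T (i + 1) + C * (n ^ 2 + 1 / δ K ^ 2) / 4 ^ K * Z := by
        refine add_le_add (hfirst K) ((hsecond H).trans ?_)
        have : 0 ≤ C * (n ^ 2 + 1 / δ K ^ 2) / 4 ^ K := by positivity
        exact mul_le_mul_of_nonneg_left (hsm.sum_le_tsum _ fun i _ => by positivity) this
    _ ≤ _ := by
        have h1 : ∑ i ∈ Finset.range K, T (i + 1) ≤ ∑ k ∈ Finset.range (K + 1), T k := by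
          rw [Finset.sum_range_succ' T]
          linarith [hT0 0]
        have h2 : T K ≤ ∑ k ∈ Finset.range (K + 1), T k :=
          Finset.single_le_sum (fun k _ => hT0 k) (Finset.self_mem_range_succ K)
        have h3 : C * (n ^ 2 + 1 / δ K ^ 2) / 4 ^ K * Z = C * Z * (n ^ 2 / 4 ^ K) + C * Z * T K := by
          have := (hδ K).ne'
          simp only [hT]
          field_simp
        rw [h3]
        have hCZ : 0 ≤ C * Z := by positivity
        have hn4 : 0 ≤ n ^ 2 / 4 ^ K := by positivity
        nlinarith [mul_le_mul_of_nonneg_left h1 hC.le, mul_le_mul_of_nonneg_left h2 hCZ,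
          mul_nonneg hC.le hn4]

/-- Mean square of a sum of sawtooth functions along an arithmetic progression. -/
theorem integral_sq_sum_saw_le : ∃ C : ℝ, 0 < C ∧ ∀ (θ n : ℝ) (K : ℕ) (δ : ℕ → ℝ), 0 < n →
    (∀ k, 0 < δ k) → (∀ k, ∀ h : ℕ, 1 ≤ h → h ≤ 2 ^ k → δ k ≤ nint (h * θ)) →
    ∀ (J : Finset ℤ) (β : ℝ) (f : ℤ → ℝ → ℝ), (J : Set ℤ).OrdConnected → (J.card : ℝ) ≤ n →
    ((∀ j u, f j u = saw (θ * j + β - u)) ∨ (∀ j u, f j u = saw (u - (θ * j + β)))) →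
    ∫ u in (0 : ℝ)..1, (∑ j ∈ J, f j u) ^ 2
      ≤ C * (∑ k ∈ Finset.range (K + 1), 1 / (4 ^ k * δ k ^ 2) + n ^ 2 / 4 ^ K) := by
  obtain ⟨C, hC, hle⟩ := sum_expWeight_le
  refine ⟨C, hC, ?_⟩
  intro θ n K δ hn hδ hsep J β f hJ hcard hf
  have hs := hasSum_integral_sq_sum_saw J (fun j => θ * j + β) f hf
  refine le_of_tendsto' hs.tendsto_sum_nat fun H => ?_
  refine le_trans ?_ (hle θ n K δ hn hδ hsep H)
  have hsub : (Finset.Ico 1 H : Finset ℕ) ⊆ Finset.range H := by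
    intro h hh; simp at hh ⊢; omega
  rw [← Finset.sum_subset hsub]
  · refine Finset.sum_le_sum fun h hh => ?_
    have h1 := sq_norm_sum_exp_le J hJ hcard (h * θ) (h * β)
    have e : ∀ j : ℤ, 2 * Real.pi * h * (θ * j + β) = 2 * Real.pi * (h * θ * j + h * β) := by
      intro j; ring
    simp only [e]
    have hpi : 1 / (2 * Real.pi ^ 2) ≤ 1 := by
      rw [div_le_one (by positivity)]
      nlinarith [Real.pi_gt_three]
    have h2 : 0 ≤ 1 / (h : ℝ) ^ 2 * expWeight n (h * θ) :=
      mul_nonneg (by positivity) (expWeight_nonneg _ _)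
    calc _ ≤ 1 / (2 * Real.pi ^ 2) * (1 / (h : ℝ) ^ 2 * expWeight n (h * θ)) := by gcongr
      _ ≤ _ := mul_le_of_le_one_left h2 hpi
  · intro h hh hn'
    have : h = 0 := by simp at hh hn'; omega
    simp [this]

/-! ### Sums and integrals of concave functions -/

/-- Averaging `x` with its mirror image `p + q - x` leaves the integral unchanged. Bounds on such
symmetric pairs are exactly what concavity provides. -/
theorem mul_le_integral_of_le_symm {g : ℝ → ℝ} (hg : Continuous g) {p q c : ℝ} (hpq : p ≤ q)
    (h : ∀ x ∈ Icc p q, 2 * c ≤ g x + g (p + q - x)) : c * (q - p) ≤ ∫ x in p..q, g x := by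
  have h1 : ∫ x in p..q, g (p + q - x) = ∫ x in p..q, g x := by
    rw [intervalIntegral.integral_comp_sub_left]; simp
  have h2 : ∫ x in p..q, (2 * c) ≤ ∫ x in p..q, (g x + g (p + q - x)) :=
    intervalIntegral.integral_mono_on hpq (by simp)
      (Continuous.intervalIntegrable (by fun_prop) _ _) h
  rw [intervalIntegral.integral_add (hg.intervalIntegrable _ _)
    (Continuous.intervalIntegrable (by fun_prop) _ _), h1, intervalIntegral.integral_const,
    smul_eq_mul] at h2
  linarith

theorem integral_le_mul_of_symm_le {g : ℝ → ℝ} (hg : Continuous g) {p q c : ℝ} (hpq : p ≤ q)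
    (h : ∀ x ∈ Icc p q, g x + g (p + q - x) ≤ 2 * c) : ∫ x in p..q, g x ≤ c * (q - p) := by
  have := mul_le_integral_of_le_symm (g := fun x => -g x) (c := -c) hg.neg hpq
    (fun x hx => by linarith [h x hx])
  rw [intervalIntegral.integral_neg] at this
  linarith

/-- For a concave Lipschitz function, the sum of the positive part over the integers differs from its
integral by a multiple of the Lipschitz constant. -/
theorem abs_sum_sub_integral_le_of_concave {h : ℝ → ℝ} (hc : ConcaveOn ℝ univ h) {L : ℝ}
    (hL : ∀ x y, |h x - h y| ≤ L * |x - y|) {H : ℕ} (hH : ∀ y, 0 ≤ h y → |y| ≤ H - 1) :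
    |∑ j ∈ Finset.Icc (-(H : ℤ)) H, max (h j) 0 - ∫ y in (-(H : ℝ))..H, max (h y) 0| ≤ 4 * L := by
  have hL0 : 0 ≤ L := by
    have := hL 1 0
    norm_num at this
    exact (abs_nonneg _).trans this
  have hlip : LipschitzWith L.toNNReal h := LipschitzWith.of_dist_le_mul fun x y => by
    rw [Real.dist_eq, Real.dist_eq, Real.coe_toNNReal _ hL0]; exact hL x y
  have hcont : Continuous h := hlip.continuous
  set g : ℝ → ℝ := fun y => max (h y) 0 with hg
  have hgc : Continuous g := hcont.max continuous_const
  have hg0 : ∀ y, 0 ≤ g y := fun y => le_max_right _ _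
  have hgL : ∀ x y, g x ≤ g y + L * |x - y| := by
    intro x y
    have h1 := (abs_le.1 (abs_max_sub_max_le_abs (h x) (h y) 0)).2
    have h2 := hL x y
    simp only [hg]
    linarith
  set S : Set ℝ := {y | 0 ≤ h y} with hS
  have hgz : ∀ y, y ∉ S → g y = 0 := fun y hy => max_eq_right (not_le.1 hy).le
  rcases S.eq_empty_or_nonempty with hemp | hne
  · have : ∀ y, g y = 0 := fun y => hgz y (by simp [hemp])
    change |∑ j ∈ Finset.Icc (-(H : ℤ)) H, g j - ∫ y in (-(H : ℝ))..H, g y| ≤ 4 * L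
    simp [this, hL0]
  have hSc : IsCompact S := by
    refine (isCompact_Icc (a := -((H : ℝ) - 1)) (b := H - 1)).of_isClosed_subset
      (isClosed_le continuous_const hcont) fun y hy => ?_
    exact abs_le.1 (hH y hy)
  set A := sInf S with hA
  set B := sSup S with hB
  have hAS : A ∈ S := hSc.sInf_mem hne
  have hBS : B ∈ S := hSc.sSup_mem hne
  have hle : ∀ y ∈ S, A ≤ y ∧ y ≤ B := fun y hy =>
    ⟨csInf_le hSc.bddBelow hy, le_csSup hSc.bddAbove hy⟩
  have hmem : ∀ y, A ≤ y → y ≤ B → y ∈ S := by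
    intro y h1 h2
    have := (hc.convex_ge 0).ordConnected.out (x := A) ⟨mem_univ _, hAS⟩ (y := B) ⟨mem_univ _, hBS⟩
      ⟨h1, h2⟩
    exact this.2
  have hAH := abs_le.1 (hH A hAS)
  have hBH := abs_le.1 (hH B hBS)
  have hAB := (hle A hAS).2
  -- The integers of the support `[A, B]` are `a, …, a + n - 1`. Between the first and the last of
  -- them `g` is the concave function `h`, while `g` vanishes at `a - 1` and at `a + n`.
  set a := ⌈A⌉ with ha
  have ha1 : A ≤ a := Int.le_ceil A
  have ha2 : (a : ℝ) - 1 < A := by linarith [Int.ceil_lt_add_one A]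
  obtain ⟨n, hn⟩ : ∃ n : ℕ, ⌊B⌋ + 1 = a + n := by
    have : a ≤ ⌊B⌋ + 1 := by
      rw [ha, Int.ceil_le]
      push_cast
      linarith [Int.lt_floor_add_one B]
    exact ⟨(⌊B⌋ + 1 - a).toNat, by omega⟩
  have hb : (⌊B⌋ : ℝ) = a + n - 1 := by
    have : ((⌊B⌋ + 1 : ℤ) : ℝ) = ((a + n : ℤ) : ℝ) := by rw [hn]
    push_cast at this
    linarith
  have hb1 : (a : ℝ) + n - 1 ≤ B := by rw [← hb]; exact Int.floor_le B
  have hb2 : B < a + n := by have := Int.lt_floor_add_one B; rw [hb] at this; linarith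
  have hlow : ∀ y : ℝ, y ≤ a - 1 → g y = 0 := fun y hy => hgz y fun hy' => by
    linarith [(hle y hy').1]
  have hhigh : ∀ y : ℝ, (a : ℝ) + n ≤ y → g y = 0 := fun y hy => hgz y fun hy' => by
    linarith [(hle y hy').2]
  have hin : ∀ y : ℝ, (a : ℝ) ≤ y → y ≤ a + n - 1 → g y = h y := fun y h1 h2 =>
    max_eq_left (hmem y (by linarith) (by linarith))
  have hii : ∀ p q, IntervalIntegrable g volume p q := fun p q => hgc.intervalIntegrable p q
  have hsum : ∑ j ∈ Finset.Icc (-(H : ℤ)) H, g j = ∑ k ∈ Finset.range n, g (a + k) := by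
    have h1 : ∑ k ∈ Finset.range n, g (a + k)
        = ∑ j ∈ (Finset.range n).image (fun k : ℕ => a + k), g j := by
      rw [Finset.sum_image (fun x _ y _ hxy => by simpa using hxy)]
      simp
    rw [h1]
    symm
    apply Finset.sum_subset
    · intro j hj
      obtain ⟨k, hk, rfl⟩ := Finset.mem_image.1 hj
      have hk' : (k : ℝ) + 1 ≤ n := by exact_mod_cast Finset.mem_range.1 hk
      rw [Finset.mem_Icc]
      have e1 : (-(H : ℝ)) ≤ ((a + k : ℤ) : ℝ) := by
        push_cast; linarith [(Nat.cast_nonneg k : (0 : ℝ) ≤ k)]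
      have e2 : ((a + k : ℤ) : ℝ) ≤ (H : ℝ) := by push_cast; linarith
      exact ⟨by exact_mod_cast e1, by exact_mod_cast e2⟩
    · intro j _ hj
      by_contra hne0
      apply hj
      have h1 : (a : ℝ) - 1 < j := by
        by_contra hh; exact hne0 (hlow _ (not_lt.1 hh))
      have h2 : (j : ℝ) < a + n := by
        by_contra hh; exact hne0 (hhigh _ (not_lt.1 hh))
      have h1' : a - 1 < j := by exact_mod_cast h1
      have h2' : j < a + n := by exact_mod_cast h2
      exact Finset.mem_image.2 ⟨(j - a).toNat, by simp; omega, by omega⟩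
  have hHl : -(H : ℝ) ≤ a - 1 := by linarith
  have hint : ∫ y in (-(H : ℝ))..H, g y = ∫ y in ((a : ℝ) - 1)..(a + n), g y := by
    rw [← intervalIntegral.integral_add_adjacent_intervals (hii (-(H : ℝ)) (a - 1)) (hii _ H),
      ← intervalIntegral.integral_add_adjacent_intervals (hii ((a : ℝ) - 1) (a + n)) (hii _ H)]
    have e1 : ∫ y in (-(H : ℝ))..(a - 1), g y = 0 := by
      rw [intervalIntegral.integral_congr (g := fun _ => (0 : ℝ)), intervalIntegral.integral_zero]
      intro y hy
      rw [uIcc_of_le hHl] at hy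
      exact hlow y hy.2
    have e2 : ∫ y in ((a : ℝ) + n)..H, g y = 0 := by
      rw [intervalIntegral.integral_congr (g := fun _ => (0 : ℝ)), intervalIntegral.integral_zero]
      intro y hy
      rw [uIcc_of_le (by linarith)] at hy
      exact hhigh y hy.1
    rw [e1, e2, zero_add, add_zero]
  change |∑ j ∈ Finset.Icc (-(H : ℤ)) H, g j - ∫ y in (-(H : ℝ))..H, g y| ≤ 4 * L
  rw [hsum, hint]
  have hga : g (a - 1) = 0 := hlow _ le_rfl
  have hgb : g (a + n) = 0 := hhigh _ le_rfl
  -- If the support contains no integer, the sum is empty, and the integral is taken over a unit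
  -- interval at whose end `g` vanishes.
  rcases Nat.eq_zero_or_pos n with hn0 | hnpos
  · subst hn0
    have h1 : ∫ y in ((a : ℝ) - 1)..(a + (0 : ℕ)), g y ≤ L * ((a + (0 : ℕ)) - (a - 1)) := by
      refine integral_le_mul_of_symm_le hgc (by simp) fun x hx => ?_
      have hx1 := hx.1
      have hx2 := hx.2
      push_cast at hx2 ⊢
      have e1 := hgL x (a - 1)
      have e2 := hgL ((a : ℝ) - 1 + (a + 0) - x) (a - 1)
      rw [hga, abs_of_nonneg (by linarith)] at e1 e2
      nlinarith
    have h2 : 0 ≤ ∫ y in ((a : ℝ) - 1)..(a + (0 : ℕ)), g y :=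
      intervalIntegral.integral_nonneg (by simp) fun x _ => hg0 x
    rw [Finset.range_zero, Finset.sum_empty, zero_sub, abs_neg, abs_of_nonneg h2]
    push_cast at h1 ⊢
    linarith
  obtain ⟨m, rfl⟩ : ∃ m, n = m + 1 := ⟨n - 1, by omega⟩
  push_cast at *
  have hgaL : g a ≤ L := by
    have := hgL a (a - 1)
    rw [hga, show (a : ℝ) - (a - 1) = 1 by ring, abs_one] at this
    linarith
  have hgbL : g (a + m) ≤ L := by
    have := hgL (a + m) (a + (m + 1))
    rw [hgb, show (a : ℝ) + m - (a + (m + 1)) = -1 by ring, abs_neg, abs_one] at this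
    linarith
  have hmid : ∀ x y c, x + y = 2 * c → h x + h y ≤ 2 * h c := by
    intro x y c hxy
    have := hc.2 (mem_univ x) (mem_univ y) (show (0 : ℝ) ≤ 1 / 2 by norm_num)
      (show (0 : ℝ) ≤ 1 / 2 by norm_num) (by norm_num)
    simp only [smul_eq_mul] at this
    rw [show 1 / 2 * x + 1 / 2 * y = c by linarith] at this
    linarith
  have hend : ∀ x y t, 0 ≤ t → t ≤ 1 →
      h x + h y ≤ h (x + t * (y - x)) + h (y - t * (y - x)) := by
    intro x y t h0 h1
    have e1 := hc.2 (mem_univ x) (mem_univ y) (show 0 ≤ 1 - t by linarith) h0 (by ring)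
    have e2 := hc.2 (mem_univ x) (mem_univ y) h0 (show 0 ≤ 1 - t by linarith) (by ring)
    simp only [smul_eq_mul] at e1 e2
    rw [show (1 - t) * x + t * y = x + t * (y - x) by ring] at e1
    rw [show t * x + (1 - t) * y = y - t * (y - x) by ring] at e2
    linarith
  rw [abs_le]
  constructor
  · -- the midpoint rule
    have hk : ∀ k ∈ Finset.range (m + 1),
        ∫ y in ((a : ℝ) - 1 / 2 + (k : ℕ))..(a - 1 / 2 + (k + 1 : ℕ)), g y
          ≤ g (a + k) + ((if k = 0 then L else 0) + if k = m then L else 0) := by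
      intro k hkm
      have hkm' : (k : ℝ) ≤ m := by exact_mod_cast Nat.lt_succ_iff.1 (Finset.mem_range.1 hkm)
      have hk0 : (0 : ℝ) ≤ k := Nat.cast_nonneg k
      set c := g (a + k) + ((if k = 0 then L else 0) + if k = m then L else 0) with hcdef
      have := integral_le_mul_of_symm_le (c := c) hgc
        (p := (a : ℝ) - 1 / 2 + (k : ℕ)) (q := a - 1 / 2 + (k + 1 : ℕ)) (by push_cast; linarith) ?_
      · refine this.trans (le_of_eq ?_)
        push_cast
        ring
      · intro x hx
        have hx1 := hx.1
        have hx2 := hx.2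
        push_cast at hx2 ⊢
        -- Only the first and the last cell can leave the range on which `g` is concave; each is
        -- granted an error `L` by the Lipschitz bound.
        by_cases hk' : k = 0 ∨ k = m
        · have e1 := hgL x (a + k)
          have e2 := hgL (a - 1 / 2 + k + (a - 1 / 2 + (k + 1)) - x) (a + k)
          have e3 : |x - (a + k)| ≤ 1 / 2 := by rw [abs_le]; constructor <;> linarith
          have e4 : |a - 1 / 2 + k + (a - 1 / 2 + (k + 1)) - x - (a + k)| ≤ 1 / 2 := by
            rw [abs_le]; constructor <;> linarith
          have e5 : g (a + k) + L ≤ c := by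
            rw [hcdef]
            rcases hk' with h0 | h0 <;> simp only [h0, if_true] <;> split_ifs <;> linarith
          nlinarith
        · push Not at hk'
          have e5 : c = g (a + k) := by simp [hcdef, hk'.1, hk'.2]
          have e6 : (1 : ℝ) ≤ k := by exact_mod_cast Nat.one_le_iff_ne_zero.2 hk'.1
          have e7 : (k : ℝ) + 1 ≤ m := by
            have : k < m := lt_of_le_of_ne (by exact_mod_cast hkm') hk'.2
            exact_mod_cast this
          rw [e5, hin _ (by linarith) (by linarith), hin _ (by linarith) (by linarith),
            hin _ (by linarith) (by linarith)]
          exact hmid _ _ _ (by ring)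
    have hsumint := intervalIntegral.sum_integral_adjacent_intervals
      (a := fun k : ℕ => (a : ℝ) - 1 / 2 + k) (n := m + 1) (f := g) (μ := volume)
      (fun k _ => hii _ _)
    have htot := Finset.sum_le_sum hk
    rw [hsumint, Finset.sum_add_distrib, Finset.sum_add_distrib, Finset.sum_ite_eq',
      Finset.sum_ite_eq', if_pos (by simp), if_pos (by simp)] at htot
    rw [← intervalIntegral.integral_add_adjacent_intervals (hii ((a : ℝ) - 1) (a - 1 / 2 + (0 : ℕ)))
      (hii _ (a + (m + 1))),
      ← intervalIntegral.integral_add_adjacent_intervals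
        (hii ((a : ℝ) - 1 / 2 + (0 : ℕ)) (a - 1 / 2 + (m + 1 : ℕ))) (hii _ (a + (m + 1)))]
    have o1 : ∫ y in ((a : ℝ) - 1)..(a - 1 / 2 + (0 : ℕ)), g y
        ≤ L * (a - 1 / 2 + (0 : ℕ) - (a - 1)) := by
      refine integral_le_mul_of_symm_le hgc (by push_cast; linarith) fun x hx => ?_
      have hx1 := hx.1
      have hx2 := hx.2
      push_cast at hx2 ⊢
      have e1 := hgL x (a - 1)
      have e2 := hgL ((a : ℝ) - 1 + (a - 1 / 2 + 0) - x) (a - 1)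
      rw [hga, abs_of_nonneg (by linarith)] at e1 e2
      nlinarith
    have o2 : ∫ y in ((a : ℝ) - 1 / 2 + (m + 1 : ℕ))..(a + (m + 1)), g y
        ≤ L * (a + (m + 1) - (a - 1 / 2 + (m + 1 : ℕ))) := by
      refine integral_le_mul_of_symm_le hgc (by push_cast; linarith) fun x hx => ?_
      have hx1 := hx.1
      have hx2 := hx.2
      push_cast at hx1 ⊢
      have e1 := hgL x (a + (m + 1))
      have e2 := hgL ((a : ℝ) - 1 / 2 + (m + 1) + (a + (m + 1)) - x) (a + (m + 1))
      rw [hgb, abs_of_nonpos (by linarith)] at e1 e2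
      nlinarith
    push_cast at htot o1 o2 ⊢
    linarith
  · -- the trapezoidal rule
    have hk : ∀ k ∈ Finset.range m, (g (a + k) + g (a + k + 1)) / 2
        ≤ ∫ y in ((a : ℝ) + (k : ℕ))..(a + (k + 1 : ℕ)), g y := by
      intro k hkm
      have hkm' : (k : ℝ) + 1 ≤ m := by exact_mod_cast Finset.mem_range.1 hkm
      have hk0 : (0 : ℝ) ≤ k := Nat.cast_nonneg k
      have := mul_le_integral_of_le_symm (c := (g (a + k) + g (a + k + 1)) / 2) hgc
        (p := (a : ℝ) + (k : ℕ)) (q := a + (k + 1 : ℕ)) (by push_cast; linarith) ?_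
      · refine le_trans (le_of_eq ?_) this
        push_cast
        ring
      · intro x hx
        have hx1 := hx.1
        have hx2 := hx.2
        push_cast at hx2 ⊢
        rw [hin _ (by linarith) (by linarith), hin _ (by linarith) (by linarith),
          hin _ (by linarith) (by linarith), hin _ (by linarith) (by linarith)]
        have := hend (a + k) (a + k + 1) (x - (a + k)) (by linarith) (by linarith)
        rw [show (a : ℝ) + k + (x - (a + k)) * (a + k + 1 - (a + k)) = x by ring,
          show (a : ℝ) + k + 1 - (x - (a + k)) * (a + k + 1 - (a + k))
            = a + k + (a + (k + 1)) - x by ring] at this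
        linarith
    have hsumint := intervalIntegral.sum_integral_adjacent_intervals
      (a := fun k : ℕ => (a : ℝ) + k) (n := m) (f := g) (μ := volume)
      (fun k _ => hii _ _)
    have htot := Finset.sum_le_sum hk
    rw [hsumint, ← Finset.sum_div, Finset.sum_add_distrib] at htot
    have s1 := Finset.sum_range_succ (fun k : ℕ => g (a + k)) m
    have s2 := Finset.sum_range_succ' (fun k : ℕ => g (a + k)) m
    have s3 : ∑ k ∈ Finset.range m, g (a + (k + 1 : ℕ)) = ∑ k ∈ Finset.range m, g (a + k + 1) := by
      refine Finset.sum_congr rfl fun k _ => ?_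
      push_cast
      rw [add_assoc]
    rw [s3] at s2
    have o : ∫ y in ((a : ℝ) + (0 : ℕ))..(a + (m : ℕ)), g y
        ≤ ∫ y in ((a : ℝ) - 1)..(a + (m + 1)), g y :=
      intervalIntegral.integral_mono_interval (by push_cast; linarith) (by push_cast; linarith)
        (by linarith) (Filter.Eventually.of_forall fun x => hg0 x) (hii _ _)
    push_cast at s2 o htot
    rw [add_zero] at s2
    linarith

/-! ### Lattice points in intersections of strips -/

section Strips

variable {ι : Type*} [Fintype ι]

/-- Selecting a minimal one among finitely many affine functions, in such a way that each of them
is selected on an interval. -/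
theorem exists_selection_affine [LinearOrder ι] [Nonempty ι] (θ β : ι → ℝ) :
    ∃ e : ℤ → ι, (∀ (j : ℤ) i, θ (e j) * j + β (e j) ≤ θ i * j + β i) ∧
      ∀ i, {j | e j = i}.OrdConnected := by
  classical
  set M : ℤ → Finset ι := fun j =>
    Finset.univ.filter fun i => ∀ i', θ i * j + β i ≤ θ i' * j + β i' with hM
  have hne : ∀ j, (M j).Nonempty := fun j => by
    obtain ⟨i, hi⟩ := Finite.exists_min fun i => θ i * (j : ℝ) + β i
    exact ⟨i, by simpa [hM] using hi⟩
  have hmem : ∀ j i, i ∈ M j ↔ ∀ i', θ i * j + β i ≤ θ i' * j + β i' := fun j i => by simp [hM]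
  -- Ties are broken by the order of `ι`; an arbitrary choice among minimizers would not give
  -- intervals.
  refine ⟨fun j => (M j).min' (hne j), fun j i => (hmem j _).1 ((M j).min'_mem (hne j)) i,
    fun i => ⟨?_⟩⟩
  rintro a ha b hb j ⟨hj1, hj2⟩
  have ha' : (M a).min' (hne a) = i := ha
  have hb' : (M b).min' (hne b) = i := hb
  have hj1' : (a : ℝ) ≤ j := by exact_mod_cast hj1
  have hj2' : (j : ℝ) ≤ b := by exact_mod_cast hj2
  have hia := (hmem a i).1 (ha' ▸ (M a).min'_mem (hne a))
  have hib := (hmem b i).1 (hb' ▸ (M b).min'_mem (hne b))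
  have hij : i ∈ M j := (hmem j i).2 fun i' => by
    -- The difference of two affine functions is monotone, so the comparison at `a` or the one at
    -- `b` carries over to `j`.
    rcases le_total (θ i) (θ i') with h | h
    · nlinarith [hia i']
    · nlinarith [hib i']
  refine le_antisymm ((M j).min'_le i hij) ?_
  by_contra hlt
  push Not at hlt
  set k := (M j).min' (hne j) with hk
  have hkj := (hmem j k).1 ((M j).min'_mem (hne j))
  have hka : θ i * a + β i < θ k * a + β k := by
    refine lt_of_le_of_ne (hia k) fun heq => ?_
    have : k ∈ M a := (hmem a k).2 fun i' => heq ▸ hia i'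
    exact absurd ((M a).min'_le k this) (by rw [ha']; exact not_le.2 hlt)
  have hkb : θ i * b + β i < θ k * b + β k := by
    refine lt_of_le_of_ne (hib k) fun heq => ?_
    have : k ∈ M b := (hmem b k).2 fun i' => heq ▸ hib i'
    exact absurd ((M b).min'_le k this) (by rw [hb']; exact not_le.2 hlt)
  have := hkj i
  rcases le_total (θ i) (θ k) with h | h
  · nlinarith
  · nlinarith

/-- Mean squares of sums of sawtooth functions along a piecewise affine sequence. -/
theorem integral_sq_sum_saw_selection_le [DecidableEq ι] {B : ℝ} (J : Finset ℤ)
    (hJ : (J : Set ℤ).OrdConnected) (e : ℤ → ι) (he : ∀ i, {j | e j = i}.OrdConnected)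
    (f : ι → ℤ → ℝ → ℝ) (hf : ∀ i j, Measurable (f i j)) (hf1 : ∀ i j u, |f i j u| ≤ 1)
    (hB : ∀ i, ∀ J' ⊆ J, (J' : Set ℤ).OrdConnected →
      ∫ u in (0 : ℝ)..1, (∑ j ∈ J', f i j u) ^ 2 ≤ B) :
    ∫ u in (0 : ℝ)..1, (∑ j ∈ J, f (e j) j u) ^ 2 ≤ (Fintype.card ι : ℝ) ^ 2 * B := by
  have hfib : ∀ u, ∑ j ∈ J, f (e j) j u = ∑ i, ∑ j ∈ J with e j = i, f i j u := by
    intro u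
    rw [← Finset.sum_fiberwise_of_maps_to (t := Finset.univ) (g := e) (fun j _ => Finset.mem_univ _)]
    refine Finset.sum_congr rfl fun i _ => Finset.sum_congr rfl fun j hj => ?_
    rw [(Finset.mem_filter.1 hj).2]
  have hint : ∀ i, IntervalIntegrable (fun u => (∑ j ∈ J with e j = i, f i j u) ^ 2) volume 0 1 := by
    intro i
    refine intervalIntegrable_of_bounded (C := (J.card : ℝ) ^ 2)
      ((Finset.measurable_sum _ fun j _ => hf i j).pow_const 2) (fun u => ?_) _ _
    rw [abs_pow]
    refine pow_le_pow_left₀ (abs_nonneg _) ((Finset.abs_sum_le_sum_abs _ _).trans ?_) 2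
    refine (Finset.sum_le_sum fun j _ => hf1 i j u).trans ?_
    rw [Finset.sum_const, nsmul_eq_mul, mul_one]
    exact_mod_cast Finset.card_filter_le _ _
  calc ∫ u in (0 : ℝ)..1, (∑ j ∈ J, f (e j) j u) ^ 2
      ≤ ∫ u in (0 : ℝ)..1, (Fintype.card ι : ℝ) * ∑ i, (∑ j ∈ J with e j = i, f i j u) ^ 2 := by
        refine intervalIntegral.integral_mono_on zero_le_one ?_ ?_ fun u _ => ?_
        · refine intervalIntegrable_of_bounded (C := (J.card : ℝ) ^ 2)
            ((Finset.measurable_sum _ fun j _ => hf (e j) j).pow_const 2) (fun u => ?_) _ _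
          rw [abs_pow]
          refine pow_le_pow_left₀ (abs_nonneg _) ((Finset.abs_sum_le_sum_abs _ _).trans ?_) 2
          refine (Finset.sum_le_sum fun j _ => hf1 (e j) j u).trans ?_
          rw [Finset.sum_const, nsmul_eq_mul, mul_one]
        · refine IntervalIntegrable.const_mul ?_ _
          simpa only [Finset.sum_fn] using IntervalIntegrable.sum Finset.univ fun i _ => hint i
        · rw [hfib]
          exact sq_sum_le_card_mul_sum_sq
    _ = (Fintype.card ι : ℝ) * ∑ i, ∫ u in (0 : ℝ)..1, (∑ j ∈ J with e j = i, f i j u) ^ 2 := by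
        rw [intervalIntegral.integral_const_mul, intervalIntegral.integral_finsetSum fun i _ => hint i]
    _ ≤ (Fintype.card ι : ℝ) * ∑ _i : ι, B := by
        gcongr with i
        refine hB i _ (Finset.filter_subset _ _) ?_
        rw [Finset.coe_filter]
        exact hJ.inter (he i)
    _ = _ := by
        rw [Finset.sum_const, nsmul_eq_mul, Finset.card_univ]
        ring

/-- An intersection of strips, none of them horizontal. -/
def stripSet (θ lo hi : ι → ℝ) : Set (ℝ × ℝ) :=
  {p | ∀ e, θ e * p.2 + lo e ≤ p.1 ∧ p.1 ≤ θ e * p.2 + hi e}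

/-- The right end of the horizontal section of an intersection of strips. -/
noncomputable def rightEnd [Nonempty ι] (θ hi : ι → ℝ) (y : ℝ) : ℝ :=
  Finset.univ.inf' Finset.univ_nonempty fun e => θ e * y + hi e

theorem le_rightEnd [Nonempty ι] {θ hi : ι → ℝ} {x y : ℝ} :
    x ≤ rightEnd θ hi y ↔ ∀ e, x ≤ θ e * y + hi e := by
  simp [rightEnd]

theorem rightEnd_le [Nonempty ι] (θ hi : ι → ℝ) (y : ℝ) (e : ι) :
    rightEnd θ hi y ≤ θ e * y + hi e := le_rightEnd.1 le_rfl e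

/-- The left end of the horizontal section of an intersection of strips. -/
noncomputable def leftEnd [Nonempty ι] (θ lo : ι → ℝ) (y : ℝ) : ℝ :=
  -rightEnd (fun e => -θ e) (fun e => -lo e) y

theorem leftEnd_le [Nonempty ι] {θ lo : ι → ℝ} {x y : ℝ} :
    leftEnd θ lo y ≤ x ↔ ∀ e, θ e * y + lo e ≤ x := by
  rw [leftEnd, neg_le, le_rightEnd]
  refine forall_congr' fun e => ?_
  constructor <;> intro h <;> linarith

theorem mem_stripSet_iff [Nonempty ι] {θ lo hi : ι → ℝ} {p : ℝ × ℝ} :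
    p ∈ stripSet θ lo hi ↔ leftEnd θ lo p.2 ≤ p.1 ∧ p.1 ≤ rightEnd θ hi p.2 := by
  rw [leftEnd_le, le_rightEnd]
  exact forall_and

theorem concaveOn_rightEnd [Nonempty ι] (θ hi : ι → ℝ) : ConcaveOn ℝ univ (rightEnd θ hi) := by
  refine ⟨convex_univ, fun x _ y _ a b ha hb hab => ?_⟩
  simp only [smul_eq_mul]
  rw [le_rightEnd]
  intro e
  have hx := mul_le_mul_of_nonneg_left (rightEnd_le θ hi x e) ha
  have hy := mul_le_mul_of_nonneg_left (rightEnd_le θ hi y e) hb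
  have : θ e * (a * x + b * y) + hi e = a * (θ e * x + hi e) + b * (θ e * y + hi e) := by
    linear_combination (-hi e) * hab
  linarith

theorem abs_rightEnd_sub_le [Nonempty ι] {θ hi : ι → ℝ} {L : ℝ} (hL : ∀ e, |θ e| ≤ L) (x y : ℝ) :
    |rightEnd θ hi x - rightEnd θ hi y| ≤ L * |x - y| := by
  have key : ∀ x y, rightEnd θ hi x - L * |x - y| ≤ rightEnd θ hi y := by
    intro x y
    rw [le_rightEnd]
    intro e
    have h1 := rightEnd_le θ hi x e
    have h2 : θ e * (x - y) ≤ L * |x - y| :=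
      (le_abs_self _).trans (by rw [abs_mul]; exact mul_le_mul_of_nonneg_right (hL e) (abs_nonneg _))
    linarith
  have h1 := key x y
  have h2 := key y x
  rw [abs_sub_comm y x] at h2
  rw [abs_le]
  constructor <;> linarith

theorem abs_leftEnd_sub_le [Nonempty ι] {θ lo : ι → ℝ} {L : ℝ} (hL : ∀ e, |θ e| ≤ L) (x y : ℝ) :
    |leftEnd θ lo x - leftEnd θ lo y| ≤ L * |x - y| := by
  have := abs_rightEnd_sub_le (θ := fun e => -θ e) (hi := fun e => -lo e) (L := L)
    (by simpa using hL) x y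
  unfold leftEnd
  rwa [neg_sub_neg, abs_sub_comm]

theorem continuous_of_abs_sub_le {f : ℝ → ℝ} {L : ℝ} (hL : ∀ x y, |f x - f y| ≤ L * |x - y|) :
    Continuous f := by
  have hL0 : 0 ≤ L := by
    have := hL 1 0
    norm_num at this
    exact (abs_nonneg _).trans this
  refine LipschitzWith.continuous (K := L.toNNReal) (LipschitzWith.of_dist_le_mul fun x y => ?_)
  rw [Real.dist_eq, Real.dist_eq, Real.coe_toNNReal _ hL0]
  exact hL x y

/-- The length of the horizontal section of an intersection of strips; negative if there is none. -/
noncomputable def sectionLength [Nonempty ι] (θ lo hi : ι → ℝ) (y : ℝ) : ℝ :=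
  rightEnd θ hi y - leftEnd θ lo y

theorem exists_mem_stripSet_iff [Nonempty ι] {θ lo hi : ι → ℝ} {y : ℝ} :
    (∃ x, (x, y) ∈ stripSet θ lo hi) ↔ 0 ≤ sectionLength θ lo hi y := by
  simp only [mem_stripSet_iff, sectionLength, sub_nonneg]
  exact ⟨fun ⟨x, h⟩ => h.1.trans h.2, fun h => ⟨_, le_rfl, h⟩⟩

theorem concaveOn_sectionLength [Nonempty ι] (θ lo hi : ι → ℝ) :
    ConcaveOn ℝ univ (sectionLength θ lo hi) := by
  have := (concaveOn_rightEnd θ hi).add (concaveOn_rightEnd (fun e => -θ e) (fun e => -lo e))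
  refine this.congr fun y _ => ?_
  simp [sectionLength, leftEnd]

theorem abs_sectionLength_sub_le [Nonempty ι] {θ lo hi : ι → ℝ} {L : ℝ} (hL : ∀ e, |θ e| ≤ L)
    (x y : ℝ) : |sectionLength θ lo hi x - sectionLength θ lo hi y| ≤ 2 * L * |x - y| := by
  have h1 := abs_rightEnd_sub_le (hi := hi) hL x y
  have h2 := abs_leftEnd_sub_le (lo := lo) hL x y
  unfold sectionLength
  calc _ = |(rightEnd θ hi x - rightEnd θ hi y) - (leftEnd θ lo x - leftEnd θ lo y)| := by
        congr 1; ring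
    _ ≤ _ := (abs_sub _ _).trans (by linarith)

/-- The area of an intersection of strips. -/
theorem volume_stripSet [Nonempty ι] (θ lo hi : ι → ℝ) {H : ℕ}
    (hH : ∀ p ∈ stripSet θ lo hi, |p.2| ≤ H) :
    (volume (stripSet θ lo hi)).toReal
      = ∫ y in (-(H : ℝ))..H, max (sectionLength θ lo hi y) 0 := by
  obtain ⟨L, hL⟩ : ∃ L, ∀ e, |θ e| ≤ L := by
    obtain ⟨e, he⟩ := Finite.exists_max fun e => |θ e|
    exact ⟨_, he⟩
  have hcl : Continuous (leftEnd θ lo) := continuous_of_abs_sub_le (abs_leftEnd_sub_le hL)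
  have hcr : Continuous (rightEnd θ hi) := continuous_of_abs_sub_le (abs_rightEnd_sub_le hL)
  have hcs : Continuous (sectionLength θ lo hi) := hcr.sub hcl
  have heq : stripSet θ lo hi = {p | leftEnd θ lo p.2 ≤ p.1 ∧ p.1 ≤ rightEnd θ hi p.2} := by
    ext p; exact mem_stripSet_iff
  have hmeas : MeasurableSet (stripSet θ lo hi) := by
    rw [heq]
    exact ((isClosed_le (hcl.comp continuous_snd) continuous_fst).inter
      (isClosed_le continuous_fst (hcr.comp continuous_snd))).measurableSet
  have hle : -(H : ℝ) ≤ H := by linarith [(Nat.cast_nonneg H : (0 : ℝ) ≤ H)]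
  have hslice : ∀ y : ℝ, volume ((fun x : ℝ => (x, y)) ⁻¹' stripSet θ lo hi)
      = (Icc (-(H : ℝ)) H).indicator (fun y => ENNReal.ofReal (max (sectionLength θ lo hi y) 0)) y := by
    intro y
    have h1 : (fun x : ℝ => (x, y)) ⁻¹' stripSet θ lo hi = Icc (leftEnd θ lo y) (rightEnd θ hi y) := by
      rw [heq]; ext x; simp
    rw [h1, Real.volume_Icc]
    by_cases hy : y ∈ Icc (-(H : ℝ)) H
    · rw [indicator_of_mem hy]
      unfold sectionLength
      rcases le_total 0 (rightEnd θ hi y - leftEnd θ lo y) with h | h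
      · rw [max_eq_left h]
      · rw [max_eq_right h, ENNReal.ofReal_zero, ENNReal.ofReal_of_nonpos h]
    · rw [indicator_of_notMem hy]
      apply ENNReal.ofReal_of_nonpos
      by_contra hpos
      push Not at hpos
      obtain ⟨x, hx⟩ := exists_mem_stripSet_iff.2 (hpos.le : 0 ≤ sectionLength θ lo hi y)
      exact hy (abs_le.1 (hH _ hx))
  rw [Measure.volume_eq_prod, Measure.prod_apply_symm hmeas]
  simp only [hslice]
  rw [lintegral_indicator measurableSet_Icc, intervalIntegral.integral_of_le hle,
    ← integral_Icc_eq_integral_Ioc, integral_eq_lintegral_of_nonneg_ae]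
  · exact Filter.Eventually.of_forall fun y => le_max_right _ _
  · exact (hcs.max continuous_const).aestronglyMeasurable

/-- Counting the integers in a shifted interval. -/
theorem card_filter_shift_eq {l r u : ℝ} {H : ℕ} (hlr : l ≤ r) (hl : -(H : ℝ) ≤ l - u)
    (hr : r - u ≤ H) :
    (((Finset.Icc (-(H : ℤ)) H).filter fun i : ℤ => l ≤ i + u ∧ i + u ≤ r).card : ℝ)
      = r - l - saw (r - u) - saw (u - l) := by
  have h1 : (Finset.Icc (-(H : ℤ)) H).filter (fun i : ℤ => l ≤ i + u ∧ i + u ≤ r)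
      = Finset.Icc ⌈l - u⌉ ⌊r - u⌋ := by
    ext i
    simp only [Finset.mem_filter, Finset.mem_Icc, Int.ceil_le, Int.le_floor]
    constructor
    · rintro ⟨_, h2, h3⟩
      exact ⟨by linarith, by linarith⟩
    · rintro ⟨h2, h3⟩
      refine ⟨⟨?_, ?_⟩, by linarith, by linarith⟩
      · have : ((-(H : ℤ) : ℤ) : ℝ) ≤ i := by push_cast; linarith
        exact_mod_cast this
      · have : (i : ℝ) ≤ ((H : ℤ) : ℝ) := by push_cast; linarith
        exact_mod_cast this
  have h2 : ⌈l - u⌉ = -⌊u - l⌋ := by rw [← Int.ceil_neg, neg_sub]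
  have h3 : 0 ≤ ⌊r - u⌋ + 1 - ⌈l - u⌉ := by
    have h4 : ⌈l - u⌉ ≤ ⌈r - u⌉ := Int.ceil_le_ceil (by linarith)
    have h5 := Int.ceil_le_floor_add_one (r - u)
    omega
  rw [h1, Int.card_Icc]
  have h6 : (((⌊r - u⌋ + 1 - ⌈l - u⌉).toNat : ℤ) : ℝ) = ⌊r - u⌋ + 1 + ⌊u - l⌋ := by
    rw [Int.toNat_of_nonneg h3, h2]
    push_cast
    ring
  rw [Int.cast_natCast] at h6
  rw [h6]
  simp only [saw, Int.fract]
  ring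

/-- The number of points of `(ℤ + u) × ℤ` in an intersection of strips, within a box. -/
noncomputable def stripCount (θ lo hi : ι → ℝ) (H : ℕ) (u : ℝ) : ℝ :=
  ∑ j ∈ Finset.Icc (-(H : ℤ)) H, ∑ i ∈ Finset.Icc (-(H : ℤ)) H,
    (stripSet θ lo hi).indicator 1 ((i : ℝ) + u, (j : ℝ))

/-- The mean square over the shifts of the discrepancy of an intersection of strips. -/
theorem integral_sq_stripCount_le [LinearOrder ι] [Nonempty ι] {θ lo hi : ι → ℝ} {L B n Y : ℝ}
    {H : ℕ} (hL : ∀ e, |θ e| ≤ L) (hH : ∀ p ∈ stripSet θ lo hi, |p.1| ≤ H - 1 ∧ |p.2| ≤ H - 1)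
    (hY : ∀ p ∈ stripSet θ lo hi, |p.2| ≤ Y) (hY0 : 0 ≤ Y) (hn : 2 * Y + 1 ≤ n)
    (hB : ∀ e (J : Finset ℤ) (β : ℝ) (f : ℤ → ℝ → ℝ), (J : Set ℤ).OrdConnected → (J.card : ℝ) ≤ n →
      ((∀ j u, f j u = saw (θ e * j + β - u)) ∨ (∀ j u, f j u = saw (u - (θ e * j + β)))) →
      ∫ u in (0 : ℝ)..1, (∑ j ∈ J, f j u) ^ 2 ≤ B) :
    ∫ u in (0 : ℝ)..1, (stripCount θ lo hi H u - (volume (stripSet θ lo hi)).toReal) ^ 2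
      ≤ 3 * (64 * L ^ 2 + 2 * (Fintype.card ι : ℝ) ^ 2 * B) := by
  classical
  set l := leftEnd θ lo with hl
  set r := rightEnd θ hi with hr
  set s := sectionLength θ lo hi with hs
  set J : Finset ℤ := (Finset.Icc (-(H : ℤ)) H).filter fun j => 0 ≤ s j with hJ
  have hmem : ∀ p : ℝ × ℝ, p ∈ stripSet θ lo hi ↔ l p.2 ≤ p.1 ∧ p.1 ≤ r p.2 :=
    fun p => mem_stripSet_iff
  have hJo : (J : Set ℤ).OrdConnected := by
    rw [hJ, Finset.coe_filter]
    refine ⟨?_⟩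
    rintro a ⟨ha, ha'⟩ b ⟨hb, hb'⟩ j ⟨hj1, hj2⟩
    refine ⟨?_, ?_⟩
    · rw [Finset.mem_Icc] at *; omega
    · have := ((concaveOn_sectionLength θ lo hi).convex_ge 0).ordConnected.out
        (x := (a : ℝ)) ⟨mem_univ _, ha'⟩ (y := (b : ℝ)) ⟨mem_univ _, hb'⟩
        (⟨by exact_mod_cast hj1, by exact_mod_cast hj2⟩ : (j : ℝ) ∈ Icc (a : ℝ) b)
      exact this.2
  have hJc : (J.card : ℝ) ≤ n := by
    have h1 : J ⊆ Finset.Icc ⌈-Y⌉ ⌊Y⌋ := by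
      intro j hj
      obtain ⟨x, hx⟩ := exists_mem_stripSet_iff.2 (Finset.mem_filter.1 hj).2
      have := abs_le.1 (hY _ hx)
      rw [Finset.mem_Icc, Int.ceil_le, Int.le_floor]
      exact this
    have h2 := Finset.card_le_card h1
    rw [Int.card_Icc, Int.ceil_neg] at h2
    have h3 : 0 ≤ ⌊Y⌋ := Int.floor_nonneg.2 hY0
    have h4 : (J.card : ℤ) ≤ 2 * ⌊Y⌋ + 1 := by omega
    have h5 : (J.card : ℝ) ≤ 2 * ⌊Y⌋ + 1 := by exact_mod_cast h4
    linarith [Int.floor_le Y]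
  -- Three contributions: the section lengths, whose sum is the area up to `8 * L`, and the
  -- sawtooths at the right and at the left ends.
  have hrow : ∀ u ∈ Icc (0 : ℝ) 1, stripCount θ lo hi H u
      = ∑ j ∈ Finset.Icc (-(H : ℤ)) H, max (s j) 0
        - ∑ j ∈ J, saw (r j - u) - ∑ j ∈ J, saw (u - l j) := by
    intro u hu
    have h1 : stripCount θ lo hi H u = ∑ j ∈ J, (s j - saw (r j - u) - saw (u - l j)) := by
      rw [hJ, Finset.sum_filter]
      refine Finset.sum_congr rfl fun j _ => ?_
      have e1 : ∑ i ∈ Finset.Icc (-(H : ℤ)) H,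
          (stripSet θ lo hi).indicator (1 : ℝ × ℝ → ℝ) ((i : ℝ) + u, (j : ℝ))
          = ((Finset.Icc (-(H : ℤ)) H).filter fun i : ℤ => l j ≤ i + u ∧ i + u ≤ r j).card := by
        rw [Finset.card_filter]
        push_cast
        refine Finset.sum_congr rfl fun i _ => ?_
        rw [indicator_apply]
        simp only [hmem, Pi.one_apply]
      rw [e1]
      split_ifs with h0
      · have hlr : l j ≤ r j := sub_nonneg.1 h0
        have m1 := abs_le.1 (hH (l j, j) ((hmem _).2 ⟨le_rfl, hlr⟩)).1
        have m2 := abs_le.1 (hH (r j, j) ((hmem _).2 ⟨hlr, le_rfl⟩)).1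
        exact card_filter_shift_eq hlr (by linarith [hu.2, m1.1]) (by linarith [hu.1, m2.2])
      · rw [Finset.filter_eq_empty_iff.2, Finset.card_empty, Nat.cast_zero]
        intro i _ hi
        exact h0 (sub_nonneg.2 (hi.1.trans hi.2))
    rw [h1, Finset.sum_sub_distrib, Finset.sum_sub_distrib]
    congr 2
    rw [hJ, Finset.sum_filter]
    refine Finset.sum_congr rfl fun j _ => ?_
    split_ifs with h0
    · rw [max_eq_left h0]
    · rw [max_eq_right (not_le.1 h0).le]
  have harea : |∑ j ∈ Finset.Icc (-(H : ℤ)) H, max (s j) 0 - (volume (stripSet θ lo hi)).toReal|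
      ≤ 4 * (2 * L) := by
    rw [volume_stripSet θ lo hi (H := H) fun p hp => (hH p hp).2.trans (by linarith)]
    refine abs_sum_sub_integral_le_of_concave (concaveOn_sectionLength θ lo hi)
      (abs_sectionLength_sub_le hL) fun y hy => ?_
    obtain ⟨x, hx⟩ := exists_mem_stripSet_iff.2 hy
    exact (hH _ hx).2
  set E := ∑ j ∈ Finset.Icc (-(H : ℤ)) H, max (s j) 0 - (volume (stripSet θ lo hi)).toReal with hE
  set X : ℝ → ℝ := fun u => ∑ j ∈ J, saw (r j - u) with hX
  set Z : ℝ → ℝ := fun u => ∑ j ∈ J, saw (u - l j) with hZ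
  have hXB : ∫ u in (0 : ℝ)..1, X u ^ 2 ≤ (Fintype.card ι : ℝ) ^ 2 * B := by
    -- The right end is a minimum of affine functions. The rows are grouped by the active one, which
    -- makes each group an arithmetic progression along a single edge.
    obtain ⟨e, he1, he2⟩ := exists_selection_affine θ hi
    have hre : ∀ j : ℤ, r j = θ (e j) * j + hi (e j) := fun j =>
      le_antisymm (rightEnd_le _ _ _ _) (le_rightEnd.2 (he1 j))
    simp only [hX, hre]
    refine integral_sq_sum_saw_selection_le J hJo e he2 (fun i j u => saw (θ i * j + hi i - u))
      (fun i j => measurable_saw.comp (by fun_prop)) (fun _ _ _ => abs_saw_le _) ?_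
    intro i J' hJ' hJo'
    exact hB i J' (hi i) _ hJo' ((Nat.cast_le.2 (Finset.card_le_card hJ')).trans hJc)
      (Or.inl fun _ _ => rfl)
  have hZB : ∫ u in (0 : ℝ)..1, Z u ^ 2 ≤ (Fintype.card ι : ℝ) ^ 2 * B := by
    obtain ⟨e, he1, he2⟩ := exists_selection_affine (fun e => -θ e) (fun e => -lo e)
    have hre : ∀ j : ℤ, l j = θ (e j) * j + lo (e j) := fun j => by
      refine le_antisymm (leftEnd_le.2 fun i => ?_) (leftEnd_le.1 le_rfl _)
      linarith [he1 j i]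
    simp only [hZ, hre]
    refine integral_sq_sum_saw_selection_le J hJo e he2 (fun i j u => saw (u - (θ i * j + lo i)))
      (fun i j => measurable_saw.comp (by fun_prop)) (fun _ _ _ => abs_saw_le _) ?_
    intro i J' hJ' hJo'
    exact hB i J' (lo i) _ hJo' ((Nat.cast_le.2 (Finset.card_le_card hJ')).trans hJc)
      (Or.inr fun _ _ => rfl)
  have hint : ∀ F : ℤ → ℝ → ℝ, (∀ j, Measurable (F j)) →
      IntervalIntegrable (fun u => (∑ j ∈ J, saw (F j u)) ^ 2) volume 0 1 := by
    intro F hF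
    refine intervalIntegrable_of_bounded (C := (J.card : ℝ) ^ 2)
      ((Finset.measurable_sum _ fun j _ => measurable_saw.comp (hF j)).pow_const 2) (fun u => ?_) _ _
    rw [abs_pow]
    refine pow_le_pow_left₀ (abs_nonneg _) ((Finset.abs_sum_le_sum_abs _ _).trans ?_) 2
    refine (Finset.sum_le_sum fun j _ => abs_saw_le _).trans ?_
    rw [Finset.sum_const, nsmul_eq_mul, mul_one]
  have hiX : IntervalIntegrable (fun u => X u ^ 2) volume 0 1 :=
    hint (fun j u => r j - u) fun j => by fun_prop
  have hiZ : IntervalIntegrable (fun u => Z u ^ 2) volume 0 1 :=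
    hint (fun j u => u - l j) fun j => by fun_prop
  have hXm : Measurable X := Finset.measurable_sum _ fun j _ => measurable_saw.comp (by fun_prop)
  have hZm : Measurable Z := Finset.measurable_sum _ fun j _ => measurable_saw.comp (by fun_prop)
  have habsX : ∀ u, |X u| ≤ J.card := fun u =>
    (Finset.abs_sum_le_sum_abs _ _).trans
      ((Finset.sum_le_sum fun j _ => abs_saw_le _).trans (by simp))
  have habsZ : ∀ u, |Z u| ≤ J.card := fun u =>
    (Finset.abs_sum_le_sum_abs _ _).trans
      ((Finset.sum_le_sum fun j _ => abs_saw_le _).trans (by simp))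
  have hE2 : E ^ 2 ≤ 64 * L ^ 2 := by
    have := sq_le_sq' (abs_le.1 harea).1 (abs_le.1 harea).2
    nlinarith
  calc ∫ u in (0 : ℝ)..1, (stripCount θ lo hi H u - (volume (stripSet θ lo hi)).toReal) ^ 2
      = ∫ u in (0 : ℝ)..1, (E - X u - Z u) ^ 2 := by
        refine intervalIntegral.integral_congr fun u hu => ?_
        rw [uIcc_of_le zero_le_one] at hu
        simp only [hrow u hu, hE, hX, hZ]
        ring
    _ ≤ ∫ u in (0 : ℝ)..1, 3 * (E ^ 2 + X u ^ 2 + Z u ^ 2) := by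
        refine intervalIntegral.integral_mono_on zero_le_one ?_ ?_ fun u _ => ?_
        · refine intervalIntegrable_of_bounded (C := (|E| + J.card + J.card) ^ 2)
            (((measurable_const.sub hXm).sub hZm).pow_const 2) (fun u => ?_) _ _
          rw [abs_pow]
          refine pow_le_pow_left₀ (abs_nonneg _) ?_ 2
          calc |E - X u - Z u| ≤ |E - X u| + |Z u| := abs_sub _ _
            _ ≤ |E| + |X u| + |Z u| := by gcongr; exact abs_sub _ _
            _ ≤ _ := by gcongr; exacts [habsX u, habsZ u]
        · exact ((intervalIntegrable_const.add hiX).add hiZ).const_mul 3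
        · nlinarith [sq_nonneg (E + X u), sq_nonneg (E + Z u), sq_nonneg (X u - Z u)]
    _ = 3 * (E ^ 2 + (∫ u in (0 : ℝ)..1, X u ^ 2) + ∫ u in (0 : ℝ)..1, Z u ^ 2) := by
        rw [intervalIntegral.integral_const_mul, intervalIntegral.integral_add
          (intervalIntegrable_const.add hiX) hiZ, intervalIntegral.integral_add
          intervalIntegrable_const hiX]
        simp
    _ ≤ _ := by linarith

end Strips

/-! ### Coverings and the Cantor construction of a direction -/

/-- `Ω` is covered by `k` intervals of length `r`. -/
def CoveredBy (Ω : Set ℝ) (r : ℝ) (k : ℕ) : Prop :=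
  ∃ F : Finset ℝ, F.card ≤ k ∧ Ω ⊆ ⋃ x ∈ F, Icc x (x + r)

theorem CoveredBy.mono {Ω : Set ℝ} {r r' : ℝ} {k k' : ℕ} (h : CoveredBy Ω r k) (hr : r ≤ r')
    (hk : k ≤ k') : CoveredBy Ω r' k' := by
  obtain ⟨F, hF, hc⟩ := h
  refine ⟨F, hF.trans hk, hc.trans (iUnion₂_mono fun x _ => Icc_subset_Icc_right ?_)⟩
  linarith

theorem CoveredBy.insert_zero {Ω : Set ℝ} {r : ℝ} {k : ℕ} (h : CoveredBy Ω r k) (hr : 0 ≤ r) :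
    CoveredBy (insert 0 Ω) r (k + 1) := by
  classical
  obtain ⟨F, hF, hc⟩ := h
  refine ⟨insert 0 F, (Finset.card_insert_le _ _).trans (by omega), ?_⟩
  rw [insert_subset_iff]
  constructor
  · exact mem_iUnion₂.2 ⟨0, Finset.mem_insert_self _ _, by simp [hr]⟩
  · refine hc.trans fun x hx => ?_
    obtain ⟨y, hy, hxy⟩ := mem_iUnion₂.1 hx
    exact mem_iUnion₂.2 ⟨y, Finset.mem_insert_of_mem hy, hxy⟩

/-- The Euclidean norm of an integer vector. -/
noncomputable def vnorm (v : ℤ × ℤ) : ℝ := Real.sqrt ((v.1 : ℝ) ^ 2 + (v.2 : ℝ) ^ 2)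

/-- The component of an integer vector orthogonal to the direction `x`. -/
noncomputable def slant (x : ℝ) (v : ℤ × ℤ) : ℝ := v.2 * Real.cos x - v.1 * Real.sin x

theorem vnorm_sq (v : ℤ × ℤ) : vnorm v ^ 2 = (v.1 : ℝ) ^ 2 + (v.2 : ℝ) ^ 2 :=
  Real.sq_sqrt (by positivity)

theorem one_le_vnorm {v : ℤ × ℤ} (hv : v ≠ 0) : 1 ≤ vnorm v := by
  rw [vnorm, Real.one_le_sqrt]
  have h : v.1 ≠ 0 ∨ v.2 ≠ 0 := by
    by_contra hh
    push Not at hh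
    exact hv (Prod.ext hh.1 hh.2)
  have : (1 : ℤ) ≤ v.1 ^ 2 + v.2 ^ 2 := by
    rcases h with h | h
    · have := sq_pos_of_ne_zero h |>.le; have := sq_nonneg v.2; have := pow_pos (abs_pos.2 h) 2
      rw [sq_abs] at this; omega
    · have := sq_nonneg v.1; have := pow_pos (abs_pos.2 h) 2
      rw [sq_abs] at this; omega
  exact_mod_cast this

theorem exists_polar (v : ℤ × ℤ) :
    ∃ φ : ℝ, (v.1 : ℝ) = vnorm v * Real.cos φ ∧ (v.2 : ℝ) = vnorm v * Real.sin φ := by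
  set z : ℂ := ⟨v.1, v.2⟩ with hz
  have hn : ‖z‖ = vnorm v := by
    rw [Complex.norm_def, Complex.normSq_mk, vnorm]
    congr 1
    ring
  refine ⟨z.arg, ?_, ?_⟩
  · rw [← hn, Complex.norm_mul_cos_arg]
  · rw [← hn, Complex.norm_mul_sin_arg]

theorem slant_eq {v : ℤ × ℤ} {φ : ℝ} (h1 : (v.1 : ℝ) = vnorm v * Real.cos φ)
    (h2 : (v.2 : ℝ) = vnorm v * Real.sin φ) (x : ℝ) : slant x v = vnorm v * Real.sin (φ - x) := by
  rw [slant, h1, h2, Real.sin_sub]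
  ring

/-- Directions of short integer vectors are well separated. -/
theorem eq_of_slant_eq_zero {v w : ℤ × ℤ} (hv : v ≠ 0) (hw : w ≠ 0) {x y l : ℝ}
    (hx : slant x v = 0) (hy : slant y w = 0) (hvl : 4 * l * vnorm v ^ 2 ≤ 1)
    (hwl : 4 * l * vnorm w ^ 2 ≤ 1) (hl : l ≤ 1) (hxy : |x - y| ≤ 3 / 2 * l) : x = y := by
  obtain ⟨φ, h1, h2⟩ := exists_polar v
  obtain ⟨ψ, h3, h4⟩ := exists_polar w
  have hv1 := one_le_vnorm hv
  have hw1 := one_le_vnorm hw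
  rw [slant_eq h1 h2, mul_eq_zero] at hx
  rw [slant_eq h3 h4, mul_eq_zero] at hy
  have hx' : Real.sin (φ - x) = 0 := hx.resolve_left (by linarith)
  have hy' : Real.sin (ψ - y) = 0 := hy.resolve_left (by linarith)
  obtain ⟨m, hm⟩ := Real.sin_eq_zero_iff.1 hx'
  obtain ⟨n, hn⟩ := Real.sin_eq_zero_iff.1 hy'
  -- The determinant is an integer of absolute value `|v||w||sin (x - y)|`, which is at most `3/8`.
  -- So it vanishes and the two vectors are parallel.
  set D : ℤ := v.1 * w.2 - v.2 * w.1 with hD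
  have hDr : (D : ℝ) = vnorm v * vnorm w * Real.sin (ψ - φ) := by
    rw [hD]
    push_cast
    rw [h1, h2, h3, h4, Real.sin_sub]
    ring
  have hsin : |Real.sin (ψ - φ)| = |Real.sin (x - y)| := by
    have : ψ - φ = -(x - y) + ((n - m : ℤ) : ℝ) * Real.pi := by
      push_cast
      linarith
    rw [this, Real.sin_add_int_mul_pi, Real.sin_neg, abs_mul, abs_neg]
    simp
  have hl0 : 0 ≤ l := by linarith [abs_nonneg (x - y)]
  have hsmall : |(D : ℝ)| < 1 := by
    rw [hDr, abs_mul, hsin, abs_of_nonneg (by positivity)]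
    have e1 : |Real.sin (x - y)| ≤ 3 / 2 * l := Real.abs_sin_le_abs.trans hxy
    have e2 : vnorm v * vnorm w ≤ (vnorm v ^ 2 + vnorm w ^ 2) / 2 := by
      nlinarith [sq_nonneg (vnorm v - vnorm w)]
    have e3 : vnorm v * vnorm w * |Real.sin (x - y)|
        ≤ (vnorm v ^ 2 + vnorm w ^ 2) / 2 * (3 / 2 * l) :=
      mul_le_mul e2 e1 (abs_nonneg _) (by positivity)
    nlinarith
  have hD0 : D = 0 := by
    have : |D| < 1 := by exact_mod_cast hsmall
    exact Int.abs_lt_one_iff.1 this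
  rw [hD0, Int.cast_zero] at hDr
  have hs0 : Real.sin (x - y) = 0 := by
    rw [← abs_eq_zero, ← hsin, abs_eq_zero]
    exact (mul_eq_zero.1 hDr.symm).resolve_left (by positivity)
  have hpi := Real.pi_gt_three
  have hb := abs_le.1 hxy
  have := (Real.sin_eq_zero_iff_of_lt_of_lt (by linarith) (by linarith)).1 hs0
  linarith

/-- A lower bound for the slant away from the directions of integer vectors. -/
theorem vnorm_mul_le_abs_slant {v : ℤ × ℤ} {α c ω r : ℝ}
    (hα : ∀ x, slant (x - c) v = 0 → 2 * r ≤ |α - x|) (hω : |ω - c| ≤ r) :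
    vnorm v * (r / 2) ≤ |slant (α - ω) v| := by
  obtain ⟨φ, h1, h2⟩ := exists_polar v
  set y := φ - (α - ω) with hy
  set m := round (y / Real.pi) with hm
  have hpi := Real.pi_pos
  have hym : |y - m * Real.pi| ≤ Real.pi / 2 := by
    have h := abs_sub_round (y / Real.pi)
    have e : y - m * Real.pi = (y / Real.pi - m) * Real.pi := by field_simp
    rw [e, abs_mul, abs_of_pos hpi]
    nlinarith
  have hz := hα (c + φ - m * Real.pi) (by
    rw [slant_eq h1 h2, show φ - (c + φ - m * Real.pi - c) = m * Real.pi by ring,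
      Real.sin_int_mul_pi, mul_zero])
  have hlow : r ≤ |y - m * Real.pi| := by
    have e : y - m * Real.pi = -(α - (c + φ - m * Real.pi)) + (ω - c) := by rw [hy]; ring
    have := abs_sub_abs_le_abs_sub (-(α - (c + φ - m * Real.pi))) (-(ω - c))
    rw [abs_neg, abs_neg, sub_neg_eq_add, ← e] at this
    linarith
  have hsin := Real.mul_abs_le_abs_sin hym
  rw [Real.sin_sub_int_mul_pi, abs_mul, abs_zpow, abs_neg, abs_one, one_zpow, one_mul] at hsin
  rw [slant_eq h1 h2, abs_mul, abs_of_nonneg (show 0 ≤ vnorm v from Real.sqrt_nonneg _)]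
  refine mul_le_mul_of_nonneg_left (le_trans ?_ hsin) (Real.sqrt_nonneg _)
  have hr : 0 ≤ r := (abs_nonneg _).trans hω
  have h2pi : (1 : ℝ) / 2 ≤ 2 / Real.pi := by
    rw [div_le_div_iff₀ (by norm_num) hpi]
    linarith [Real.pi_le_four]
  calc r / 2 = 1 / 2 * r := by ring
    _ ≤ 2 / Real.pi * |y - m * Real.pi| := mul_le_mul h2pi hlow hr (by positivity)

/-- One step of the Cantor construction: a subinterval away from the directions of short vectors. -/
theorem exists_subinterval {Ω : Set ℝ} {a l : ℝ} {k : ℕ} (hl : 0 < l) (hl1 : l ≤ 1)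
    (hcov : CoveredBy Ω (l / (8 * (k + 1))) k) :
    ∃ b, a ≤ b ∧ b + l / (2 * (k + 1)) ≤ a + l ∧ ∀ α ∈ Icc b (b + l / (2 * (k + 1))), ∀ ω ∈ Ω,
      ∀ v : ℤ × ℤ, v ≠ 0 → 4 * l * vnorm v ^ 2 ≤ 1 →
        vnorm v * (l / (2 * (k + 1)) / 8) ≤ |slant (α - ω) v| := by
  obtain ⟨F, hF, hc⟩ := hcov
  set g := l / (2 * ((k : ℝ) + 1)) with hg
  have hk1 : (0 : ℝ) < (k : ℝ) + 1 := by positivity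
  have hg0 : 0 < g := by positivity
  have hgl : 2 * g * (k + 1) = l := by rw [hg]; field_simp
  have hr : l / (8 * ((k : ℝ) + 1)) = g / 4 := by rw [hg]; field_simp; norm_num
  rw [hr] at hc
  -- Candidates `[s i, s i + g]` for `i ≤ k`, each centred in one of `k + 1` consecutive cells of
  -- length `2 * g`. A spoiled candidate has, in its own cell, a rational direction translated by
  -- some `c ∈ F`. With all candidates spoiled, two of them share `c`; by `eq_of_slant_eq_zero` the
  -- two directions coincide, although they lie in different cells.
  set s : ℕ → ℝ := fun i => a + 2 * g * i + g / 2 with hs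
  by_cases hgood : ∃ i, i ≤ k ∧ ∀ α ∈ Icc (s i) (s i + g), ∀ c ∈ F, ∀ v : ℤ × ℤ, v ≠ 0 →
      4 * l * vnorm v ^ 2 ≤ 1 → ∀ x, slant (x - c) v = 0 → 2 * (g / 4) ≤ |α - x|
  · obtain ⟨i, hi, hgi⟩ := hgood
    have hi' : (i : ℝ) ≤ k := by exact_mod_cast hi
    have hi0 : (0 : ℝ) ≤ i := Nat.cast_nonneg i
    refine ⟨s i, ?_, ?_, fun α hα ω hω v hv hvl => ?_⟩
    · simp only [hs]; nlinarith
    · simp only [hs]; nlinarith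
    · obtain ⟨c, hcF, hcω⟩ := mem_iUnion₂.1 (hc hω)
      have := vnorm_mul_le_abs_slant (r := g / 4) (ω := ω) (hgi α hα c hcF v hv hvl) (by
        rw [abs_of_nonneg (by linarith [hcω.1])]; linarith [hcω.2])
      rwa [show g / 4 / 2 = g / 8 by ring] at this
  · exfalso
    push Not at hgood
    have hch : ∀ i : ℕ, ∃ c x, i ≤ k → c ∈ F ∧ s i - g / 2 < x ∧ x < s i + 3 / 2 * g ∧
        ∃ v : ℤ × ℤ, v ≠ 0 ∧ 4 * l * vnorm v ^ 2 ≤ 1 ∧ slant (x - c) v = 0 := by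
      intro i
      by_cases hi : i ≤ k
      · obtain ⟨α, hα, c, hcF, v, hv, hvl, x, hx, hlt⟩ := hgood i hi
        have := abs_lt.1 hlt
        exact ⟨c, x, fun _ => ⟨hcF, by linarith [hα.1], by linarith [hα.2], v, hv, hvl, hx⟩⟩
      · exact ⟨0, 0, fun h => absurd h hi⟩
    choose c x hcx using hch
    obtain ⟨i, hi, j, hj, hij, hcij⟩ := Finset.exists_ne_map_eq_of_card_lt_of_maps_to
      (s := Finset.range (k + 1)) (t := F) (f := c) (by simpa using Nat.lt_succ_of_le hF)
      (fun i hi => (hcx i (Nat.lt_succ_iff.1 (Finset.mem_range.1 hi))).1)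
    have hi' := Nat.lt_succ_iff.1 (Finset.mem_range.1 hi)
    have hj' := Nat.lt_succ_iff.1 (Finset.mem_range.1 hj)
    obtain ⟨_, hxi1, hxi2, v, hv, hvl, hxv⟩ := hcx i hi'
    obtain ⟨_, hxj1, hxj2, w, hw, hwl, hxw⟩ := hcx j hj'
    have ri : (i : ℝ) ≤ k := by exact_mod_cast hi'
    have rj : (j : ℝ) ≤ k := by exact_mod_cast hj'
    have ri0 : (0 : ℝ) ≤ i := Nat.cast_nonneg i
    have rj0 : (0 : ℝ) ≤ j := Nat.cast_nonneg j
    have heq := eq_of_slant_eq_zero hv hw hxv hxw hvl hwl hl1 (by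
      rw [← hcij, sub_sub_sub_cancel_right, abs_le]
      simp only [hs] at hxi1 hxi2 hxj1 hxj2
      constructor <;> nlinarith)
    rw [← hcij, sub_left_inj] at heq
    rw [← heq] at hxj1 hxj2
    simp only [hs] at hxi1 hxi2 hxj1 hxj2
    rcases lt_or_gt_of_ne hij with h | h
    · have : (i : ℝ) + 1 ≤ j := by exact_mod_cast h
      nlinarith
    · have : (j : ℝ) + 1 ≤ i := by exact_mod_cast h
      nlinarith

/-- The number of directions that matter at scale `l`. -/
noncomputable def scaleNumber (Ω : Set ℝ) (l : ℝ) : ℕ :=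
  sInf {k : ℕ | CoveredBy Ω (l / (8 * (k + 1))) k}

theorem scaleNumber_le {Ω : Set ℝ} {l : ℝ} {k : ℕ} (h : CoveredBy Ω (l / (8 * (k + 1))) k) :
    scaleNumber Ω l ≤ k := Nat.sInf_le h

/-- The length of the next interval in the Cantor construction. -/
noncomputable def nextScale (Ω : Set ℝ) (l : ℝ) : ℝ := l / (2 * (scaleNumber Ω l + 1))

/-- A direction that is not too close to rational directions relative to every element of `Ω`. -/
theorem exists_angle {Ω : Set ℝ}
    (hΩ : ∀ l : ℝ, 0 < l → l ≤ 1 → ∃ k : ℕ, CoveredBy Ω (l / (8 * (k + 1))) k) :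
    ∃ α : ℝ, ∀ ω ∈ Ω, ∀ v : ℤ × ℤ, v ≠ 0 → ∃ l : ℝ, 0 < l ∧ l ≤ 1 ∧ 1 < 4 * l * vnorm v ^ 2 ∧
      vnorm v * (nextScale Ω (nextScale Ω l) / 8) ≤ |slant (α - ω) v| := by
  have hnext : ∀ l : ℝ, 0 < l → 0 < nextScale Ω l ∧ nextScale Ω l ≤ l / 2 := by
    intro l hl
    refine ⟨by unfold nextScale; positivity, ?_⟩
    unfold nextScale
    apply div_le_div_of_nonneg_left hl.le (by norm_num)
    linarith [(Nat.cast_nonneg (scaleNumber Ω l) : (0 : ℝ) ≤ scaleNumber Ω l)]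
  have hstep : ∀ p : ℝ × ℝ, ∃ b, 0 < p.2 → p.2 ≤ 1 → p.1 ≤ b ∧ b + nextScale Ω p.2 ≤ p.1 + p.2 ∧
      ∀ α ∈ Icc b (b + nextScale Ω p.2), ∀ ω ∈ Ω, ∀ v : ℤ × ℤ, v ≠ 0 →
        4 * p.2 * vnorm v ^ 2 ≤ 1 → vnorm v * (nextScale Ω p.2 / 8) ≤ |slant (α - ω) v| := by
    intro p
    by_cases hp : 0 < p.2 ∧ p.2 ≤ 1
    · obtain ⟨b, hb⟩ := exists_subinterval (a := p.1) hp.1 hp.2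
        (Nat.sInf_mem (s := {k : ℕ | CoveredBy Ω (p.2 / (8 * (k + 1))) k}) (hΩ p.2 hp.1 hp.2))
      exact ⟨b, fun _ _ => hb⟩
    · exact ⟨0, fun h1 h2 => absurd ⟨h1, h2⟩ hp⟩
  choose nb hnb using hstep
  -- The intervals are stored as left end and length, beginning with `[0, 1]`; the angle is a common
  -- point of all of them.
  set I : ℕ → ℝ × ℝ := fun n => (fun p => (nb p, nextScale Ω p.2))^[n] (0, 1) with hI
  have hIs : ∀ n, I (n + 1) = (nb (I n), nextScale Ω (I n).2) := fun n => by
    simp only [hI, Function.iterate_succ_apply']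
  have hlen : ∀ n, 0 < (I n).2 ∧ (I n).2 ≤ (1 / 2) ^ n := by
    intro n
    induction n with
    | zero => simp [hI]
    | succ n ih =>
      rw [hIs]
      have := hnext _ ih.1
      refine ⟨this.1, this.2.trans ?_⟩
      rw [pow_succ]
      linarith [ih.2]
  have hlen1 : ∀ n, (I n).2 ≤ 1 := fun n => (hlen n).2.trans (pow_le_one₀ (by norm_num) (by norm_num))
  have hprop := fun n => hnb (I n) (hlen n).1 (hlen1 n)
  have hnest : ∀ n, Icc (I (n + 1)).1 ((I (n + 1)).1 + (I (n + 1)).2)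
      ⊆ Icc (I n).1 ((I n).1 + (I n).2) := by
    intro n
    rw [hIs]
    exact Icc_subset_Icc (hprop n).1 (hprop n).2.1
  obtain ⟨α, hα⟩ := IsCompact.nonempty_iInter_of_sequence_nonempty_isCompact_isClosed
    (fun n => Icc (I n).1 ((I n).1 + (I n).2)) hnest
    (fun n => nonempty_Icc.2 (by linarith [(hlen n).1])) isCompact_Icc (fun n => isClosed_Icc)
  rw [mem_iInter] at hα
  refine ⟨α, fun ω hω v hv => ?_⟩
  have hv1 := one_le_vnorm hv
  have hex : ∃ n, 4 * (I n).2 * vnorm v ^ 2 ≤ 1 := by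
    obtain ⟨n, hn⟩ := exists_pow_lt_of_lt_one (show 0 < 1 / (4 * vnorm v ^ 2) by positivity)
      (show (1 / 2 : ℝ) < 1 by norm_num)
    refine ⟨n, ?_⟩
    have h1 := (hlen n).2.trans hn.le
    rw [le_div_iff₀ (by positivity)] at h1
    linarith
  classical
  -- The vector `v` becomes short for the first time at the interval `m + 1`, and is avoided in the
  -- interval `m + 2`. Its not being short at `m` bounds the length of the interval `m` from below,
  -- whence the double application of `nextScale`.
  obtain ⟨m, hm⟩ : ∃ m, Nat.find hex = m + 1 := by
    refine Nat.exists_eq_succ_of_ne_zero fun h0 => ?_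
    have := Nat.find_spec hex
    rw [h0] at this
    simp only [hI, Function.iterate_zero_apply] at this
    nlinarith
  have hmin := Nat.find_min hex (m := m) (by omega)
  have hspec := Nat.find_spec hex
  rw [hm] at hspec
  refine ⟨(I m).2, (hlen m).1, hlen1 m, not_le.1 hmin, ?_⟩
  have h2 := (hprop (m + 1)).2.2 α
  have hα2 := hα (m + 2)
  rw [hIs (m + 1)] at hα2
  have := h2 hα2 ω hω v hv hspec
  rwa [hIs m] at this

/-! ### Logarithmic covering numbers of lacunary sets -/

/-- The logarithmic weight `1 + log (1 / r)`. -/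
noncomputable def lw (r : ℝ) : ℝ := 1 - Real.log r

theorem one_le_lw {r : ℝ} (h0 : 0 < r) (h1 : r ≤ 1) : 1 ≤ lw r := by
  have := Real.log_nonpos h0.le h1
  unfold lw; linarith

theorem CoveredBy.union {Ω Ω' : Set ℝ} {r : ℝ} {k k' : ℕ} (h : CoveredBy Ω r k)
    (h' : CoveredBy Ω' r k') : CoveredBy (Ω ∪ Ω') r (k + k') := by
  classical
  obtain ⟨F, hF, hc⟩ := h
  obtain ⟨F', hF', hc'⟩ := h'
  refine ⟨F ∪ F', (Finset.card_union_le _ _).trans (by omega), union_subset ?_ ?_⟩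
  · exact hc.trans (biUnion_subset_biUnion_left fun x hx => Finset.mem_union_left _ hx)
  · exact hc'.trans (biUnion_subset_biUnion_left fun x hx => Finset.mem_union_right _ hx)

theorem CoveredBy.neg {Ω : Set ℝ} {r : ℝ} {k : ℕ} (h : CoveredBy Ω r k) :
    CoveredBy {x | -x ∈ Ω} r k := by
  classical
  obtain ⟨F, hF, hc⟩ := h
  refine ⟨F.image fun x => -(x + r), Finset.card_image_le.trans hF, fun x hx => ?_⟩
  obtain ⟨y, hy, hxy⟩ := mem_iUnion₂.1 (hc hx)
  refine mem_iUnion₂.2 ⟨-(y + r), Finset.mem_image_of_mem _ hy, ?_, ?_⟩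
  · linarith [hxy.2]
  · linarith [hxy.1]

/-- A bounded set with covering numbers `O ((1 + log (1 / r)) ^ M)`. -/
def LogCovered (M : ℕ) (Ω : Set ℝ) : Prop :=
  (∃ B : ℝ, 1 ≤ B ∧ ∀ x ∈ Ω, |x| ≤ B) ∧
    ∃ C : ℝ, 1 ≤ C ∧ ∀ r : ℝ, 0 < r → r ≤ 1 → ∃ k : ℕ, (k : ℝ) ≤ C * lw r ^ M ∧ CoveredBy Ω r k

theorem LogCovered.subset {M : ℕ} {Ω Ω' : Set ℝ} (h : LogCovered M Ω) (hs : Ω' ⊆ Ω) :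
    LogCovered M Ω' := by
  obtain ⟨⟨B, hB1, hB⟩, C, hC1, hC⟩ := h
  refine ⟨⟨B, hB1, fun x hx => hB x (hs hx)⟩, C, hC1, fun r h0 h1 => ?_⟩
  obtain ⟨k, hk, F, hF, hc⟩ := hC r h0 h1
  exact ⟨k, hk, F, hF, hs.trans hc⟩

theorem LogCovered.succ {M : ℕ} {Ω : Set ℝ} (h : LogCovered M Ω) : LogCovered (M + 1) Ω := by
  obtain ⟨hB, C, hC1, hC⟩ := h
  refine ⟨hB, C, hC1, fun r h0 h1 => ?_⟩
  obtain ⟨k, hk, hc⟩ := hC r h0 h1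
  refine ⟨k, hk.trans ?_, hc⟩
  have := one_le_lw h0 h1
  gcongr
  exact Nat.le_succ M

theorem LogCovered.union {M : ℕ} {Ω Ω' : Set ℝ} (h : LogCovered M Ω) (h' : LogCovered M Ω') :
    LogCovered M (Ω ∪ Ω') := by
  obtain ⟨⟨B, hB1, hB⟩, C, hC1, hC⟩ := h
  obtain ⟨⟨B', hB1', hB'⟩, C', hC1', hC'⟩ := h'
  refine ⟨⟨B + B', by linarith, fun x hx => ?_⟩, C + C', by linarith, fun r h0 h1 => ?_⟩
  · rcases hx with hx | hx
    · linarith [hB x hx]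
    · linarith [hB' x hx]
  · obtain ⟨k, hk, hc⟩ := hC r h0 h1
    obtain ⟨k', hk', hc'⟩ := hC' r h0 h1
    refine ⟨k + k', ?_, hc.union hc'⟩
    push_cast
    linarith

theorem LogCovered.neg {M : ℕ} {Ω : Set ℝ} (h : LogCovered M Ω) : LogCovered M {x | -x ∈ Ω} := by
  obtain ⟨⟨B, hB1, hB⟩, C, hC1, hC⟩ := h
  refine ⟨⟨B, hB1, fun x hx => ?_⟩, C, hC1, fun r h0 h1 => ?_⟩
  · rw [← abs_neg]; exact hB _ hx
  · obtain ⟨k, hk, hc⟩ := hC r h0 h1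
    exact ⟨k, hk, hc.neg⟩

theorem exists_mul_pow_le {A D : ℝ} (hA0 : 0 < A) (hA1 : A < 1) (hD : 1 ≤ D) :
    ∃ C : ℝ, 0 ≤ C ∧ ∀ r : ℝ, 0 < r → r ≤ 1 → ∃ m : ℕ, (m : ℝ) ≤ C * lw r ∧ D * A ^ m ≤ r := by
  have hlA : 0 < -Real.log A := by linarith [Real.log_neg hA0 hA1]
  have hlD := Real.log_nonneg hD
  refine ⟨(Real.log D + 1) / (-Real.log A) + 1, by positivity, fun r h0 h1 => ?_⟩
  have hlr := Real.log_nonpos h0.le h1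
  set t := (Real.log D - Real.log r) / (-Real.log A) with ht
  have ht0 : 0 ≤ t := div_nonneg (by linarith) hlA.le
  refine ⟨⌈t⌉₊, ?_, ?_⟩
  · have h2 := (Nat.ceil_lt_add_one ht0).le
    refine h2.trans ?_
    rw [ht, lw, add_mul]
    refine add_le_add ?_ (by linarith)
    rw [div_mul_eq_mul_div]
    apply div_le_div_of_nonneg_right _ hlA.le
    nlinarith
  · rw [← Real.log_le_log_iff (by positivity) h0, Real.log_mul (by positivity) (by positivity),
      Real.log_pow]
    have h2 := Nat.le_ceil t
    rw [ht, div_le_iff₀ hlA, ← ht] at h2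
    linarith

theorem le_mul_pow_of_ratio {a : ℕ → ℝ} {A : ℝ} (hA : 0 ≤ A) (h : ∀ n, a (n + 1) ≤ A * a n) (n : ℕ) :
    a n ≤ a 0 * A ^ n := by
  induction n with
  | zero => simp
  | succ n ih =>
    calc a (n + 1) ≤ A * a n := h n
      _ ≤ A * (a 0 * A ^ n) := mul_le_mul_of_nonneg_left ih hA
      _ = a 0 * A ^ (n + 1) := by ring

/-- All but `O(1 + log (1 / r))` terms lie in the single interval `[0, r]`. -/
theorem logCovered_of_isLacunarySeq {ω : ℕ → ℝ} (h : IsLacunarySeq ω) : LogCovered 1 (range ω) := by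
  classical
  obtain ⟨hpos, A, hA1, hA⟩ := h
  have hA0 : 0 < A := (div_pos (hpos 1) (hpos 0)).trans (hA 0)
  have hle := le_mul_pow_of_ratio hA0.le fun n => ((div_lt_iff₀ (hpos n)).1 (hA n)).le
  have hω0 : ∀ n, ω n ≤ ω 0 := fun n => (hle n).trans
    (mul_le_of_le_one_right (hpos 0).le (pow_le_one₀ hA0.le hA1.le))
  have hmax : 1 ≤ ω 0 + 1 := by linarith [hpos 0]
  obtain ⟨C, hC0, hC⟩ := exists_mul_pow_le hA0 hA1 hmax
  refine ⟨⟨ω 0 + 1, hmax, ?_⟩, C + 1, by linarith, fun r h0 h1 => ?_⟩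
  · rintro _ ⟨n, rfl⟩
    rw [abs_of_pos (hpos n)]
    linarith [hω0 n]
  · obtain ⟨m, hm, hmr⟩ := hC r h0 h1
    refine ⟨m + 1, ?_, insert 0 ((Finset.range m).image ω), ?_, ?_⟩
    · push_cast
      have := one_le_lw h0 h1
      linarith
    · refine (Finset.card_insert_le _ _).trans ?_
      have := Finset.card_image_le (s := Finset.range m) (f := ω)
      rw [Finset.card_range] at this
      omega
    · rintro _ ⟨n, rfl⟩
      rw [mem_iUnion₂]
      rcases lt_or_ge n m with hn | hn
      · exact ⟨ω n, Finset.mem_insert_of_mem (Finset.mem_image_of_mem _ (Finset.mem_range.2 hn)),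
          le_rfl, by linarith⟩
      · refine ⟨0, Finset.mem_insert_self _ _, (hpos n).le, ?_⟩
        have h2 : A ^ n ≤ A ^ m := pow_le_pow_of_le_one hA0.le hA1.le hn
        have h3 : ω 0 * A ^ n ≤ (ω 0 + 1) * A ^ m :=
          mul_le_mul (by linarith) h2 (by positivity) (by linarith [hpos 0])
        linarith [hle n]

/-- Adding lacunary sequences converging from the left raises the order by one. -/
theorem LogCovered.left_sequences {M : ℕ} {Ω : Set ℝ} (h : LogCovered M Ω) {A : ℝ} (hA1 : A < 1)
    {a : ℝ → ℕ → ℝ} (ha : ∀ p ∈ Ω, ∀ n, 0 ≤ a p n ∧ a p (n + 1) ≤ A * a p n ∧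
      Disjoint Ω (Ioo (p - a p n) p)) :
    LogCovered (M + 1) (⋃ p ∈ Ω, range fun n => p - a p n) := by
  classical
  obtain ⟨⟨B, hB1, hB⟩, C, hC1, hC⟩ := h
  -- The given ratio may be zero or negative; powers and logarithms call for a positive one.
  set A' := max A (1 / 2) with hA'
  have hA0' : 0 < A' := lt_max_of_lt_right (by norm_num)
  have hA1' : A' < 1 := max_lt hA1 (by norm_num)
  have hle : ∀ p ∈ Ω, ∀ n, a p n ≤ a p 0 * A' ^ n := fun p hp =>
    le_mul_pow_of_ratio hA0'.le fun n => (ha p hp n).2.1.trans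
      (mul_le_mul_of_nonneg_right (le_max_left _ _) (ha p hp n).1)
  have hgap : ∀ p ∈ Ω, ∀ p' ∈ Ω, p' < p → ∀ n, a p n ≤ p - p' := by
    intro p hp p' hp' hlt n
    by_contra hcon
    exact disjoint_left.1 (ha p hp n).2.2 hp' ⟨by linarith, hlt⟩
  -- By `hgap` the sequence at `p` fits into the gap to any smaller point of `Ω`, so only a least
  -- point can have long offsets.
  obtain ⟨D, hD1, hD⟩ : ∃ D : ℝ, 1 ≤ D ∧ ∀ p ∈ Ω, a p 0 ≤ D := by
    by_cases hmin : ∃ p₀ ∈ Ω, ∀ p ∈ Ω, p₀ ≤ p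
    · obtain ⟨p₀, hp₀, hpm⟩ := hmin
      have h0 := (ha p₀ hp₀ 0).1
      refine ⟨2 * B + a p₀ 0, by linarith, fun p hp => ?_⟩
      rcases (hpm p hp).eq_or_lt with rfl | hlt
      · linarith
      · have e1 := hgap p hp p₀ hp₀ hlt 0
        have e2 := abs_le.1 (hB p hp)
        have e3 := abs_le.1 (hB p₀ hp₀)
        linarith
    · push Not at hmin
      refine ⟨2 * B, by linarith, fun p hp => ?_⟩
      obtain ⟨p', hp', hlt⟩ := hmin p hp
      have e1 := hgap p hp p' hp' hlt 0
      have e2 := abs_le.1 (hB p hp)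
      have e3 := abs_le.1 (hB p' hp')
      linarith
  obtain ⟨C', hC0', hC'⟩ := exists_mul_pow_le hA0' hA1' hD1
  refine ⟨⟨B + D, by linarith, ?_⟩, C * (2 + C'), by nlinarith, fun r h0 h1 => ?_⟩
  · intro x hx
    obtain ⟨p, hp, n, rfl⟩ := mem_iUnion₂.1 hx
    have e1 := hle p hp n
    have e2 : a p 0 * A' ^ n ≤ a p 0 :=
      mul_le_of_le_one_right (ha p hp 0).1 (pow_le_one₀ hA0'.le hA1'.le)
    have e3 := hD p hp
    have e4 := abs_le.1 (hB p hp)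
    have e5 := (ha p hp n).1
    change |p - a p n| ≤ B + D
    rw [abs_le]
    constructor <;> linarith
  obtain ⟨k, hk, F, hF, hc⟩ := hC r h0 h1
  obtain ⟨m, hm, hmr⟩ := hC' r h0 h1
  have hl := one_le_lw h0 h1
  -- Within a covering interval only the least point of `Ω`, if there is one, can have a sequence
  -- that leaves the interval; `q x` is this point. The sequences at all other points stay above a
  -- point of `Ω` in the interval.
  have hsel : ∀ x : ℝ, ∃ q, ∀ p ∈ Ω, p ∈ Icc x (x + r) →
      (∀ p' ∈ Ω, p' ∈ Icc x (x + r) → p ≤ p') → p = q := by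
    intro x
    by_cases hex : ∃ p ∈ Ω, p ∈ Icc x (x + r) ∧ ∀ p' ∈ Ω, p' ∈ Icc x (x + r) → p ≤ p'
    · obtain ⟨q, hq, hqx, hqm⟩ := hex
      exact ⟨q, fun p hp hpx hpm => le_antisymm (hpm q hq hqx) (hqm p hp hpx)⟩
    · push Not at hex
      refine ⟨0, fun p hp hpx hpm => ?_⟩
      obtain ⟨p', hp', hpx', hlt⟩ := hex p hp hpx
      exact absurd (hpm p' hp' hpx') (not_le.2 hlt)
  choose q hq using hsel
  -- Each covering interval is replaced by itself, its left neighbour and `m` intervals for the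
  -- first terms of the sequence at `q x`; later terms are within `r` of the limit.
  refine ⟨k * (2 + m), ?_, F.biUnion fun x =>
    insert x (insert (x - r) ((Finset.range m).image fun n => q x - a (q x) n)), ?_, ?_⟩
  · push_cast
    calc (k : ℝ) * (2 + m) ≤ C * lw r ^ M * (2 * lw r + C' * lw r) := by
          gcongr
          linarith
      _ = C * (2 + C') * lw r ^ (M + 1) := by ring
  · refine Finset.card_biUnion_le.trans ?_
    calc _ ≤ ∑ _x ∈ F, (2 + m) := by
          refine Finset.sum_le_sum fun x _ => ?_
          refine (Finset.card_insert_le _ _).trans ?_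
          have e1 := Finset.card_insert_le (x - r)
            ((Finset.range m).image fun n => q x - a (q x) n)
          have e2 := Finset.card_image_le (s := Finset.range m) (f := fun n => q x - a (q x) n)
          rw [Finset.card_range] at e2
          omega
      _ = F.card * (2 + m) := by rw [Finset.sum_const, smul_eq_mul]
      _ ≤ _ := Nat.mul_le_mul_right _ hF
  · intro y hy
    obtain ⟨p, hp, n, rfl⟩ := mem_iUnion₂.1 hy
    obtain ⟨x, hx, hpx⟩ := mem_iUnion₂.1 (hc hp)
    have han := (ha p hp n).1
    simp only [mem_iUnion₂, Finset.mem_biUnion]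
    by_cases hmin : ∀ p' ∈ Ω, p' ∈ Icc x (x + r) → p ≤ p'
    · have hpq := hq x p hp hpx hmin
      rcases lt_or_ge n m with hn | hn
      · refine ⟨p - a p n, ⟨x, hx, ?_⟩, le_rfl, by linarith⟩
        rw [← hpq]
        exact Finset.mem_insert_of_mem (Finset.mem_insert_of_mem
          (Finset.mem_image.2 ⟨n, Finset.mem_range.2 hn, rfl⟩))
      · have e1 : a p n ≤ r := by
          refine (hle p hp n).trans (le_trans ?_ hmr)
          exact mul_le_mul (hD p hp) (pow_le_pow_of_le_one hA0'.le hA1'.le hn) (by positivity)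
            (by linarith)
        rcases le_total x (p - a p n) with hcase | hcase
        · exact ⟨x, ⟨x, hx, Finset.mem_insert_self _ _⟩, hcase, by linarith [hpx.2]⟩
        · refine ⟨x - r, ⟨x, hx, Finset.mem_insert_of_mem (Finset.mem_insert_self _ _)⟩, ?_, ?_⟩
          · linarith [hpx.1]
          · linarith
    · push Not at hmin
      obtain ⟨p', hp', hpx', hlt⟩ := hmin
      have := hgap p hp p' hp' hlt n
      exact ⟨x, ⟨x, hx, Finset.mem_insert_self _ _⟩, by linarith [hpx'.1], by linarith [hpx.2]⟩

/-- Every additional order costs one more factor `lw r`. Sequences approaching from the right are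
treated by reflecting at `0`. -/
theorem logCovered_of_isLacunaryOfOrder : ∀ (M : ℕ) {Ω : Set ℝ}, IsLacunaryOfOrder M Ω →
    LogCovered M Ω
  | 0, _, h => h.elim
  | 1, _, ⟨_, hω, hΩ⟩ => hΩ ▸ logCovered_of_isLacunarySeq hω
  | M + 2, Ω, ⟨Ω', hΩ', A, hA1, a, b, hab, hsub⟩ => by
    have h := logCovered_of_isLacunaryOfOrder (M + 1) hΩ'
    have hl := h.left_sequences hA1 (a := a) fun p hp n =>
      ⟨(hab p hp n).1, (hab p hp n).2.1, (hab p hp n).2.2.1⟩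
    have hr := (h.neg.left_sequences hA1 (a := fun p => b (-p)) fun p hp n =>
      ⟨(hab (-p) hp n).2.2.2.1, (hab (-p) hp n).2.2.2.2.1, ?_⟩).neg
    · refine ((h.succ.union hl).union hr).subset (hsub.trans ?_)
      rintro x (hx | hx)
      · exact Or.inl (Or.inl hx)
      · obtain ⟨p, hp, hx | hx⟩ := mem_iUnion₂.1 hx
        · exact Or.inl (Or.inr (mem_iUnion₂.2 ⟨p, hp, hx⟩))
        · obtain ⟨n, rfl⟩ := hx
          refine Or.inr (mem_iUnion₂.2 ⟨-p, by simpa using hp, n, ?_⟩)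
          simp
          ring
    · have := (hab (-p) hp n).2.2.2.2.2
      rw [disjoint_left] at this ⊢
      intro x hx hxm
      exact this hx ⟨by linarith [hxm.2], by linarith [hxm.1]⟩

theorem LogCovered.insert_zero {M : ℕ} {Ω : Set ℝ} (h : LogCovered M Ω) :
    LogCovered M (insert 0 Ω) := by
  have : LogCovered M ({0} : Set ℝ) := by
    refine ⟨⟨1, le_rfl, by simp⟩, 1, le_rfl, fun r h0 h1 => ⟨1, ?_, {0}, by simp, by simp [h0.le]⟩⟩
    have := one_le_pow₀ (one_le_lw h0 h1) (n := M)
    simpa using this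
  exact (this.union h).subset (by rw [insert_eq])

theorem eventually_mul_log_pow_le (M : ℕ) {a C : ℝ} (ha : 0 < a) (hC : 0 < C) :
    ∃ x : ℝ, 1 ≤ x ∧ C * (Real.log (a * x)) ^ M ≤ x := by
  have h1 := (Real.isLittleO_pow_log_id_atTop (n := M)).bound (show 0 < 1 / (a * C) by positivity)
  have h2 : Filter.Tendsto (fun x : ℝ => a * x) Filter.atTop Filter.atTop :=
    Filter.tendsto_id.const_mul_atTop ha
  obtain ⟨x, hx, hx1⟩ := ((h2.eventually h1).and (Filter.eventually_ge_atTop 1)).exists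
  refine ⟨x, hx1, ?_⟩
  simp only [id, Real.norm_eq_abs] at hx
  rw [abs_of_pos (by positivity : 0 < a * x)] at hx
  have h3 := (le_abs_self _).trans hx
  calc C * Real.log (a * x) ^ M ≤ C * (1 / (a * C) * (a * x)) := by gcongr
    _ = x := by field_simp

/-- The number `k` and the length `l / (8 * (k + 1))` depend on each other. For `k` of order `lw l ^
M` the length is `l` up to powers of logarithms, which changes the logarithmic weight by a factor
growing only like the logarithm of the constant `C'`. Hence `C'` can be chosen by
`eventually_mul_log_pow_le`. -/
theorem LogCovered.exists_scale {M : ℕ} {Ω : Set ℝ} (h : LogCovered M Ω) :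
    ∃ C : ℝ, 1 ≤ C ∧ ∀ l : ℝ, 0 < l → l ≤ 1 → ∃ k : ℕ, (k : ℝ) ≤ C * lw l ^ M ∧
      CoveredBy Ω (l / (8 * (k + 1))) k := by
  obtain ⟨_, C, hC1, hC⟩ := h
  obtain ⟨C', hC1', hCC⟩ := eventually_mul_log_pow_le M
    (show 0 < Real.exp (1 + M) * 16 by positivity) (show 0 < C by linarith)
  refine ⟨C', hC1', fun l h0 h1 => ?_⟩
  have hl := one_le_lw h0 h1
  have hlM : 1 ≤ lw l ^ M := one_le_pow₀ hl
  set k := ⌊C' * lw l ^ M⌋₊ with hk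
  have hkle : (k : ℝ) ≤ C' * lw l ^ M := Nat.floor_le (by positivity)
  refine ⟨k, hkle, ?_⟩
  have hk1 : (0 : ℝ) < 8 * (k + 1) := by positivity
  have hk8 : (1 : ℝ) ≤ 8 * (k + 1) := by
    have : (0 : ℝ) ≤ k := Nat.cast_nonneg k
    linarith
  obtain ⟨k₀, hk₀, hcov⟩ := hC (l / (8 * (k + 1))) (by positivity)
    ((div_le_self h0.le hk8).trans h1)
  refine hcov.mono le_rfl ?_
  rw [hk]
  apply Nat.le_floor
  refine hk₀.trans ?_
  have hlog : lw (l / (8 * (k + 1))) ≤ Real.log (Real.exp (1 + M) * 16 * C') * lw l := by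
    have e1 : lw (l / (8 * ((k : ℝ) + 1))) = lw l + Real.log (8 * (k + 1)) := by
      unfold lw
      rw [Real.log_div h0.ne' hk1.ne']
      ring
    have e2 : Real.log (8 * ((k : ℝ) + 1)) ≤ Real.log (16 * C' * lw l ^ M) := by
      apply Real.log_le_log hk1
      nlinarith
    have e3 : Real.log (16 * C' * lw l ^ M) = Real.log (16 * C') + M * Real.log (lw l) := by
      rw [Real.log_mul (by positivity) (by positivity), Real.log_pow]
    have e4 : Real.log (Real.exp (1 + M) * 16 * C') = 1 + M + Real.log (16 * C') := by
      rw [mul_assoc, Real.log_mul (by positivity) (by positivity), Real.log_exp]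
    have e5 : Real.log (lw l) ≤ lw l := (Real.log_le_sub_one_of_pos (by linarith)).trans (by linarith)
    have e6 : 0 ≤ Real.log (16 * C') := Real.log_nonneg (by linarith)
    have e7 : (0 : ℝ) ≤ M := Nat.cast_nonneg M
    rw [e1, e4]
    nlinarith [mul_le_mul_of_nonneg_left e5 e7]
  have hlw0 : 0 ≤ lw (l / (8 * ((k : ℝ) + 1))) := by
    have := one_le_lw (r := l / (8 * ((k : ℝ) + 1))) (by positivity) ((div_le_self h0.le hk8).trans h1)
    linarith
  calc C * lw (l / (8 * (k + 1))) ^ M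
      ≤ C * (Real.log (Real.exp (1 + M) * 16 * C') * lw l) ^ M := by gcongr
    _ = C * Real.log (Real.exp (1 + M) * 16 * C') ^ M * lw l ^ M := by rw [mul_pow]; ring
    _ ≤ C' * lw l ^ M := by gcongr

/-! ### Polynomial covering numbers -/

/-- Covering numbers `O (r ^ (-s))`. -/
def PowCovered (s : ℝ) (Ω : Set ℝ) : Prop :=
  ∃ C : ℝ, 1 ≤ C ∧ ∀ r : ℝ, 0 < r → r ≤ 1 → ∃ k : ℕ, (k : ℝ) ≤ C * r ^ (-s) ∧ CoveredBy Ω r k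

theorem PowCovered.insert_zero {s : ℝ} (hs : 0 ≤ s) {Ω : Set ℝ} (h : PowCovered s Ω) :
    PowCovered s (insert 0 Ω) := by
  obtain ⟨C, hC1, hC⟩ := h
  refine ⟨C + 1, by linarith, fun r h0 h1 => ?_⟩
  obtain ⟨k, hk, hc⟩ := hC r h0 h1
  refine ⟨k + 1, ?_, hc.insert_zero h0.le⟩
  have : 1 ≤ r ^ (-s) := Real.one_le_rpow_of_pos_of_le_one_of_nonpos h0 h1 (by linarith)
  push_cast
  linarith

theorem powCovered_of_hasCoveringExponent {s : ℝ} (hs : 0 ≤ s) {Ω : Set ℝ}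
    (h : HasCoveringExponent Ω s) : PowCovered s Ω := by
  obtain ⟨C, δ, hδ, hC⟩ := h
  obtain ⟨F₀, hF₀, hc₀⟩ := hC (δ / 2) (by positivity) (by linarith)
  refine ⟨max 1 (max C F₀.card), le_max_left _ _, fun r h0 h1 => ?_⟩
  have hr1 : 1 ≤ r ^ (-s) := Real.one_le_rpow_of_pos_of_le_one_of_nonpos h0 h1 (by linarith)
  rcases lt_or_ge r δ with hlt | hge
  · obtain ⟨F, hF, hc⟩ := hC r h0 hlt
    refine ⟨F.card, hF.trans ?_, F, le_rfl, hc⟩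
    gcongr
    exact (le_max_left _ _).trans (le_max_right _ _)
  · refine ⟨F₀.card, ?_, CoveredBy.mono ⟨F₀, le_rfl, hc₀⟩ (by linarith) le_rfl⟩
    have : (F₀.card : ℝ) ≤ max 1 (max C F₀.card) := (le_max_right _ _).trans (le_max_right _ _)
    have h2 : (1 : ℝ) ≤ max 1 (max C F₀.card) := le_max_left _ _
    nlinarith

/-- The implicit relation `k ≈ (l / k) ^ (-s)` is solved by `k ≈ l ^ (-s / (1 - s))`. -/
theorem PowCovered.exists_scale {s : ℝ} (hs0 : 0 ≤ s) (hs1 : s < 1) {Ω : Set ℝ}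
    (h : PowCovered s Ω) :
    ∃ C : ℝ, 1 ≤ C ∧ ∀ l : ℝ, 0 < l → l ≤ 1 → ∃ k : ℕ, (k : ℝ) ≤ C * l ^ (-(s / (1 - s))) ∧
      CoveredBy Ω (l / (8 * (k + 1))) k := by
  obtain ⟨C, hC1, hC⟩ := h
  have h1s : 0 < 1 - s := by linarith
  -- The solution of `16 * C * C' ^ s = C'`.
  set C' := (16 * C) ^ (1 / (1 - s)) with hC'
  have hC1' : 1 ≤ C' := Real.one_le_rpow (by linarith) (by positivity)
  have hCpow : C' ^ (1 - s) = 16 * C := by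
    rw [hC', ← Real.rpow_mul (by linarith)]
    field_simp
    rw [Real.rpow_one]
  refine ⟨C', hC1', fun l h0 h1 => ?_⟩
  set t := l ^ (-(s / (1 - s))) with ht
  have ht1 : 1 ≤ t := Real.one_le_rpow_of_pos_of_le_one_of_nonpos h0 h1
    (by have : 0 ≤ s / (1 - s) := by positivity
        linarith)
  set k := ⌊C' * t⌋₊ with hk
  have hkle : (k : ℝ) ≤ C' * t := Nat.floor_le (by positivity)
  refine ⟨k, hkle, ?_⟩
  have hk0 : (0 : ℝ) ≤ k := Nat.cast_nonneg k
  have hk8 : (1 : ℝ) ≤ 8 * (k + 1) := by linarith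
  obtain ⟨k₀, hk₀, hcov⟩ := hC (l / (8 * (k + 1))) (by positivity)
    ((div_le_self h0.le hk8).trans h1)
  refine hcov.mono le_rfl ?_
  rw [hk]
  apply Nat.le_floor
  refine hk₀.trans ?_
  have hkt : 8 * ((k : ℝ) + 1) ≤ 16 * (C' * t) := by nlinarith
  have hlow : l / (16 * (C' * t)) ≤ l / (8 * (k + 1)) :=
    div_le_div_of_nonneg_left h0.le (by positivity) hkt
  have hmono : (l / (8 * ((k : ℝ) + 1))) ^ (-s) ≤ (l / (16 * (C' * t))) ^ (-s) :=
    Real.rpow_le_rpow_of_nonpos (by positivity) hlow (by linarith)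
  have heq : (l / (16 * (C' * t))) ^ (-s) = 16 ^ s * C' ^ s * t := by
    rw [Real.rpow_neg (by positivity), Real.div_rpow h0.le (by positivity),
      Real.mul_rpow (by norm_num) (by positivity), Real.mul_rpow (by positivity) (by positivity),
      inv_div]
    have e1 : t ^ s = l ^ (-(s / (1 - s)) * s) := by rw [ht, ← Real.rpow_mul h0.le]
    have e2 : t = l ^ (-(s / (1 - s)) * s) / l ^ s := by
      rw [ht, ← Real.rpow_sub h0]
      congr 1
      field_simp
      ring
    rw [e1]
    conv_rhs => rw [e2]
    ring
  have h16 : (16 : ℝ) ^ s ≤ 16 := by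
    calc (16 : ℝ) ^ s ≤ 16 ^ (1 : ℝ) := Real.rpow_le_rpow_of_exponent_le (by norm_num) hs1.le
      _ = 16 := Real.rpow_one _
  have hCC : C' ^ s * (16 * C) = C' := by
    rw [← hCpow, ← Real.rpow_add (by linarith)]
    simp
  calc C * (l / (8 * (k + 1))) ^ (-s) ≤ C * (16 ^ s * C' ^ s * t) := by rw [← heq]; gcongr
    _ ≤ C * (16 * C' ^ s * t) := by gcongr
    _ = C' ^ s * (16 * C) * t := by ring
    _ = C' * t := by rw [hCC]

/-! ### Lower bounds for two steps of the construction -/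

theorem le_nextScale {Ω : Set ℝ} {l x : ℝ} {k : ℕ} (hl : 0 < l) (hx : 1 ≤ x) (hk : (k : ℝ) ≤ x)
    (hc : CoveredBy Ω (l / (8 * (k + 1))) k) : l / (4 * x) ≤ nextScale Ω l := by
  unfold nextScale
  apply div_le_div_of_nonneg_left hl.le (by positivity)
  have : (scaleNumber Ω l : ℝ) ≤ k := by exact_mod_cast scaleNumber_le hc
  linarith

theorem nextScale_le_one {Ω : Set ℝ} {l : ℝ} (hl : 0 < l) (hl1 : l ≤ 1) : nextScale Ω l ≤ 1 := by
  unfold nextScale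
  refine (div_le_self hl.le ?_).trans hl1
  linarith [(Nat.cast_nonneg (scaleNumber Ω l) : (0 : ℝ) ≤ scaleNumber Ω l)]

theorem lw_anti {x y : ℝ} (hx : 0 < x) (h : x ≤ y) : lw y ≤ lw x := by
  have := Real.log_le_log hx h
  unfold lw; linarith

/-- The length exceeds `1 / (4 * q ^ 2)`, and each of the two steps loses only a factor of order `(1
+ log q) ^ M`. -/
theorem LogCovered.le_nextScale_nextScale {M : ℕ} {Ω : Set ℝ} (h : LogCovered M Ω) :
    ∃ c : ℝ, 0 < c ∧ ∀ l q : ℝ, 0 < l → l ≤ 1 → 1 ≤ q → 1 < 4 * l * q ^ 2 →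
      c / (q ^ 2 * (1 + Real.log q) ^ (2 * M)) ≤ nextScale Ω (nextScale Ω l) := by
  obtain ⟨C, hC1, hC⟩ := h.exists_scale
  set D : ℝ := 1 + M + Real.log (4 * C) with hD
  have hlC : 0 ≤ Real.log (4 * C) := Real.log_nonneg (by linarith)
  have hD1 : 1 ≤ D := by
    have : (0 : ℝ) ≤ M := Nat.cast_nonneg M
    linarith
  have hstep : ∀ l t : ℝ, 0 < t → t ≤ l → l ≤ 1 → t / (4 * (C * lw t ^ M)) ≤ nextScale Ω l := by
    intro l t ht htl hl1
    have hl0 := ht.trans_le htl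
    obtain ⟨k, hk, hc⟩ := hC l hl0 hl1
    have e1 := one_le_lw hl0 hl1
    have e2 := one_le_lw ht (htl.trans hl1)
    have e3 := lw_anti ht htl
    have e4 : 1 ≤ C * lw l ^ M := one_le_mul_of_one_le_of_one_le hC1 (one_le_pow₀ e1)
    refine le_trans ?_ (le_nextScale hl0 e4 hk hc)
    apply div_le_div₀ hl0.le htl (by positivity)
    gcongr
  refine ⟨1 / (64 * C ^ 2 * D ^ M * 3 ^ (2 * M)), by positivity, fun l q hl0 hl1 hq hlq => ?_⟩
  set t := 1 / (4 * q ^ 2) with ht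
  have ht0 : 0 < t := by positivity
  have htl : t ≤ l := by
    rw [ht, div_le_iff₀ (by positivity)]; linarith
  have ht1 : t ≤ 1 := htl.trans hl1
  have e0 := one_le_lw ht0 ht1
  have hlq0 := Real.log_nonneg hq
  have e1 : lw t ≤ 3 * (1 + Real.log q) := by
    rw [lw, ht, Real.log_div one_ne_zero (by positivity), Real.log_one,
      Real.log_mul (by norm_num) (by positivity), Real.log_pow,
      show (4 : ℝ) = 2 ^ 2 by norm_num, Real.log_pow]
    push_cast
    linarith [Real.log_two_lt_d9]
  set t' := t / (4 * (C * lw t ^ M)) with ht'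
  have hlM : 1 ≤ lw t ^ M := one_le_pow₀ e0
  have ht0' : 0 < t' := by positivity
  have hn := hstep l t ht0 htl hl1
  have hn' := hstep (nextScale Ω l) t' ht0' hn (nextScale_le_one hl0 hl1)
  refine le_trans ?_ hn'
  have e2 : lw t' ≤ D * lw t := by
    have e3 : lw t' = lw t + Real.log (4 * C) + M * Real.log (lw t) := by
      rw [lw, ht', Real.log_div ht0.ne' (by positivity), ← mul_assoc,
        Real.log_mul (by positivity) (by positivity), Real.log_pow, lw]
      ring
    have e5 : Real.log (lw t) ≤ lw t := (Real.log_le_sub_one_of_pos (by linarith)).trans (by linarith)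
    have e7 : (0 : ℝ) ≤ M := Nat.cast_nonneg M
    rw [e3, hD]
    nlinarith [mul_le_mul_of_nonneg_left e5 e7]
  have e4 : 0 < lw t' := by
    have : t' ≤ 1 := hn.trans (nextScale_le_one hl0 hl1)
    linarith [one_le_lw ht0' this]
  have e8 : 0 < 1 + Real.log q := by linarith
  calc 1 / (64 * C ^ 2 * D ^ M * 3 ^ (2 * M)) / (q ^ 2 * (1 + Real.log q) ^ (2 * M))
      = t / (4 * (C * (3 * (1 + Real.log q)) ^ M)) / (4 * (C * (D * (3 * (1 + Real.log q))) ^ M)) := by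
        rw [ht]
        generalize 1 + Real.log q = Q at e8
        simp only [mul_pow, pow_mul']
        field_simp
        ring
    _ ≤ t / (4 * (C * lw t ^ M)) / (4 * (C * lw t' ^ M)) := by
        have e9 : lw t' ≤ D * (3 * (1 + Real.log q)) := e2.trans (by gcongr)
        gcongr

/-- One step takes a length to at least a constant times its power with exponent `1 / (1 - s)`; two
steps are applied to a length of order at least `q ^ (-2)`. -/
theorem PowCovered.le_nextScale_nextScale {s : ℝ} (hs0 : 0 ≤ s) (hs1 : s < 1) {Ω : Set ℝ}
    (h : PowCovered s Ω) :
    ∃ c : ℝ, 0 < c ∧ ∀ l q : ℝ, 0 < l → l ≤ 1 → 1 ≤ q → 1 < 4 * l * q ^ 2 →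
      c * q ^ (-(2 / (1 - s) ^ 2)) ≤ nextScale Ω (nextScale Ω l) := by
  obtain ⟨C, hC1, hC⟩ := h.exists_scale hs0 hs1
  have h1s : 0 < 1 - s := by linarith
  set e := 1 / (1 - s) with he
  have he0 : 0 < e := by positivity
  have hstep : ∀ l t : ℝ, 0 < t → t ≤ l → l ≤ 1 → 1 / (4 * C) * t ^ e ≤ nextScale Ω l := by
    intro l t ht htl hl1
    have hl0 := ht.trans_le htl
    obtain ⟨k, hk, hc⟩ := hC l hl0 hl1
    have e1 : 1 ≤ l ^ (-(s / (1 - s))) := Real.one_le_rpow_of_pos_of_le_one_of_nonpos hl0 hl1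
      (by have : 0 ≤ s / (1 - s) := by positivity
          linarith)
    refine le_trans ?_ (le_nextScale hl0 (one_le_mul_of_one_le_of_one_le hC1 e1) hk hc)
    have e2 : l / (4 * (C * l ^ (-(s / (1 - s))))) = 1 / (4 * C) * l ^ e := by
      have : l ^ e = l * l ^ (s / (1 - s)) := by
        nth_rewrite 2 [← Real.rpow_one l]
        rw [← Real.rpow_add hl0]
        congr 1
        rw [he]
        field_simp
        ring
      rw [this, Real.rpow_neg hl0.le]
      field_simp
    rw [e2]
    gcongr
  refine ⟨1 / (4 * C) * (1 / (4 * C) * (1 / 4) ^ e) ^ e, by positivity, fun l q hl0 hl1 hq hlq => ?_⟩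
  set t := 1 / 4 * q ^ (-2 : ℝ) with ht
  have hq0 : 0 < q := by linarith
  have ht0 : 0 < t := by positivity
  have htl : t ≤ l := by
    rw [ht, Real.rpow_neg hq0.le, Real.rpow_two, ← div_eq_mul_inv, div_le_iff₀ (by positivity)]
    linarith
  have hn := hstep l t ht0 htl hl1
  have hn' := hstep (nextScale Ω l) _ (by positivity) hn (nextScale_le_one hl0 hl1)
  refine le_trans (le_of_eq ?_) hn'
  have e1 : t ^ e = (1 / 4) ^ e * q ^ (-2 * e) := by
    rw [ht, Real.mul_rpow (by norm_num) (by positivity), ← Real.rpow_mul hq0.le]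
  rw [e1, ← mul_assoc (1 / (4 * C)) ((1 / 4) ^ e),
    Real.mul_rpow (x := 1 / (4 * C) * (1 / 4) ^ e) (by positivity) (by positivity),
    ← Real.rpow_mul hq0.le, ← mul_assoc]
  congr 2
  rw [he]
  field_simp

/-! ### Slopes in the turned frame -/

/-- In the frame turned by `α`, the lines perpendicular to and the lines in the directions of `Ω` have
slopes which are bounded by `L` and badly approximable with lower bounds `δ`. -/
def SlopeBound (α : ℝ) (Ω : Set ℝ) (L : ℝ) (δ : ℕ → ℝ) : Prop :=
  ∀ ω ∈ Ω, ∀ φ : ℝ, (φ = ω ∨ φ = ω + Real.pi / 2) → Real.cos (φ - α) ≠ 0 ∧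
    |Real.tan (φ - α)| ≤ L ∧
      ∀ k h : ℕ, 1 ≤ h → h ≤ 2 ^ k → δ k ≤ nint (h * -Real.tan (φ - α))

/-- With `p` the integer nearest to `m * θ`, the number `(m * θ - p) * cos β` is up to sign the
slant of the integer vector `(m, p)`, or of `(-p, m)` for the perpendicular direction. The norm of
this vector is at most `3 * m / Ψ 1`. The unit vectors `(0, 1)` and `(1, 0)` keep `cos β` away from
zero, which bounds the slope. -/
theorem slopeBound_of_slant {α : ℝ} {Ω : Set ℝ} {Ψ : ℝ → ℝ} (hpos : ∀ q, 1 ≤ q → 0 < Ψ q)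
    (hanti : AntitoneOn Ψ (Ici 1))
    (h : ∀ ω ∈ Ω, ∀ v : ℤ × ℤ, v ≠ 0 → Ψ (vnorm v) ≤ |slant (α - ω) v|) :
    SlopeBound α Ω (1 / Ψ 1) (fun k => Ψ (3 / Ψ 1 * 2 ^ k)) := by
  intro ω hω φ hφ
  have hΨ1 := hpos 1 le_rfl
  set x := α - ω with hx
  have hcosx : Ψ 1 ≤ |Real.cos x| := by
    have := h ω hω (0, 1) (by simp)
    simpa [vnorm, slant, ← hx] using this
  have hsinx : Ψ 1 ≤ |Real.sin x| := by
    have := h ω hω (1, 0) (by simp)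
    simpa [vnorm, slant, ← hx] using this
  set β := φ - α with hβ
  obtain ⟨hcos, hlin⟩ : Ψ 1 ≤ |Real.cos β| ∧ ∀ m p : ℤ, ∃ v : ℤ × ℤ,
      vnorm v ^ 2 = (m : ℝ) ^ 2 + (p : ℝ) ^ 2 ∧
      |slant x v| = |m * Real.sin β + p * Real.cos β| := by
    rcases hφ with rfl | rfl
    · have e : β = -x := by rw [hβ, hx]; ring
      rw [e, Real.cos_neg, Real.sin_neg]
      refine ⟨hcosx, fun m p => ⟨(m, p), vnorm_sq _, ?_⟩⟩
      rw [slant]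
      congr 1
      ring
    · have e : β = Real.pi / 2 - x := by rw [hβ, hx]; ring
      rw [e, Real.cos_pi_div_two_sub, Real.sin_pi_div_two_sub]
      refine ⟨hsinx, fun m p => ⟨(-p, m), ?_, ?_⟩⟩
      · rw [vnorm_sq]; push_cast; ring
      · rw [slant]
        congr 1
        push_cast
        ring
  have hcos0 : Real.cos β ≠ 0 := fun h0 => by rw [h0, abs_zero] at hcos; linarith
  have hcosp : 0 < |Real.cos β| := abs_pos.2 hcos0
  have htan : |Real.tan β| ≤ 1 / Ψ 1 := by
    rw [Real.tan_eq_sin_div_cos, abs_div]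
    exact div_le_div₀ zero_le_one (Real.abs_sin_le_one _) hΨ1 hcos
  refine ⟨hcos0, htan, fun k m hm1 hmk => ?_⟩
  set L := 1 / Ψ 1 with hL
  have hL1 : 1 ≤ L := by
    rw [hL, le_div_iff₀ hΨ1, one_mul]
    exact hcos.trans (Real.abs_cos_le_one _)
  set θ := -Real.tan β with hθ
  have hθL : |θ| ≤ L := by rwa [hθ, abs_neg]
  set p := round ((m : ℝ) * θ) with hp
  obtain ⟨v, hv1, hv2⟩ := hlin m p
  have hm1' : (1 : ℝ) ≤ m := by exact_mod_cast hm1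
  have hmk' : (m : ℝ) ≤ 2 ^ k := by exact_mod_cast hmk
  push_cast at hv1 hv2
  have hvpos : 1 ≤ vnorm v ^ 2 := by rw [hv1]; nlinarith [sq_nonneg (p : ℝ)]
  have hv0 : v ≠ 0 := by
    rintro rfl
    simp [vnorm] at hvpos
    linarith
  have hvn := one_le_vnorm hv0
  have hpb : |(p : ℝ)| ≤ 2 * (m * L) := by
    have e1 := abs_sub_round ((m : ℝ) * θ)
    have e2 : |(m : ℝ) * θ| ≤ m * L := by
      rw [abs_mul, abs_of_nonneg (by linarith : (0 : ℝ) ≤ m)]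
      gcongr
    have e3 : |(p : ℝ)| ≤ |(p : ℝ) - m * θ| + |(m : ℝ) * θ| := by
      have := abs_add_le ((p : ℝ) - m * θ) (m * θ)
      simpa using this
    rw [abs_sub_comm] at e1
    nlinarith
  have hvb : vnorm v ≤ 3 / Ψ 1 * 2 ^ k := by
    have e0 : (0 : ℝ) ≤ m * L := by positivity
    have e1 : vnorm v ≤ 3 * (m * L) := by
      refine abs_le_of_sq_le_sq' ?_ (by positivity) |>.2
      rw [hv1, ← sq_abs (p : ℝ)]
      have e2 : (m : ℝ) ≤ m * L := le_mul_of_one_le_right (by linarith) hL1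
      have e3 := pow_le_pow_left₀ (abs_nonneg _) hpb 2
      have e4 := pow_le_pow_left₀ (by linarith : (0 : ℝ) ≤ m) e2 2
      have e5 := sq_nonneg ((m : ℝ) * L)
      linarith
    refine e1.trans ?_
    rw [show 3 / Ψ 1 = 3 * L by rw [hL]; ring]
    nlinarith
  have hΨ := (hanti (mem_Ici.2 hvn) (mem_Ici.2 (hvn.trans hvb)) hvb).trans (h ω hω v hv0)
  refine hΨ.trans ?_
  rw [hv2]
  have e : (m : ℝ) * Real.sin β + p * Real.cos β = -(m * θ - p) * Real.cos β := by
    rw [hθ, Real.tan_eq_sin_div_cos]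
    field_simp
    ring
  rw [e, abs_mul, abs_neg]
  exact mul_le_of_le_one_right (abs_nonneg _) (Real.abs_cos_le_one _)

/-- A good direction for a set with logarithmic covering numbers. -/
theorem LogCovered.exists_slopeBound {M : ℕ} {Ω : Set ℝ} (h : LogCovered M Ω) :
    ∃ α L c : ℝ, 0 < c ∧ SlopeBound α Ω L (fun k => c / (2 ^ k * ((k : ℝ) + 1) ^ (2 * M))) := by
  obtain ⟨C, _, hC⟩ := h.exists_scale
  obtain ⟨α, hα⟩ := exists_angle fun l h0 h1 => (hC l h0 h1).imp fun k hk => hk.2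
  obtain ⟨c, hc, hcle⟩ := h.le_nextScale_nextScale
  have hb : ∀ q : ℝ, 1 ≤ q → 0 < 1 + Real.log q := fun q hq => by linarith [Real.log_nonneg hq]
  -- The factor `vnorm v / 8` in `exists_angle` times the lower bound of order `q ^ (-2)` for two
  -- steps.
  set Ψ : ℝ → ℝ := fun q => c / 8 / (q * (1 + Real.log q) ^ (2 * M)) with hΨ
  have hpos : ∀ q, 1 ≤ q → 0 < Ψ q := fun q hq => by
    have := hb q hq
    simp only [hΨ]
    positivity
  have hanti : AntitoneOn Ψ (Ici 1) := by
    intro x hx y hy hxy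
    have hx1 : 1 ≤ x := hx
    have e1 := hb x hx
    have e2 := Real.log_le_log (by linarith : 0 < x) hxy
    have hy0 : 0 < y := by linarith
    simp only [hΨ]
    gcongr
  have key := slopeBound_of_slant (α := α) (Ω := Ω) hpos hanti fun ω hω v hv => by
    obtain ⟨l, hl0, hl1, hlv, hle⟩ := hα ω hω v hv
    have hv1 := one_le_vnorm hv
    refine le_trans ?_ hle
    have := hcle l (vnorm v) hl0 hl1 hv1 hlv
    have e1 := hb _ hv1
    calc Ψ (vnorm v) = vnorm v * (c / (vnorm v ^ 2 * (1 + Real.log (vnorm v)) ^ (2 * M)) / 8) := by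
          simp only [hΨ]
          field_simp
      _ ≤ _ := by gcongr
  have hΨ1 := hpos 1 le_rfl
  rcases Ω.eq_empty_or_nonempty with rfl | ⟨ω, hω⟩
  · exact ⟨0, 0, 1, one_pos, fun ω hω => absurd hω (notMem_empty _)⟩
  set T := 3 / Ψ 1 with hT
  -- The vector `(0, 1)`, tested against some `ω ∈ Ω`, gives `Ψ 1 ≤ 1`; this is why the empty set is
  -- settled first.
  have hT1 : 1 ≤ T := by
    have e1 := (key ω hω ω (Or.inl rfl))
    have e2 := e1.2.2 0 1 le_rfl (by simp)
    have e3 : Ψ 1 ≤ 1 := by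
      obtain ⟨l, hl0, hl1, hlv, hle⟩ := hα ω hω (0, 1) (by simp)
      have hv : vnorm (0, 1) = 1 := by simp [vnorm]
      rw [hv] at hle hlv
      have := hcle l 1 hl0 hl1 le_rfl hlv
      simp only [hΨ]
      simp only [Real.log_one, add_zero, one_pow, mul_one, div_one, one_mul] at this hle ⊢
      have e4 : |slant (α - ω) (0, 1)| ≤ 1 := by
        simpa [slant] using Real.abs_cos_le_one (α - ω)
      linarith
    rw [hT, le_div_iff₀ hΨ1]
    linarith
  have hlT := Real.log_nonneg hT1
  refine ⟨α, 1 / Ψ 1, c / 8 / (T * (1 + Real.log T) ^ (2 * M)), by positivity, ?_⟩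
  intro ω hω φ hφ
  obtain ⟨k1, k2, k3⟩ := key ω hω φ hφ
  refine ⟨k1, k2, fun k m hm1 hmk => le_trans ?_ (k3 k m hm1 hmk)⟩
  simp only [hΨ]
  rw [div_div]
  have h2k : (1 : ℝ) ≤ 2 ^ k := one_le_pow₀ (by norm_num)
  have hq : 1 ≤ T * 2 ^ k := by nlinarith
  have e1 := hb _ hq
  have e2 : 1 + Real.log (T * 2 ^ k) ≤ (1 + Real.log T) * (k + 1) := by
    rw [Real.log_mul (by positivity) (by positivity), Real.log_pow]
    have : (0 : ℝ) ≤ k := Nat.cast_nonneg k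
    nlinarith [Real.log_two_lt_d9, mul_nonneg this hlT]
  apply div_le_div_of_nonneg_left (by positivity) (by positivity)
  calc T * 2 ^ k * (1 + Real.log (T * 2 ^ k)) ^ (2 * M)
      ≤ T * 2 ^ k * ((1 + Real.log T) * (k + 1)) ^ (2 * M) := by gcongr
    _ = _ := by rw [mul_pow]; ring

/-- A good direction for a set with polynomial covering numbers, simultaneously for all admissible
exponents. -/
theorem exists_slopeBound_of_powCovered {Ω : Set ℝ} {S : Set ℝ}
    (hS : ∀ s ∈ S, 0 ≤ s ∧ s < 1 ∧ PowCovered s Ω) (hne : S.Nonempty) :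
    ∃ α : ℝ, ∀ s ∈ S, ∃ L c : ℝ, 0 < c ∧
      SlopeBound α Ω L (fun k => c * ((2 : ℝ) ^ k) ^ (1 - 2 / (1 - s) ^ 2)) := by
  obtain ⟨s₀, hs₀⟩ := hne
  obtain ⟨C, _, hC⟩ := (hS s₀ hs₀).2.2.exists_scale (hS s₀ hs₀).1 (hS s₀ hs₀).2.1
  -- A single admissible exponent suffices to run the construction. As `nextScale` uses the least
  -- possible number of intervals at each scale, the resulting `α` serves every `s ∈ S`.
  obtain ⟨α, hα⟩ := exists_angle fun l h0 h1 => (hC l h0 h1).imp fun k hk => hk.2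
  refine ⟨α, fun s hs => ?_⟩
  obtain ⟨hs0, hs1, hcov⟩ := hS s hs
  obtain ⟨c, hc, hcle⟩ := hcov.le_nextScale_nextScale hs0 hs1
  have h1s : 0 < 1 - s := by linarith
  have hexp : 1 - 2 / (1 - s) ^ 2 ≤ 0 := by
    rw [sub_nonpos, le_div_iff₀ (by positivity)]
    nlinarith
  set E := 1 - 2 / (1 - s) ^ 2 with hE
  set Ψ : ℝ → ℝ := fun q => c / 8 * q ^ E with hΨ
  have hpos : ∀ q, 1 ≤ q → 0 < Ψ q := fun q hq => by
    have : 0 < q := by linarith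
    simp only [hΨ]
    positivity
  have hanti : AntitoneOn Ψ (Ici 1) := by
    intro x hx y hy hxy
    have hx1 : 1 ≤ x := hx
    simp only [hΨ]
    exact mul_le_mul_of_nonneg_left
      (Real.rpow_le_rpow_of_nonpos (by linarith) hxy hexp) (by positivity)
  have key := slopeBound_of_slant (α := α) (Ω := Ω) hpos hanti fun ω hω v hv => by
    obtain ⟨l, hl0, hl1, hlv, hle⟩ := hα ω hω v hv
    have hv1 := one_le_vnorm hv
    have hv0 : 0 < vnorm v := by linarith
    refine le_trans ?_ hle
    have := hcle l (vnorm v) hl0 hl1 hv1 hlv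
    calc Ψ (vnorm v) = vnorm v * (c * vnorm v ^ (-(2 / (1 - s) ^ 2)) / 8) := by
          simp only [hΨ]
          rw [hE, sub_eq_add_neg, Real.rpow_add hv0, Real.rpow_one]
          ring
      _ ≤ _ := by gcongr
  have hΨ1 := hpos 1 le_rfl
  refine ⟨1 / Ψ 1, c / 8 * (3 / Ψ 1) ^ E, by positivity, ?_⟩
  convert key using 2 with k
  simp only [hΨ]
  rw [Real.mul_rpow (by positivity) (by positivity), mul_assoc]

/-! ### The turned and scaled lattice -/

/-- The coordinate of a point of the plane in the direction `φ`. -/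
noncomputable def crd (φ : ℝ) (x : Plane) : ℝ := x 0 * Real.cos φ + x 1 * Real.sin φ

theorem crd_add (φ : ℝ) (x y : Plane) : crd φ (x + y) = crd φ x + crd φ y := by
  simp [crd]; ring

theorem crd_sub (φ : ℝ) (x y : Plane) : crd φ (x - y) = crd φ x - crd φ y := by
  simp [crd]; ring

theorem crd_zero_apply (x : Plane) : crd 0 x = x 0 := by simp [crd]

theorem crd_pi_div_two (x : Plane) : crd (Real.pi / 2) x = x 1 := by simp [crd]

theorem continuous_crd (φ : ℝ) : Continuous (crd φ) := by
  unfold crd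
  fun_prop

/-- Cartesian coordinates turned by `α` and scaled by `1 / s`. -/
noncomputable def frame (α s : ℝ) (p : ℝ × ℝ) : Plane :=
  !₂[(p.1 * Real.cos α - p.2 * Real.sin α) / s, (p.1 * Real.sin α + p.2 * Real.cos α) / s]

theorem crd_frame (α s φ : ℝ) (p : ℝ × ℝ) :
    crd φ (frame α s p) = (p.1 * Real.cos (φ - α) + p.2 * Real.sin (φ - α)) / s := by
  simp only [crd, frame, Real.cos_sub, Real.sin_sub]
  simp
  ring

theorem frame_sq (α : ℝ) {s : ℝ} (hs : 0 < s) (p : ℝ × ℝ) :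
    p.1 ^ 2 + p.2 ^ 2 = s ^ 2 * ((frame α s p) 0 ^ 2 + (frame α s p) 1 ^ 2) := by
  simp only [frame]
  simp
  field_simp
  linear_combination (-(p.1 ^ 2) - p.2 ^ 2) * Real.sin_sq_add_cos_sq α

theorem frame_injective (α : ℝ) {s : ℝ} (hs : 0 < s) : Function.Injective (frame α s) := by
  intro p q h
  have h1 := crd_frame α s α p
  have h2 := crd_frame α s (α + Real.pi / 2) p
  rw [h, crd_frame] at h1 h2
  simp only [sub_self, Real.cos_zero, Real.sin_zero, add_sub_cancel_left, Real.cos_pi_div_two,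
    Real.sin_pi_div_two, mul_one, mul_zero, add_zero, zero_add] at h1 h2
  rw [div_left_inj' hs.ne'] at h1 h2
  exact Prod.ext h1.symm h2.symm

theorem continuous_frame (α s : ℝ) : Continuous (frame α s) := by
  refine (PiLp.continuous_toLp 2 _).comp (continuous_pi fun i => ?_)
  fin_cases i <;> simp <;> fun_prop

/-- The change of area under `frame`. -/
theorem volume_frame_preimage (α : ℝ) {s : ℝ} (hs : 0 < s) {K : Set Plane} (hK : MeasurableSet K) :
    (volume (frame α s ⁻¹' K)).toReal = s ^ 2 * volume.real K := by
  set f := Matrix.toLin (Module.Basis.finTwoProd ℝ) (Module.Basis.finTwoProd ℝ)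
    !![Real.cos α / s, -Real.sin α / s; Real.sin α / s, Real.cos α / s] with hf
  have hdet : LinearMap.det f = 1 / s ^ 2 := by
    rw [hf, LinearMap.det_toLin, Matrix.det_fin_two_of]
    field_simp
    linear_combination Real.sin_sq_add_cos_sq α
  have hfa : ∀ p : ℝ × ℝ, f p = (Real.cos α / s * p.1 + -Real.sin α / s * p.2,
      Real.sin α / s * p.1 + Real.cos α / s * p.2) := fun p => by
    rw [hf, Matrix.toLin_finTwoProd_apply]
  set g : ℝ × ℝ → Plane := fun p => WithLp.toLp 2 ((MeasurableEquiv.finTwoArrow (α := ℝ)).symm p)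
    with hg
  have hgm : MeasurePreserving g :=
    (PiLp.volume_preserving_toLp (Fin 2)).comp (volume_preserving_finTwoArrow ℝ).symm
  have hfr : frame α s = g ∘ f := by
    ext p i
    fin_cases i
    · simp [frame, hg, hfa]; ring
    · simp [frame, hg, hfa]; ring
  rw [hfr, preimage_comp, Measure.addHaar_preimage_linearMap volume (by rw [hdet]; positivity),
    hgm.measure_preimage hK.nullMeasurableSet, hdet, ENNReal.toReal_mul, ENNReal.toReal_ofReal
    (abs_nonneg _), abs_of_pos (by positivity), measureReal_def]
  field_simp

/-- An intersection of strips in the plane. -/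
def planeStrips (φ c d : Fin 4 → ℝ) : Set Plane :=
  {x | ∀ e, c e ≤ crd (φ e) x ∧ crd (φ e) x ≤ d e}

theorem isClosed_planeStrips (φ c d : Fin 4 → ℝ) : IsClosed (planeStrips φ c d) := by
  have : planeStrips φ c d = ⋂ e, {x | c e ≤ crd (φ e) x} ∩ {x | crd (φ e) x ≤ d e} := by
    ext x; simp [planeStrips]
  rw [this]
  exact isClosed_iInter fun e => (isClosed_le continuous_const (continuous_crd _)).inter
    (isClosed_le (continuous_crd _) continuous_const)

/-- Dividing by `cos (φ e - α)` solves for the coordinate along the rows. A negative cosine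
exchanges the two bounds, hence `min` and `max`. -/
theorem frame_preimage_planeStrips {α s : ℝ} (hs : 0 < s) {φ c d : Fin 4 → ℝ}
    (hcos : ∀ e, Real.cos (φ e - α) ≠ 0) (hcd : ∀ e, c e ≤ d e) :
    frame α s ⁻¹' planeStrips φ c d = stripSet (fun e => -Real.tan (φ e - α))
      (fun e => min (c e * s / Real.cos (φ e - α)) (d e * s / Real.cos (φ e - α)))
      (fun e => max (c e * s / Real.cos (φ e - α)) (d e * s / Real.cos (φ e - α))) := by
  ext p
  simp only [planeStrips, stripSet, mem_preimage, mem_ofPred_eq]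
  refine forall_congr' fun e => ?_
  rw [crd_frame]
  set b := Real.cos (φ e - α) with hb
  have hb0 := hcos e
  have hcd' : c e * s ≤ d e * s := mul_le_mul_of_nonneg_right (hcd e) hs.le
  rw [Real.tan_eq_sin_div_cos, ← hb, le_div_iff₀ hs, div_le_iff₀ hs]
  set t := Real.sin (φ e - α)
  have key : p.1 * b + p.2 * t = (p.1 + t / b * p.2) * b := by
    have : b ≠ 0 := hb0
    field_simp
  rw [key]
  rcases lt_or_gt_of_ne hb0 with h | h
  · rw [min_eq_right (div_le_div_of_nonpos_of_le h.le hcd'),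
      max_eq_left (div_le_div_of_nonpos_of_le h.le hcd'), ← le_div_iff_of_neg h,
      ← div_le_iff_of_neg h]
    constructor <;> rintro ⟨h1, h2⟩ <;> constructor <;> linarith
  · rw [min_eq_left (div_le_div_of_nonneg_right hcd' h.le),
      max_eq_right (div_le_div_of_nonneg_right hcd' h.le), ← div_le_iff₀ h, ← le_div_iff₀ h]
    constructor <;> rintro ⟨h1, h2⟩ <;> constructor <;> linarith

/-- The number of points of the rotated, shifted and scaled lattice `N ^ (-1 / 2) ℤ²` in a set, within
a large box. -/
noncomputable def latCount (α : ℝ) (N : ℕ) (u : ℝ) (S : Set Plane) : ℝ :=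
  ∑ j ∈ Finset.Icc (-((2 * N + 1 : ℕ) : ℤ)) (2 * N + 1 : ℕ),
    ∑ i ∈ Finset.Icc (-((2 * N + 1 : ℕ) : ℤ)) (2 * N + 1 : ℕ),
      S.indicator 1 (frame α (Real.sqrt N) ((i : ℝ) + u, (j : ℝ)))

/-- The mean square over the shifts of the discrepancy of an intersection of strips. -/
theorem integral_sq_latCount_planeStrips_le : ∃ C : ℝ, 0 < C ∧ ∀ (α L : ℝ) (Ω : Set ℝ) (δ : ℕ → ℝ),
    (∀ k, 0 < δ k) → SlopeBound α Ω L δ → ∀ (N K : ℕ), 1 ≤ N → ∀ φ c d : Fin 4 → ℝ,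
    (∀ e, ∃ ω ∈ Ω, φ e = ω ∨ φ e = ω + Real.pi / 2) → (∀ e, c e ≤ d e) →
    planeStrips φ c d ⊆ unitSquare →
    ∫ u in (0 : ℝ)..1, (latCount α N u (planeStrips φ c d)
        - N * volume.real (planeStrips φ c d)) ^ 2
      ≤ C * (L ^ 2 + ∑ k ∈ Finset.range (K + 1), 1 / (4 ^ k * δ k ^ 2) + N / 4 ^ K) := by
  obtain ⟨C, hC, hle⟩ := integral_sq_sum_saw_le
  refine ⟨192 + 96 * 16 * C, by positivity, ?_⟩
  intro α L Ω δ hδ hslope N K hN φ c d hφ hcd hsub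
  have hN1 : (1 : ℝ) ≤ N := by exact_mod_cast hN
  set s := Real.sqrt N with hs
  have hs1 : 1 ≤ s := Real.one_le_sqrt.2 hN1
  have hs2 : s ^ 2 = N := Real.sq_sqrt (by linarith)
  have hsN : s ≤ N := by nlinarith
  have hs0 : 0 < s := by linarith
  have hsl : ∀ e, Real.cos (φ e - α) ≠ 0 ∧ |Real.tan (φ e - α)| ≤ L ∧
      ∀ k h : ℕ, 1 ≤ h → h ≤ 2 ^ k → δ k ≤ nint (h * -Real.tan (φ e - α)) := fun e => by
    obtain ⟨ω, hω, hφe⟩ := hφ e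
    exact hslope ω hω (φ e) hφe
  have hpre := frame_preimage_planeStrips hs0 (fun e => (hsl e).1) hcd
  set θ : Fin 4 → ℝ := fun e => -Real.tan (φ e - α) with hθ
  set lo : Fin 4 → ℝ := fun e =>
    min (c e * s / Real.cos (φ e - α)) (d e * s / Real.cos (φ e - α)) with hlo
  set hi : Fin 4 → ℝ := fun e =>
    max (c e * s / Real.cos (φ e - α)) (d e * s / Real.cos (φ e - α)) with hhi
  -- The norm on the unit square is at most `√2 < 3/2`. As `3/2 * s ≤ 2 * N`, the box of `latCount`
  -- misses nothing.
  have hbound : ∀ p ∈ stripSet θ lo hi, |p.1| ≤ 3 / 2 * s ∧ |p.2| ≤ 3 / 2 * s := by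
    intro p hp
    rw [← hpre] at hp
    have h1 := hsub hp
    have h2 := frame_sq α hs0 p
    obtain ⟨a0, a1⟩ := h1 0
    obtain ⟨b0, b1⟩ := h1 1
    have h3 : p.1 ^ 2 + p.2 ^ 2 ≤ 2 * s ^ 2 := by
      rw [h2, mul_comm]
      exact mul_le_mul_of_nonneg_right (by nlinarith) (sq_nonneg s)
    exact ⟨abs_le_of_sq_le_sq (by nlinarith [sq_nonneg p.2]) (by positivity),
      abs_le_of_sq_le_sq (by nlinarith [sq_nonneg p.1]) (by positivity)⟩
  set T := ∑ k ∈ Finset.range (K + 1), 1 / (4 ^ k * δ k ^ 2) with hT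
  have hT0 : 0 ≤ T := Finset.sum_nonneg fun k _ => by have := hδ k; positivity
  have hcast : ((2 * N + 1 : ℕ) : ℝ) - 1 = 2 * N := by push_cast; ring
  -- At most `2 * (3/2 * s) + 1 ≤ 4 * s` rows are met, since `1 ≤ s`.
  have main := integral_sq_stripCount_le (θ := θ) (lo := lo) (hi := hi) (L := L)
    (B := C * (T + (4 * s) ^ 2 / 4 ^ K)) (n := 4 * s) (Y := 3 / 2 * s) (H := 2 * N + 1)
    (fun e => by rw [hθ, abs_neg]; exact (hsl e).2.1)
    (fun p hp => by
      rw [hcast]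
      have := hbound p hp
      exact ⟨this.1.trans (by linarith), this.2.trans (by linarith)⟩)
    (fun p hp => (hbound p hp).2) (by positivity) (by linarith)
    (fun e J β f hJ hcard hf =>
      hle (θ e) (4 * s) K δ (by positivity) hδ (hsl e).2.2 J β f hJ hcard hf)
  have hvol : (volume (stripSet θ lo hi)).toReal = N * volume.real (planeStrips φ c d) := by
    rw [← hpre, volume_frame_preimage α hs0 (isClosed_planeStrips φ c d).measurableSet, hs2]
  have hcount : ∀ u, stripCount θ lo hi (2 * N + 1) u = latCount α N u (planeStrips φ c d) := by
    intro u
    unfold stripCount latCount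
    rw [← hpre]
    rfl
  simp only [hvol, hcount] at main
  refine main.trans ?_
  have hNK : 0 ≤ (N : ℝ) / 4 ^ K := by positivity
  have e1 : (4 * s) ^ 2 / 4 ^ K = 16 * ((N : ℝ) / 4 ^ K) := by rw [mul_pow, hs2]; ring
  rw [e1, Fintype.card_fin]
  push_cast
  have h1 := mul_nonneg hC.le hT0
  have h2 := mul_nonneg hC.le hNK
  have h3 := mul_nonneg hC.le (sq_nonneg L)
  nlinarith [sq_nonneg L]

/-! ### Rectangles in the unit square and on the torus -/

/-- The half-open unit square. -/
def halfSquare : Set Plane := {x | ∀ i, x i ∈ Ico (0 : ℝ) 1}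

theorem halfSquare_subset : halfSquare ⊆ unitSquare := fun _ hx i => Ico_subset_Icc_self (hx i)

theorem measurableSet_halfSquare : MeasurableSet halfSquare := by
  have : halfSquare = ⋂ i, (fun x : Plane => x i) ⁻¹' Ico (0 : ℝ) 1 := by
    ext x; simp [halfSquare]
  rw [this]
  exact MeasurableSet.iInter fun i => (by fun_prop : Measurable fun x : Plane => x i) measurableSet_Ico

theorem crd_dir (φ ψ : ℝ) : crd φ (dir ψ) = Real.cos (ψ - φ) := by
  simp [crd, dir, Real.cos_sub]

theorem crd_smul (φ t : ℝ) (x : Plane) : crd φ (t • x) = t * crd φ x := by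
  simp [crd]; ring

theorem eq_crd_smul_dir (φ : ℝ) (x : Plane) :
    x = crd φ x • dir φ + crd (φ + Real.pi / 2) x • dir (φ + Real.pi / 2) := by
  ext i
  fin_cases i
  · simp [crd, dir, Real.cos_add_pi_div_two, Real.sin_add_pi_div_two]
    linear_combination (-(x 0)) * Real.sin_sq_add_cos_sq φ
  · simp [crd, dir, Real.cos_add_pi_div_two, Real.sin_add_pi_div_two]
    linear_combination (-(x 1)) * Real.sin_sq_add_cos_sq φ

theorem sq_add_sq_crd (φ : ℝ) (x : Plane) :
    crd φ x ^ 2 + crd (φ + Real.pi / 2) x ^ 2 = x 0 ^ 2 + x 1 ^ 2 := by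
  simp only [crd, Real.cos_add_pi_div_two, Real.sin_add_pi_div_two]
  linear_combination (x 0 ^ 2 + x 1 ^ 2) * Real.sin_sq_add_cos_sq φ

theorem mem_rect_iff (R : Rect) (x : Plane) : x ∈ R.toSet ↔
    (crd R.angle R.vertex ≤ crd R.angle x ∧ crd R.angle x ≤ crd R.angle R.vertex + R.width) ∧
    (crd (R.angle + Real.pi / 2) R.vertex ≤ crd (R.angle + Real.pi / 2) x ∧
      crd (R.angle + Real.pi / 2) x ≤ crd (R.angle + Real.pi / 2) R.vertex + R.height) := by
  constructor
  · rintro ⟨s, hs, t, ht, rfl⟩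
    simp only [crd_add, crd_smul, crd_dir, sub_self, Real.cos_zero, add_sub_cancel_left,
      Real.cos_pi_div_two, sub_add_cancel_left, Real.cos_neg, mul_zero, mul_one, add_zero]
    exact ⟨⟨by linarith [hs.1], by linarith [hs.2]⟩, ⟨by linarith [ht.1], by linarith [ht.2]⟩⟩
  · rintro ⟨⟨h1, h2⟩, h3, h4⟩
    refine ⟨crd R.angle (x - R.vertex), ?_, crd (R.angle + Real.pi / 2) (x - R.vertex), ?_, ?_⟩
    · rw [crd_sub]; constructor <;> linarith
    · rw [crd_sub]; constructor <;> linarith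
    · rw [add_assoc, ← eq_crd_smul_dir, add_sub_cancel]

/-- The vector of the plane with given integer coordinates. -/
noncomputable def zvec (z : Fin 2 → ℤ) : Plane := WithLp.toLp 2 fun i => (z i : ℝ)

/-- The directions of the sides of a rectangle and of the unit square. -/
noncomputable def sideAngles (R : Rect) : Fin 4 → ℝ := ![R.angle, R.angle + Real.pi / 2, 0, Real.pi / 2]

/-- Lower bounds for the coordinates of the points of the translate `R - z` in the unit square. -/
noncomputable def lowerSides (R : Rect) (z : Plane) : Fin 4 → ℝ :=
  ![crd R.angle (R.vertex - z), crd (R.angle + Real.pi / 2) (R.vertex - z), 0, 0]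

/-- Upper bounds for the coordinates of the points of the translate `R - z` in the unit square. -/
noncomputable def upperSides (R : Rect) (z : Plane) : Fin 4 → ℝ :=
  ![crd R.angle (R.vertex - z) + R.width, crd (R.angle + Real.pi / 2) (R.vertex - z) + R.height, 1, 1]

/-- The part of the translate `R - z` in the unit square. -/
noncomputable def cellPart (R : Rect) (z : Plane) : Set Plane :=
  planeStrips (sideAngles R) (lowerSides R z) (upperSides R z)

theorem mem_cellPart_iff {R : Rect} {z x : Plane} :
    x ∈ cellPart R z ↔ x ∈ unitSquare ∧ x + z ∈ R.toSet := by
  rw [mem_rect_iff]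
  simp only [cellPart, planeStrips, mem_ofPred_eq, unitSquare, Fin.forall_fin_succ, sideAngles,
    lowerSides, upperSides, crd_sub, crd_add, mem_Icc]
  simp [crd_zero_apply, crd_pi_div_two]
  constructor
  · rintro ⟨⟨h1, h2⟩, ⟨h3, h4⟩, h5, h6⟩
    refine ⟨⟨h5, h6⟩, ⟨?_, ?_⟩, ?_, ?_⟩ <;> linarith
  · rintro ⟨⟨h5, h6⟩, ⟨h1, h2⟩, h3, h4⟩
    refine ⟨⟨?_, ?_⟩, ⟨?_, ?_⟩, h5, h6⟩ <;> linarith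

theorem lowerSides_le_upperSides (R : Rect) (z : Plane) (e : Fin 4) :
    lowerSides R z e ≤ upperSides R z e := by
  have := R.width_pos
  have := R.height_pos
  fin_cases e <;> simp [lowerSides, upperSides] <;> linarith

theorem sideAngles_mem {R : Rect} {Ω : Set ℝ} (hR : R.angle ∈ Ω) (h0 : (0 : ℝ) ∈ Ω) (e : Fin 4) :
    ∃ ω ∈ Ω, sideAngles R e = ω ∨ sideAngles R e = ω + Real.pi / 2 := by
  fin_cases e
  · exact ⟨_, hR, Or.inl rfl⟩
  · exact ⟨_, hR, Or.inr rfl⟩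
  · exact ⟨_, h0, Or.inl rfl⟩
  · exact ⟨_, h0, Or.inr (by simp [sideAngles])⟩

/-- For almost every shift, no lattice point lies on one of countably many given lines. -/
theorem ae_crd_frame_ne {α s : ℝ} (hs : 0 < s) {T : Set (ℝ × ℝ)} (hT : T.Countable)
    (hcos : ∀ t ∈ T, Real.cos (t.1 - α) ≠ 0) :
    ∀ᵐ u : ℝ, ∀ t ∈ T, ∀ i j : ℤ, crd t.1 (frame α s ((i : ℝ) + u, (j : ℝ))) ≠ t.2 := by
  rw [ae_ball_iff hT]
  intro t ht
  rw [ae_all_iff]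
  intro i
  rw [ae_all_iff]
  intro j
  have hsub : {u : ℝ | ¬ crd t.1 (frame α s ((i : ℝ) + u, (j : ℝ))) ≠ t.2}
      ⊆ {(t.2 * s - j * Real.sin (t.1 - α)) / Real.cos (t.1 - α) - i} := by
    intro u hu
    have hu' : crd t.1 (frame α s ((i : ℝ) + u, (j : ℝ))) = t.2 := not_not.1 hu
    rw [crd_frame, div_eq_iff hs.ne'] at hu'
    rw [mem_singleton_iff, ← hu']
    have := hcos t ht
    field_simp
    ring
  exact measure_mono_null hsub (measure_singleton _)

/-- The boundary lines of the unit square and of the translates of a rectangle. -/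
noncomputable def sideLines (R : Rect) : Set (ℝ × ℝ) :=
  ⋃ z : Fin 2 → ℤ, ⋃ e : Fin 4, {(sideAngles R e, lowerSides R (zvec z) e),
    (sideAngles R e, upperSides R (zvec z) e)}

theorem countable_sideLines (R : Rect) : (sideLines R).Countable :=
  countable_iUnion fun _ => countable_iUnion fun _ => by simp

/-- A point is in general position if it lies on none of these lines. -/
def GeneralPosition (R : Rect) (x : Plane) : Prop := ∀ t ∈ sideLines R, crd t.1 x ≠ t.2

theorem GeneralPosition.ne_lower {R : Rect} {x : Plane} (h : GeneralPosition R x) (z : Fin 2 → ℤ)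
    (e : Fin 4) : crd (sideAngles R e) x ≠ lowerSides R (zvec z) e :=
  h (sideAngles R e, lowerSides R (zvec z) e) (mem_iUnion₂.2 ⟨z, e, Or.inl rfl⟩)

theorem GeneralPosition.ne_upper {R : Rect} {x : Plane} (h : GeneralPosition R x) (z : Fin 2 → ℤ)
    (e : Fin 4) : crd (sideAngles R e) x ≠ upperSides R (zvec z) e :=
  h (sideAngles R e, upperSides R (zvec z) e) (mem_iUnion₂.2 ⟨z, e, Or.inr rfl⟩)

theorem GeneralPosition.mem_halfSquare_iff {R : Rect} {x : Plane} (h : GeneralPosition R x) :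
    x ∈ halfSquare ↔ x ∈ unitSquare := by
  refine ⟨fun hx => halfSquare_subset hx, fun hx i => ⟨(hx i).1, lt_of_le_of_ne (hx i).2 ?_⟩⟩
  have h0 := h.ne_upper 0 2
  have h1 := h.ne_upper 0 3
  simp only [sideAngles, upperSides, Matrix.cons_val, crd_zero_apply, crd_pi_div_two] at h0 h1
  fin_cases i
  · exact h0
  · exact h1

theorem isBounded_rect (R : Rect) : Bornology.IsBounded R.toSet := by
  refine (Metric.isBounded_closedBall (x := R.vertex) (r := R.width + R.height)).subset ?_
  rintro _ ⟨s, hs, t, ht, rfl⟩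
  have hd : ∀ φ, ‖dir φ‖ = 1 := fun φ => by
    rw [dir, EuclideanSpace.norm_eq]
    simp
  rw [Metric.mem_closedBall, dist_eq_norm, add_assoc, add_sub_cancel_left]
  refine (norm_add_le _ _).trans ?_
  rw [norm_smul, norm_smul, hd, hd, Real.norm_eq_abs, Real.norm_eq_abs, abs_of_nonneg hs.1,
    abs_of_nonneg ht.1]
  linarith [hs.2, ht.2]

theorem isClosed_rect (R : Rect) : IsClosed R.toSet := by
  have : R.toSet = ({x | crd R.angle R.vertex ≤ crd R.angle x} ∩
      {x | crd R.angle x ≤ crd R.angle R.vertex + R.width}) ∩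
      ({x | crd (R.angle + Real.pi / 2) R.vertex ≤ crd (R.angle + Real.pi / 2) x} ∩
        {x | crd (R.angle + Real.pi / 2) x ≤ crd (R.angle + Real.pi / 2) R.vertex + R.height}) := by
    ext x; exact mem_rect_iff R x
  rw [this]
  exact ((isClosed_le continuous_const (continuous_crd _)).inter
    (isClosed_le (continuous_crd _) continuous_const)).inter
    ((isClosed_le continuous_const (continuous_crd _)).inter
    (isClosed_le (continuous_crd _) continuous_const))

theorem dist_sq_plane (x y : Plane) : dist x y ^ 2 = (x 0 - y 0) ^ 2 + (x 1 - y 1) ^ 2 := by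
  rw [EuclideanSpace.dist_eq, Real.sq_sqrt (by positivity)]
  simp [Fin.sum_univ_two, Real.dist_eq, sq_abs]

theorem sq_add_sq_le_one_of_diam {R : Rect} (h : Metric.diam R.toSet ≤ 1) :
    R.width ^ 2 + R.height ^ 2 ≤ 1 := by
  have hw := R.width_pos
  have hh := R.height_pos
  have h1 : R.vertex ∈ R.toSet := ⟨0, ⟨le_rfl, hw.le⟩, 0, ⟨le_rfl, hh.le⟩, by simp⟩
  have h2 : R.vertex + R.width • dir R.angle + R.height • dir (R.angle + Real.pi / 2) ∈ R.toSet :=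
    ⟨_, ⟨hw.le, le_rfl⟩, _, ⟨hh.le, le_rfl⟩, rfl⟩
  have h3 := (Metric.dist_le_diam_of_mem (isBounded_rect R) h2 h1).trans h
  have h4 := dist_sq_plane (R.vertex + R.width • dir R.angle + R.height • dir (R.angle + Real.pi / 2))
    R.vertex
  set w : Plane := R.width • dir R.angle + R.height • dir (R.angle + Real.pi / 2) with hw'
  rw [add_assoc, ← hw'] at h3 h4
  have h5 := sq_add_sq_crd R.angle w
  simp only [hw', crd_add, crd_smul, crd_dir, sub_self, Real.cos_zero, add_sub_cancel_left,
    Real.cos_pi_div_two, sub_add_cancel_left, Real.cos_neg, mul_zero, mul_one, add_zero, zero_add]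
    at h5
  rw [h5]
  simp only [PiLp.add_apply, add_sub_cancel_left] at h4
  rw [← hw', ← h4]
  exact pow_le_one₀ dist_nonneg h3

/-- The integer translations that can bring a rectangle of diameter at most one to the unit square. -/
noncomputable def nearShifts (R : Rect) : Finset (Fin 2 → ℤ) :=
  Finset.Icc (fun i => ⌊R.vertex i⌋ - 1) (fun i => ⌊R.vertex i⌋ + 1)

theorem card_nearShifts (R : Rect) : (nearShifts R).card = 9 := by
  rw [nearShifts, Pi.card_Icc]
  have h : ∀ a : ℤ, a + 1 + 1 - (a - 1) = 3 := fun a => by ring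
  simp [Int.card_Icc, h]

theorem mem_nearShifts {R : Rect} (hd : Metric.diam R.toSet ≤ 1) {x : Plane} (hx : x ∈ halfSquare)
    {z : Fin 2 → ℤ} (hz : x + zvec z ∈ R.toSet) : z ∈ nearShifts R := by
  have hv : R.vertex ∈ R.toSet :=
    ⟨0, ⟨le_rfl, R.width_pos.le⟩, 0, ⟨le_rfl, R.height_pos.le⟩, by simp⟩
  have h1 := (Metric.dist_le_diam_of_mem (isBounded_rect R) hz hv).trans hd
  have h2 := pow_le_one₀ (n := 2) dist_nonneg h1
  rw [dist_sq_plane] at h2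
  have key : ∀ i, |x i + z i - R.vertex i| ≤ 1 := by
    intro i
    rw [← sq_le_one_iff_abs_le_one]
    have e0 := sq_nonneg (x 0 + z 0 - R.vertex 0)
    have e1 := sq_nonneg (x 1 + z 1 - R.vertex 1)
    have h3 : (x 0 + z 0 - R.vertex 0) ^ 2 + (x 1 + z 1 - R.vertex 1) ^ 2 ≤ 1 := h2
    fin_cases i
    · exact (le_add_of_nonneg_right e1).trans h3
    · exact (le_add_of_nonneg_left e0).trans h3
  rw [nearShifts, Finset.mem_Icc]
  constructor
  · intro i
    have h3 := abs_le.1 (key i)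
    have h4 := hx i
    have h5 := Int.floor_le (R.vertex i)
    have : (⌊R.vertex i⌋ : ℝ) - 2 < z i := by linarith [h4.2]
    have : ⌊R.vertex i⌋ - 2 < z i := by exact_mod_cast this
    change ⌊R.vertex i⌋ - 1 ≤ z i
    omega
  · intro i
    have h3 := abs_le.1 (key i)
    have h4 := hx i
    have h5 := Int.lt_floor_add_one (R.vertex i)
    have : (z i : ℝ) < ⌊R.vertex i⌋ + 2 := by linarith [h4.1]
    have : z i < ⌊R.vertex i⌋ + 2 := by exact_mod_cast this
    change z i ≤ ⌊R.vertex i⌋ + 1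
    omega

theorem one_le_dist_zvec {z z' : Fin 2 → ℤ} (h : z ≠ z') (x : Plane) :
    1 ≤ ((x + zvec z) 0 - (x + zvec z') 0) ^ 2 + ((x + zvec z) 1 - (x + zvec z') 1) ^ 2 := by
  have h1 : (1 : ℤ) ≤ (z 0 - z' 0) ^ 2 + (z 1 - z' 1) ^ 2 := by
    by_contra hlt
    have h0 := sq_nonneg (z 0 - z' 0)
    have h0' := sq_nonneg (z 1 - z' 1)
    have e0 : (z 0 - z' 0) ^ 2 = 0 := by omega
    have e1 : (z 1 - z' 1) ^ 2 = 0 := by omega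
    apply h
    ext i
    fin_cases i
    · exact sub_eq_zero.1 (pow_eq_zero_iff two_ne_zero |>.1 e0)
    · exact sub_eq_zero.1 (pow_eq_zero_iff two_ne_zero |>.1 e1)
  have h2 : (1 : ℝ) ≤ ((z 0 : ℝ) - z' 0) ^ 2 + ((z 1 : ℝ) - z' 1) ^ 2 := by exact_mod_cast h1
  simpa [zvec] using h2

/-- A point in general position has at most one integer translate in a rectangle of diameter at most
one. -/
theorem GeneralPosition.unique {R : Rect} (hd : Metric.diam R.toSet ≤ 1) {x : Plane}
    (hx : GeneralPosition R x) {z z' : Fin 2 → ℤ} (hz : x + zvec z ∈ R.toSet)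
    (hz' : x + zvec z' ∈ R.toSet) : z = z' := by
  by_contra hne
  have h1 := one_le_dist_zvec hne x
  have h2 := sq_add_sq_le_one_of_diam hd
  have h3 := sq_add_sq_crd R.angle ((x + zvec z) - (x + zvec z'))
  rw [crd_sub, crd_sub] at h3
  simp only [PiLp.sub_apply] at h3
  obtain ⟨⟨a1, a2⟩, a3, a4⟩ := (mem_rect_iff R _).1 hz
  obtain ⟨⟨b1, b2⟩, b3, b4⟩ := (mem_rect_iff R _).1 hz'
  have hl := hx.ne_lower z 0
  have hu := hx.ne_upper z 0
  simp only [sideAngles, lowerSides, upperSides, Matrix.cons_val_zero, crd_sub] at hl hu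
  have ca := crd_add R.angle x (zvec z)
  have l1 : crd R.angle R.vertex < crd R.angle (x + zvec z) :=
    lt_of_le_of_ne a1 fun h => hl (by linarith)
  have l2 : crd R.angle (x + zvec z) < crd R.angle R.vertex + R.width :=
    lt_of_le_of_ne a2 fun h => hu (by linarith)
  -- General position makes this inequality strict. So the squared distance of the two translates is
  -- less than `width² + height² ≤ 1`, whereas distinct integer vectors are at distance at least
  -- one.
  have e1 : (crd R.angle (x + zvec z) - crd R.angle (x + zvec z')) ^ 2 < R.width ^ 2 := by
    apply sq_lt_sq'
    · linarith
    · linarith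
  have e2 : (crd (R.angle + Real.pi / 2) (x + zvec z)
      - crd (R.angle + Real.pi / 2) (x + zvec z')) ^ 2 ≤ R.height ^ 2 := by
    apply sq_le_sq'
    · linarith
    · linarith
  linarith

/-- By uniqueness of the integer translate nothing is counted twice, so the torus count splits into
nine counts for intersections of strips in the unit square. -/
theorem indicator_torus_eq_sum {R : Rect} (hd : Metric.diam R.toSet ≤ 1) {x : Plane}
    (hx : GeneralPosition R x) :
    (halfSquare ∩ modIntegers R.toSet).indicator (1 : Plane → ℝ) x
      = ∑ z ∈ nearShifts R, (cellPart R (zvec z)).indicator (1 : Plane → ℝ) x := by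
  by_cases hmem : x ∈ halfSquare ∩ modIntegers R.toSet
  · obtain ⟨z₀, hz₀⟩ := hmem.2
    rw [indicator_of_mem hmem, Finset.sum_eq_single z₀]
    · have hx₀ : x ∈ cellPart R (zvec z₀) := mem_cellPart_iff.2 ⟨halfSquare_subset hmem.1, hz₀⟩
      rw [indicator_of_mem hx₀]
    · intro z _ hne
      refine indicator_of_notMem (fun h => hne ?_) _
      exact hx.unique hd (mem_cellPart_iff.1 h).2 hz₀
    · intro h
      exact absurd (mem_nearShifts hd hmem.1 hz₀) h
  · rw [indicator_of_notMem hmem, Finset.sum_eq_zero]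
    intro z _
    refine indicator_of_notMem (fun h => hmem ?_) _
    obtain ⟨h1, h2⟩ := mem_cellPart_iff.1 h
    exact ⟨hx.mem_halfSquare_iff.2 h1, z, h2⟩

theorem volume_unitSquare_diff_halfSquare : volume (unitSquare \ halfSquare) = 0 := by
  have hsub : unitSquare \ halfSquare ⊆ ⋃ i : Fin 2, (WithLp.ofLp : Plane → Fin 2 → ℝ) ⁻¹'
      {f | f i = 1} := by
    rintro x ⟨h1, h2⟩
    obtain ⟨i, hi⟩ := not_forall.1 h2
    refine mem_iUnion.2 ⟨i, ?_⟩
    have h3 := h1 i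
    by_contra hne
    exact hi ⟨h3.1, lt_of_le_of_ne h3.2 hne⟩
  refine measure_mono_null hsub (measure_iUnion_null fun i => ?_)
  have hm : MeasurableSet {f : Fin 2 → ℝ | f i = 1} :=
    measurableSet_eq_fun (by fun_prop) (by fun_prop)
  rw [(PiLp.volume_preserving_ofLp (Fin 2)).measure_preimage hm.nullMeasurableSet, volume_pi]
  exact Measure.pi_hyperplane _ i 1

/-- The half-open unit cells tile the plane, and closing a cell adds a null set. -/
theorem volume_rect_eq_sum {R : Rect} (hd : Metric.diam R.toSet ≤ 1) :
    volume.real R.toSet = ∑ z ∈ nearShifts R, volume.real (cellPart R (zvec z)) := by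
  set A : (Fin 2 → ℤ) → Set Plane := fun z => R.toSet ∩ (fun x => x + -zvec z) ⁻¹' halfSquare with hA
  have hRm := (isClosed_rect R).measurableSet
  have hAm : ∀ z, MeasurableSet (A z) := fun z =>
    hRm.inter ((measurable_add_const _) measurableSet_halfSquare)
  have hfin : ∀ S ⊆ R.toSet, volume S ≠ ⊤ := fun S hS =>
    ((isBounded_rect R).subset hS).measure_lt_top.ne
  have hU : R.toSet = ⋃ z ∈ nearShifts R, A z := by
    refine subset_antisymm (fun x hx => ?_) (iUnion₂_subset fun z _ => inter_subset_left)
    have hh : x + -zvec (fun i => ⌊x i⌋) ∈ halfSquare := by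
      intro i
      have h1 := Int.floor_le (x i)
      have h2 := Int.lt_floor_add_one (x i)
      simp only [zvec, PiLp.add_apply, PiLp.neg_apply]
      constructor <;> linarith
    refine mem_iUnion₂.2 ⟨fun i => ⌊x i⌋, ?_, hx, hh⟩
    exact mem_nearShifts hd hh (by rwa [neg_add_cancel_right])
  have hdisj : PairwiseDisjoint (nearShifts R : Set (Fin 2 → ℤ)) A := by
    intro z _ z' _ hne
    rw [Function.onFun, disjoint_left]
    rintro x ⟨_, h1⟩ ⟨_, h2⟩
    apply hne
    ext i
    have e1 := h1 i
    have e2 := h2 i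
    simp only [zvec, PiLp.add_apply, PiLp.neg_apply, mem_Ico] at e1 e2
    have f1 : ((z i - z' i : ℤ) : ℝ) < 1 := by push_cast; linarith
    have f2 : ((z' i - z i : ℤ) : ℝ) < 1 := by push_cast; linarith
    have f1' : z i - z' i < 1 := by exact_mod_cast f1
    have f2' : z' i - z i < 1 := by exact_mod_cast f2
    omega
  have hpart : ∀ z, volume.real (cellPart R (zvec z)) = volume.real (A z) := by
    intro z
    rw [measureReal_def, measureReal_def]
    congr 1
    have h1 : volume (A z) = volume ((fun x => x + zvec z) ⁻¹' A z) :=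
      (measure_preimage_add_right volume (zvec z) (A z)).symm
    have h2 : (fun x => x + zvec z) ⁻¹' A z = cellPart R (zvec z) ∩ halfSquare := by
      ext x
      simp only [hA, mem_preimage, mem_inter_iff, add_neg_cancel_right, mem_cellPart_iff]
      exact ⟨fun h => ⟨⟨halfSquare_subset h.2, h.1⟩, h.2⟩, fun h => ⟨h.1.2, h.2⟩⟩
    rw [h1, h2]
    refine le_antisymm ?_ (measure_mono inter_subset_left)
    calc volume (cellPart R (zvec z))
        ≤ volume ((cellPart R (zvec z) ∩ halfSquare) ∪ (unitSquare \ halfSquare)) := by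
          refine measure_mono fun x hx => ?_
          by_cases h : x ∈ halfSquare
          · exact Or.inl ⟨hx, h⟩
          · exact Or.inr ⟨(mem_cellPart_iff.1 hx).1, h⟩
      _ ≤ _ := by
          refine (measure_union_le _ _).trans ?_
          rw [volume_unitSquare_diff_halfSquare, add_zero]
  conv_lhs => rw [hU]
  rw [measureReal_biUnion_finset hdisj (fun z _ => hAm z)
    (fun z _ => hfin _ inter_subset_left)]
  exact Finset.sum_congr rfl fun z _ => (hpart z).symm

theorem cellPart_subset (R : Rect) (z : Plane) : cellPart R z ⊆ unitSquare := fun _ hx =>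
  (mem_cellPart_iff.1 hx).1

theorem cellPart_zero {R : Rect} (h : R.toSet ⊆ unitSquare) : cellPart R 0 = R.toSet := by
  ext x
  rw [mem_cellPart_iff, add_zero]
  exact ⟨fun hx => hx.2, fun hx => ⟨h hx, hx⟩⟩

theorem cos_ne_zero_of_mem_sideLines {α L : ℝ} {Ω : Set ℝ} {δ : ℕ → ℝ} (hs : SlopeBound α Ω L δ)
    {R : Rect} (hR : R.angle ∈ Ω) (h0 : (0 : ℝ) ∈ Ω) : ∀ t ∈ sideLines R, Real.cos (t.1 - α) ≠ 0 := by
  intro t ht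
  obtain ⟨z, e, ht⟩ := mem_iUnion₂.1 ht
  obtain ⟨ω, hω, hφ⟩ := sideAngles_mem hR h0 e
  have : t.1 = sideAngles R e := by
    rcases ht with h | h
    · rw [h]
    · rw [mem_singleton_iff.1 h]
  rw [this]
  exact (hs ω hω _ hφ).1

/-- Each boundary line is transversal to the rows, so a given lattice point hits it for one `u`
only. Under an integral over `u` it is thus irrelevant whether the unit square is closed or
half-open. -/
theorem ae_generalPosition {α L : ℝ} {Ω : Set ℝ} {δ : ℕ → ℝ} (hs : SlopeBound α Ω L δ)
    {R : Rect} (hR : R.angle ∈ Ω) (h0 : (0 : ℝ) ∈ Ω) {N : ℕ} (hN : 1 ≤ N) :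
    ∀ᵐ u : ℝ, ∀ i j : ℤ, GeneralPosition R (frame α (Real.sqrt N) ((i : ℝ) + u, (j : ℝ))) := by
  have hN0 : 0 < Real.sqrt N := Real.sqrt_pos.2 (by exact_mod_cast hN)
  filter_upwards [ae_crd_frame_ne hN0 (countable_sideLines R)
    (cos_ne_zero_of_mem_sideLines hs hR h0)] with u hu i j t ht
  exact hu t ht i j

theorem measurable_latCount (α : ℝ) (N : ℕ) {S : Set Plane} (hS : MeasurableSet S) :
    Measurable fun u => latCount α N u S := by
  unfold latCount
  refine Finset.measurable_sum _ fun j _ => Finset.measurable_sum _ fun i _ => ?_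
  refine (measurable_one.indicator hS).comp ((continuous_frame _ _).measurable.comp ?_)
  fun_prop

theorem abs_latCount_le (α : ℝ) (N : ℕ) (u : ℝ) (S : Set Plane) :
    |latCount α N u S| ≤ (2 * (2 * N + 1) + 1) ^ 2 := by
  unfold latCount
  have h1 : ∀ x : Plane, |S.indicator (1 : Plane → ℝ) x| ≤ 1 := fun x => by
    by_cases h : x ∈ S <;> simp [h]
  have hc : ((Finset.Icc (-((2 * N + 1 : ℕ) : ℤ)) (2 * N + 1 : ℕ)).card : ℝ)
      = 2 * (2 * N + 1) + 1 := by
    rw [Int.card_Icc]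
    have : ((2 * N + 1 : ℕ) : ℤ) + 1 - -((2 * N + 1 : ℕ) : ℤ) = ((2 * (2 * N + 1) + 1 : ℕ) : ℤ) := by
      push_cast; ring
    rw [this, Int.toNat_natCast]
    push_cast
    ring
  calc _ ≤ ∑ j ∈ Finset.Icc (-((2 * N + 1 : ℕ) : ℤ)) (2 * N + 1 : ℕ),
        ∑ i ∈ Finset.Icc (-((2 * N + 1 : ℕ) : ℤ)) (2 * N + 1 : ℕ), (1 : ℝ) := by
        refine (Finset.abs_sum_le_sum_abs _ _).trans (Finset.sum_le_sum fun j _ => ?_)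
        exact (Finset.abs_sum_le_sum_abs _ _).trans (Finset.sum_le_sum fun i _ => h1 _)
    _ = _ := by
        simp only [Finset.sum_const, nsmul_eq_mul, mul_one, hc]
        ring

theorem intervalIntegrable_sq_latCount (α : ℝ) (N : ℕ) {S : Set Plane} (hS : MeasurableSet S)
    (c : ℝ) : IntervalIntegrable (fun u => (latCount α N u S - c) ^ 2) volume 0 1 := by
  refine intervalIntegrable_of_bounded (C := ((2 * (2 * N + 1) + 1) ^ 2 + |c|) ^ 2)
    (((measurable_latCount α N hS).sub_const c).pow_const 2) (fun u => ?_) _ _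
  rw [abs_pow]
  refine pow_le_pow_left₀ (abs_nonneg _) ?_ 2
  exact (abs_sub _ _).trans (by gcongr; exact abs_latCount_le _ _ _ _)

/-- The mean square discrepancy of a rectangle contained in the unit square, and of a rectangle of
diameter at most one on the torus. -/
theorem integral_sq_latCount_le : ∃ C : ℝ, 0 < C ∧ ∀ (α L : ℝ) (Ω : Set ℝ) (δ : ℕ → ℝ),
    (∀ k, 0 < δ k) → (0 : ℝ) ∈ Ω → SlopeBound α Ω L δ → ∀ (N K : ℕ), 1 ≤ N →
    ∀ R : Rect, R.angle ∈ Ω →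
    (R.toSet ⊆ unitSquare → ∫ u in (0 : ℝ)..1,
      (latCount α N u (halfSquare ∩ R.toSet) - N * volume.real R.toSet) ^ 2
        ≤ C * (L ^ 2 + ∑ k ∈ Finset.range (K + 1), 1 / (4 ^ k * δ k ^ 2) + N / 4 ^ K)) ∧
    (Metric.diam R.toSet ≤ 1 → ∫ u in (0 : ℝ)..1,
      (latCount α N u (halfSquare ∩ modIntegers R.toSet) - N * volume.real R.toSet) ^ 2
        ≤ C * (L ^ 2 + ∑ k ∈ Finset.range (K + 1), 1 / (4 ^ k * δ k ^ 2) + N / 4 ^ K)) := by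
  obtain ⟨C, hC, hle⟩ := integral_sq_latCount_planeStrips_le
  -- One factor `9` comes from Cauchy–Schwarz over the nine translates, the other from adding up
  -- their bounds.
  refine ⟨81 * C, by positivity, ?_⟩
  intro α L Ω δ hδ h0 hs N K hN R hR
  set E := L ^ 2 + ∑ k ∈ Finset.range (K + 1), 1 / (4 ^ k * δ k ^ 2) + N / 4 ^ K with hE
  have hT0 : 0 ≤ ∑ k ∈ Finset.range (K + 1), 1 / (4 ^ k * δ k ^ 2) :=
    Finset.sum_nonneg fun k _ => by have := hδ k; positivity
  have hE0 : 0 ≤ E := by positivity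
  have hgp := ae_generalPosition hs hR h0 hN
  have hpart : ∀ z, ∫ u in (0 : ℝ)..1,
      (latCount α N u (cellPart R z) - N * volume.real (cellPart R z)) ^ 2 ≤ C * E := fun z =>
    hle α L Ω δ hδ hs N K hN _ _ _ (sideAngles_mem hR h0) (lowerSides_le_upperSides R z)
      (cellPart_subset R z)
  constructor
  · intro hsub
    have h1 := hpart 0
    rw [cellPart_zero hsub] at h1
    refine le_trans (le_of_eq ?_) (h1.trans (by nlinarith [mul_nonneg hC.le hE0]))
    refine intervalIntegral.integral_congr_ae ?_
    filter_upwards [hgp] with u hu _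
    have : latCount α N u (halfSquare ∩ R.toSet) = latCount α N u R.toSet := by
      unfold latCount
      refine Finset.sum_congr rfl fun j _ => Finset.sum_congr rfl fun i _ => ?_
      have hx := hu i j
      set x := frame α (Real.sqrt N) ((i : ℝ) + u, (j : ℝ))
      have hiff : x ∈ halfSquare ∩ R.toSet ↔ x ∈ R.toSet :=
        ⟨fun h => h.2, fun h => ⟨hx.mem_halfSquare_iff.2 (hsub h), h⟩⟩
      by_cases h : x ∈ R.toSet
      · rw [indicator_of_mem h, indicator_of_mem (hiff.2 h)]
      · rw [indicator_of_notMem h, indicator_of_notMem (mt hiff.1 h)]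
    rw [this]
  · intro hd
    have hm : ∀ z, MeasurableSet (cellPart R z) := fun z => (isClosed_planeStrips _ _ _).measurableSet
    have hint := fun z : Fin 2 → ℤ => intervalIntegrable_sq_latCount α N (hm (zvec z))
      (N * volume.real (cellPart R (zvec z)))
    set D : (Fin 2 → ℤ) → ℝ → ℝ := fun z u =>
      latCount α N u (cellPart R (zvec z)) - N * volume.real (cellPart R (zvec z)) with hD
    have hsum : ∀ᵐ u : ℝ, latCount α N u (halfSquare ∩ modIntegers R.toSet)
        - N * volume.real R.toSet = ∑ z ∈ nearShifts R, D z u := by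
      filter_upwards [hgp] with u hu
      rw [hD, Finset.sum_sub_distrib, ← Finset.mul_sum, ← volume_rect_eq_sum hd]
      congr 1
      unfold latCount
      symm
      rw [Finset.sum_comm]
      refine Finset.sum_congr rfl fun j _ => ?_
      rw [Finset.sum_comm]
      exact Finset.sum_congr rfl fun i _ => (indicator_torus_eq_sum hd (hu i j)).symm
    have hDint : IntervalIntegrable (fun u => ∑ z ∈ nearShifts R, D z u ^ 2) volume 0 1 := by
      simpa only [Finset.sum_fn] using IntervalIntegrable.sum (nearShifts R) fun z _ => hint z
    calc ∫ u in (0 : ℝ)..1,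
          (latCount α N u (halfSquare ∩ modIntegers R.toSet) - N * volume.real R.toSet) ^ 2
        = ∫ u in (0 : ℝ)..1, (∑ z ∈ nearShifts R, D z u) ^ 2 := by
          refine intervalIntegral.integral_congr_ae ?_
          filter_upwards [hsum] with u hu _
          rw [hu]
      _ ≤ ∫ u in (0 : ℝ)..1, 9 * ∑ z ∈ nearShifts R, D z u ^ 2 := by
          have hpt : ∀ u, (∑ z ∈ nearShifts R, D z u) ^ 2 ≤ 9 * ∑ z ∈ nearShifts R, D z u ^ 2 := by
            intro u
            have := sq_sum_le_card_mul_sum_sq (s := nearShifts R) (f := fun z => D z u)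
            rw [card_nearShifts] at this
            exact_mod_cast this
          refine intervalIntegral.integral_mono_on zero_le_one ?_ (hDint.const_mul 9)
            fun u _ => hpt u
          refine IntervalIntegrable.mono_fun' (hDint.const_mul 9) ?_ (ae_of_all _ fun u => ?_)
          · refine ((Finset.measurable_sum _ fun z _ => ?_).pow_const 2).aestronglyMeasurable
            exact (measurable_latCount α N (hm (zvec z))).sub_const _
          · change ‖_‖ ≤ _
            rw [Real.norm_eq_abs, abs_of_nonneg (sq_nonneg _)]
            exact hpt u
      _ = 9 * ∑ z ∈ nearShifts R, ∫ u in (0 : ℝ)..1, D z u ^ 2 := by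
          rw [intervalIntegral.integral_const_mul, intervalIntegral.integral_finsetSum fun z _ => hint z]
      _ ≤ 9 * ∑ _z ∈ nearShifts R, C * E := by
          gcongr with z
          exact hpart (zvec z)
      _ = 81 * C * E := by
          rw [Finset.sum_const, card_nearShifts]
          ring

/-! ### Choice of the shift and of the point set -/

open Classical in
/-- The points of the shifted lattice in the half-open unit square. -/
noncomputable def latPoints (α : ℝ) (N : ℕ) (u : ℝ) : Finset Plane :=
  {x ∈ (Finset.Icc (-((2 * N + 1 : ℕ) : ℤ)) (2 * N + 1 : ℕ) ×ˢ
    Finset.Icc (-((2 * N + 1 : ℕ) : ℤ)) (2 * N + 1 : ℕ)).image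
      fun p : ℤ × ℤ => frame α (Real.sqrt N) ((p.2 : ℝ) + u, (p.1 : ℝ)) | x ∈ halfSquare}

theorem latPoints_subset (α : ℝ) (N : ℕ) (u : ℝ) : (latPoints α N u : Set Plane) ⊆ unitSquare := by
  intro x hx
  rw [latPoints, Finset.coe_filter] at hx
  exact halfSquare_subset hx.2

theorem ncard_latPoints_inter (α : ℝ) {N : ℕ} (hN : 1 ≤ N) (u : ℝ) (S : Set Plane) :
    (((latPoints α N u : Set Plane) ∩ S).ncard : ℝ) = latCount α N u (halfSquare ∩ S) := by
  classical
  have hN0 : 0 < Real.sqrt N := Real.sqrt_pos.2 (by exact_mod_cast hN)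
  set B := Finset.Icc (-((2 * N + 1 : ℕ) : ℤ)) (2 * N + 1 : ℕ) with hB
  set f : ℤ × ℤ → Plane := fun p => frame α (Real.sqrt N) ((p.2 : ℝ) + u, (p.1 : ℝ)) with hf
  have hinj : Function.Injective f := by
    intro p q h
    have h1 := Prod.mk.inj (frame_injective α hN0 h)
    have h2 : (p.2 : ℝ) = q.2 := add_right_cancel h1.1
    exact Prod.ext (by exact_mod_cast h1.2) (by exact_mod_cast h2)
  have h1 : ((latPoints α N u : Set Plane) ∩ S) = ((B ×ˢ B).image f).filter (· ∈ halfSquare ∩ S) := by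
    ext x
    simp only [latPoints, mem_inter_iff, Finset.mem_coe, Finset.mem_filter, ← hB, ← hf]
    tauto
  rw [h1, ncard_coe_finset, Finset.filter_image, Finset.card_image_of_injective _ hinj,
    Finset.card_filter, latCount, Finset.sum_product, Nat.cast_sum]
  refine Finset.sum_congr rfl fun j _ => ?_
  rw [Nat.cast_sum]
  refine Finset.sum_congr rfl fun i _ => ?_
  rw [indicator_apply]
  simp [hf]

theorem unitSquare_infinite : unitSquare.Infinite := by
  have h : (fun t : ℝ => (!₂[t, 0] : Plane)) '' Icc 0 1 ⊆ unitSquare := by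
    rintro _ ⟨t, ht, rfl⟩ i
    fin_cases i
    · exact ht
    · simp
  refine Infinite.mono h ((Icc_infinite zero_lt_one).image fun s _ t _ hst => ?_)
  have := congrArg (fun x : Plane => x 0) hst
  simpa using this

/-- A finite set of points of the unit square can be turned into one of prescribed cardinality by
removing or adding points. -/
theorem exists_card_eq_of_subset_unitSquare {Q : Finset Plane} (hQ : (Q : Set Plane) ⊆ unitSquare)
    (N : ℕ) : ∃ P : Finset Plane, (P : Set Plane) ⊆ unitSquare ∧ P.card = N ∧ ∀ S : Set Plane,
      |(((P : Set Plane) ∩ S).ncard : ℝ) - ((Q : Set Plane) ∩ S).ncard| ≤ |(Q.card : ℝ) - N| := by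
  classical
  have key : ∀ P Q : Finset Plane, P ⊆ Q → ∀ S : Set Plane,
      |(((P : Set Plane) ∩ S).ncard : ℝ) - ((Q : Set Plane) ∩ S).ncard| ≤ (Q.card : ℝ) - P.card := by
    intro P Q hPQ S
    have e : ∀ T : Finset Plane, ((T : Set Plane) ∩ S).ncard = (T.filter (· ∈ S)).card := fun T => by
      rw [← ncard_coe_finset]; congr 1; ext x; simp
    have h1 : (P.filter (· ∈ S)).card ≤ (Q.filter (· ∈ S)).card :=
      Finset.card_le_card (Finset.filter_subset_filter _ hPQ)
    have h2 : (Q.filter (· ∈ S)).card ≤ (P.filter (· ∈ S)).card + (Q \ P).card := by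
      refine (Finset.card_le_card fun x hx => ?_).trans (Finset.card_union_le _ _)
      simp only [Finset.mem_union, Finset.mem_filter, Finset.mem_sdiff] at hx ⊢
      tauto
    have h3 := Finset.card_sdiff_add_card_eq_card hPQ
    have h1' : ((P.filter (· ∈ S)).card : ℝ) ≤ (Q.filter (· ∈ S)).card := by exact_mod_cast h1
    have h2' : ((Q.filter (· ∈ S)).card : ℝ) ≤ (P.filter (· ∈ S)).card + (Q \ P).card := by
      exact_mod_cast h2
    have h3' : ((Q \ P).card : ℝ) + P.card = Q.card := by exact_mod_cast h3
    rw [e, e, abs_le]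
    constructor <;> linarith
  rcases le_total N Q.card with h | h
  · obtain ⟨P, hPQ, hP⟩ := Finset.exists_subset_card_eq h
    refine ⟨P, fun x hx => hQ (hPQ hx), hP, fun S => ?_⟩
    rw [← hP]
    exact (key P Q hPQ S).trans (le_abs_self _)
  · obtain ⟨T, hT, hTc⟩ := (unitSquare_infinite.sdiff Q.finite_toSet).exists_subset_card_eq
      (N - Q.card)
    have hd : Disjoint Q T := Finset.disjoint_right.2 fun x hx => (hT hx).2
    refine ⟨Q ∪ T, ?_, ?_, fun S => ?_⟩
    · intro x hx
      rcases Finset.mem_union.1 hx with h | h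
      · exact hQ h
      · exact (hT h).1
    · rw [Finset.card_union_of_disjoint hd, hTc]
      omega
    · have h1 := key Q (Q ∪ T) Finset.subset_union_left S
      rw [abs_sub_comm]
      refine h1.trans ?_
      rw [Finset.card_union_of_disjoint hd, hTc, Nat.cast_add, Nat.cast_sub h, abs_sub_comm]
      refine le_trans (le_of_eq ?_) (le_abs_self _)
      ring

/-- There is a shift whose mean square error does not exceed the average over the shifts. -/
theorem exists_shift {X : Type*} [MeasurableSpace X] (μ : Measure X) [IsProbabilityMeasure μ]
    {F : X → ℝ → ℝ} (hF : Measurable (Function.uncurry F)) {e : ℝ → ℝ} (he : Measurable e)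
    (hFi : ∀ x, IntervalIntegrable (fun u => F x u ^ 2) volume 0 1)
    (hei : IntervalIntegrable (fun u => e u ^ 2) volume 0 1) :
    ∃ u : ℝ, ∀ E : ℝ, (∀ x, ∫ u in (0 : ℝ)..1, F x u ^ 2 ≤ E) → (∫ u in (0 : ℝ)..1, e u ^ 2 ≤ E) →
      ∫⁻ x, ENNReal.ofReal (F x u ^ 2) ∂μ + ENNReal.ofReal (e u ^ 2)
        ≤ ENNReal.ofReal E + ENNReal.ofReal E := by
  have hF2 : Measurable fun p : X × ℝ => ENNReal.ofReal (F p.1 p.2 ^ 2) :=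
    (hF.pow_const 2).ennreal_ofReal
  have hswap : Measurable fun u => ∫⁻ x, ENNReal.ofReal (F x u ^ 2) ∂μ := hF2.lintegral_prod_left'
  have hprob : IsProbabilityMeasure (volume.restrict (Ioc (0 : ℝ) 1)) := ⟨by simp⟩
  -- The shift is chosen below the average of both errors together, before any bound `E` is given.
  -- It therefore serves all bounds at once.
  obtain ⟨u, hu⟩ := exists_le_lintegral (μ := volume.restrict (Ioc (0 : ℝ) 1))
    (hswap.add (he.pow_const 2).ennreal_ofReal).aemeasurable
  refine ⟨u, fun E hE1 hE2 => hu.trans ?_⟩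
  have conv : ∀ g : ℝ → ℝ, IntervalIntegrable (fun u => g u ^ 2) volume 0 1 →
      ∫ u in (0 : ℝ)..1, g u ^ 2 ≤ E →
      ∫⁻ u in Ioc (0 : ℝ) 1, ENNReal.ofReal (g u ^ 2) ≤ ENNReal.ofReal E := by
    intro g hg hle
    rw [← ofReal_integral_eq_lintegral_ofReal
      ((intervalIntegrable_iff_integrableOn_Ioc_of_le zero_le_one).1 hg)
      (ae_of_all _ fun u => sq_nonneg _), ← intervalIntegral.integral_of_le zero_le_one]
    exact ENNReal.ofReal_le_ofReal hle
  refine (lintegral_add_left hswap _).trans_le (add_le_add ?_ (conv e hei hE2))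
  rw [lintegral_lintegral_swap (f := fun u x => ENNReal.ofReal (F x u ^ 2))
    (hF2.comp measurable_swap).aemeasurable]
  calc ∫⁻ x, (∫⁻ u in Ioc (0 : ℝ) 1, ENNReal.ofReal (F x u ^ 2)) ∂μ
      ≤ ∫⁻ _, ENNReal.ofReal E ∂μ := lintegral_mono fun x => conv (F x) (hFi x) (hE1 x)
    _ = ENNReal.ofReal E := by simp

theorem eLpNorm_two_le_of_lintegral_le {X : Type*} [MeasurableSpace X] {μ : Measure X} {f : X → ℝ}
    {E : ℝ} (h : ∫⁻ x, ENNReal.ofReal (f x ^ 2) ∂μ ≤ ENNReal.ofReal E) :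
    eLpNorm f 2 μ ≤ ENNReal.ofReal (Real.sqrt E) := by
  rw [eLpNorm_eq_lintegral_rpow_enorm_toReal two_ne_zero ENNReal.ofNat_ne_top]
  have h1 : ∀ x, ‖f x‖ₑ ^ (2 : ENNReal).toReal = ENNReal.ofReal (f x ^ 2) := fun x => by
    rw [ENNReal.toReal_ofNat, Real.enorm_eq_ofReal_abs,
      ENNReal.ofReal_rpow_of_nonneg (abs_nonneg _) zero_le_two, Real.rpow_two, sq_abs]
  simp only [h1]
  refine (ENNReal.rpow_le_rpow h (by simp)).trans (le_of_eq ?_)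
  rcases le_total 0 E with hE | hE
  · rw [ENNReal.ofReal_rpow_of_nonneg hE (by simp), ENNReal.toReal_ofNat, Real.sqrt_eq_rpow]
  · rw [ENNReal.ofReal_of_nonpos hE, Real.sqrt_eq_zero_of_nonpos hE]
    simp

/-- The measurability of the counting function in the sets and in the shift. -/
theorem measurable_latCount_uncurry (α : ℝ) (N : ℕ) {X : Type*} [MeasurableSpace X]
    {A : X → Set Plane} (hA : MeasurableSet {p : X × Plane | p.2 ∈ A p.1}) :
    Measurable fun p : X × ℝ => latCount α N p.2 (A p.1) := by
  unfold latCount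
  refine Finset.measurable_sum _ fun j _ => Finset.measurable_sum _ fun i _ => ?_
  have h1 : Measurable fun p : X × ℝ => (p.1, frame α (Real.sqrt N) ((i : ℝ) + p.2, (j : ℝ))) :=
    measurable_fst.prodMk ((continuous_frame _ _).measurable.comp (by fun_prop))
  exact (measurable_one.indicator hA).comp h1

theorem sq_sub_le_of_abs_sub_le {a b e : ℝ} (h : |a - b| ≤ |e|) (c : ℝ) :
    (a - c) ^ 2 ≤ 2 * ((b - c) ^ 2 + e ^ 2) := by
  have h1 := sq_le_sq.2 h
  nlinarith [sq_nonneg ((a - b) - (b - c))]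

/-- The choice of the point set. -/
theorem exists_pointSet (α : ℝ) {N : ℕ} (hN : 1 ≤ N) {X : Type*} [MeasurableSpace X]
    {A : X → Set Plane} (hA : MeasurableSet {p : X × Plane | p.2 ∈ A p.1}) {V : X → ℝ}
    (hV : Measurable V) (μ : Measure X) [IsProbabilityMeasure μ] :
    ∃ P : Finset Plane, (P : Set Plane) ⊆ unitSquare ∧ P.card = N ∧ ∀ E : ℝ,
      (∀ x, ∫ u in (0 : ℝ)..1, (latCount α N u (halfSquare ∩ A x) - N * V x) ^ 2 ≤ E) →
      (∫ u in (0 : ℝ)..1, (latCount α N u halfSquare - N) ^ 2 ≤ E) →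
      eLpNorm (fun x => (((P : Set Plane) ∩ A x).ncard : ℝ) - P.card * V x) 2 μ
        ≤ ENNReal.ofReal (Real.sqrt (4 * E)) := by
  have hAh : MeasurableSet {p : X × Plane | p.2 ∈ halfSquare ∩ A p.1} :=
    (measurable_snd measurableSet_halfSquare).inter hA
  have hsec : ∀ x, MeasurableSet (halfSquare ∩ A x) := fun x =>
    (measurable_prodMk_left (x := x) : Measurable fun y : Plane => (x, y)) hAh
  set F : X → ℝ → ℝ := fun x u => latCount α N u (halfSquare ∩ A x) - N * V x with hFdef
  set e : ℝ → ℝ := fun u => latCount α N u halfSquare - N with hedef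
  have hF : Measurable (Function.uncurry F) :=
    (measurable_latCount_uncurry α N (A := fun x => halfSquare ∩ A x) hAh).sub
      ((hV.comp measurable_fst).const_mul (N : ℝ))
  obtain ⟨u, hu⟩ := exists_shift μ hF
    (show Measurable e from (measurable_latCount α N measurableSet_halfSquare).sub_const _)
    (fun x => intervalIntegrable_sq_latCount α N (hsec x) _)
    (intervalIntegrable_sq_latCount α N measurableSet_halfSquare _)
  -- Correcting the number of points changes every count by at most `|e u|`, the error for the whole
  -- square; this was averaged along with the rest.
  obtain ⟨P, hP, hPN, hPQ⟩ := exists_card_eq_of_subset_unitSquare (latPoints_subset α N u) N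
  refine ⟨P, hP, hPN, fun E hE1 hE2 => eLpNorm_two_le_of_lintegral_le ?_⟩
  have hE0 : 0 ≤ E :=
    (intervalIntegral.integral_nonneg zero_le_one fun u _ => sq_nonneg (e u)).trans hE2
  have hcard : ((latPoints α N u).card : ℝ) = latCount α N u halfSquare := by
    have := ncard_latPoints_inter α hN u univ
    rwa [inter_univ, inter_univ, ncard_coe_finset] at this
  have hFm : Measurable fun x => F x u := hF.of_uncurry_right
  have hpt : ∀ x, ENNReal.ofReal (((((P : Set Plane) ∩ A x).ncard : ℝ) - P.card * V x) ^ 2)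
      ≤ 2 * (ENNReal.ofReal (F x u ^ 2) + ENNReal.ofReal (e u ^ 2)) := by
    intro x
    have h1 := hPQ (A x)
    rw [ncard_latPoints_inter α hN, hcard] at h1
    rw [← ENNReal.ofReal_add (sq_nonneg _) (sq_nonneg _), ← ENNReal.ofReal_ofNat 2,
      ← ENNReal.ofReal_mul zero_le_two, hPN]
    exact ENNReal.ofReal_le_ofReal (sq_sub_le_of_abs_sub_le h1 _)
  calc ∫⁻ x, ENNReal.ofReal (((((P : Set Plane) ∩ A x).ncard : ℝ) - P.card * V x) ^ 2) ∂μ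
      ≤ ∫⁻ x, 2 * (ENNReal.ofReal (F x u ^ 2) + ENNReal.ofReal (e u ^ 2)) ∂μ := lintegral_mono hpt
    _ = 2 * (∫⁻ x, ENNReal.ofReal (F x u ^ 2) ∂μ + ENNReal.ofReal (e u ^ 2)) := by
        rw [lintegral_const_mul _ ((hFm.pow_const 2).ennreal_ofReal.add_const _),
          lintegral_add_right _ measurable_const, lintegral_const, measure_univ, mul_one]
    _ ≤ 2 * (ENNReal.ofReal E + ENNReal.ofReal E) := mul_le_mul_right (hu E hE1 hE2) _
    _ = ENNReal.ofReal (4 * E) := by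
        rw [← ENNReal.ofReal_add hE0 hE0, ← ENNReal.ofReal_ofNat 2, ← ENNReal.ofReal_mul zero_le_two]
        congr 1
        ring

theorem measurable_rect_parameters :
    Measurable fun R : Rect => (R.vertex, R.angle, R.width, R.height) := comap_measurable _

theorem measurableSet_mem_rect : MeasurableSet {p : Rect × Plane | p.2 ∈ p.1.toSet} := by
  have hv : Measurable Rect.vertex := measurable_rect_parameters.fst
  have ha : Measurable Rect.angle := measurable_rect_parameters.snd.fst
  have hw : Measurable Rect.width := measurable_rect_parameters.snd.snd.fst
  have hh : Measurable Rect.height := measurable_rect_parameters.snd.snd.snd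
  have hc : ∀ (f : Rect × Plane → ℝ) (g : Rect × Plane → Plane), Measurable f → Measurable g →
      Measurable fun p => crd (f p) (g p) := by
    intro f g hf hg
    unfold crd
    fun_prop
  have ha' : Measurable fun p : Rect × Plane => p.1.angle := ha.comp measurable_fst
  have hv' : Measurable fun p : Rect × Plane => p.1.vertex := hv.comp measurable_fst
  have hw' : Measurable fun p : Rect × Plane => p.1.width := hw.comp measurable_fst
  have hh' : Measurable fun p : Rect × Plane => p.1.height := hh.comp measurable_fst
  have ha2 := ha'.add_const (Real.pi / 2)
  simp only [mem_rect_iff]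
  exact ((measurableSet_le (hc _ _ ha' hv') (hc _ _ ha' measurable_snd)).inter
    (measurableSet_le (hc _ _ ha' measurable_snd) ((hc _ _ ha' hv').add hw'))).inter
    ((measurableSet_le (hc _ _ ha2 hv') (hc _ _ ha2 measurable_snd)).inter
    (measurableSet_le (hc _ _ ha2 measurable_snd) ((hc _ _ ha2 hv').add hh')))

theorem measurableSet_mem_modIntegers :
    MeasurableSet {p : Rect × Plane | p.2 ∈ modIntegers p.1.toSet} := by
  have : {p : Rect × Plane | p.2 ∈ modIntegers p.1.toSet}
      = ⋃ z : Fin 2 → ℤ, (fun p => (p.1, p.2 + zvec z)) ⁻¹' {p : Rect × Plane | p.2 ∈ p.1.toSet} := by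
    ext p; simp [modIntegers, zvec]
  rw [this]
  refine MeasurableSet.iUnion fun z => ?_
  have hm : Measurable fun p : Rect × Plane => (p.1, p.2 + zvec z) := by fun_prop
  exact hm measurableSet_mem_rect

theorem measurable_area : Measurable fun R : Rect => volume.real R.toSet :=
  (measurable_measure_prodMk_left measurableSet_mem_rect).ennreal_toReal

/-- The unit square as a rectangle. -/
noncomputable def unitRect : Rect := ⟨0, 0, 1, 1, one_pos, one_pos⟩

theorem unitRect_toSet : unitRect.toSet = unitSquare := by
  ext x
  rw [mem_rect_iff]
  simp [unitRect, unitSquare, crd, Fin.forall_fin_two]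

theorem volume_unitSquare : volume.real unitSquare = 1 := by
  have h : unitSquare = (WithLp.ofLp : Plane → Fin 2 → ℝ) ⁻¹' Icc 0 1 := by
    ext x
    simp [unitSquare, Pi.le_def, forall_and]
  rw [measureReal_def, h, (PiLp.volume_preserving_ofLp (Fin 2)).measure_preimage
    measurableSet_Icc.nullMeasurableSet, Real.volume_Icc_pi]
  simp

/-- Small mean square discrepancy with respect to rectangles in the unit square and on the torus. -/
theorem exists_pointSet_rectangles : ∃ C : ℝ, 0 < C ∧ ∀ (α : ℝ) (Ω : Set ℝ) (N : ℕ), 1 ≤ N →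
    (∀ μ : Measure (squareRectangles Ω), IsProbabilityMeasure μ →
      ∃ P : Finset Plane, (P : Set Plane) ⊆ unitSquare ∧ P.card = N ∧
        ∀ (L : ℝ) (δ : ℕ → ℝ) (K : ℕ), (∀ k, 0 < δ k) → SlopeBound α (insert 0 Ω) L δ →
          eLpNorm (fun R : squareRectangles Ω => discrepancy P R) 2 μ ≤ ENNReal.ofReal (Real.sqrt
            (C * (L ^ 2 + ∑ k ∈ Finset.range (K + 1), 1 / (4 ^ k * δ k ^ 2) + N / 4 ^ K)))) ∧
    (∀ μ : Measure (torusRectangles Ω), IsProbabilityMeasure μ →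
      ∃ P : Finset Plane, (P : Set Plane) ⊆ unitSquare ∧ P.card = N ∧
        ∀ (L : ℝ) (δ : ℕ → ℝ) (K : ℕ), (∀ k, 0 < δ k) → SlopeBound α (insert 0 Ω) L δ →
          eLpNorm (fun R : torusRectangles Ω => torusDiscrepancy P R) 2 μ ≤ ENNReal.ofReal (Real.sqrt
            (C * (L ^ 2 + ∑ k ∈ Finset.range (K + 1), 1 / (4 ^ k * δ k ^ 2) + N / 4 ^ K)))) := by
  obtain ⟨C, hC, hle⟩ := integral_sq_latCount_le
  refine ⟨4 * C, by positivity, fun α Ω N hN => ?_⟩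
  -- The unit square is itself a rectangle of angle `0`. Its sides also bound the parts of the other
  -- rectangles, and so `0` is adjoined to `Ω`.
  have hunit : ∀ (L : ℝ) (δ : ℕ → ℝ) (K : ℕ), (∀ k, 0 < δ k) → SlopeBound α (insert 0 Ω) L δ →
      ∫ u in (0 : ℝ)..1, (latCount α N u halfSquare - N) ^ 2
        ≤ C * (L ^ 2 + ∑ k ∈ Finset.range (K + 1), 1 / (4 ^ k * δ k ^ 2) + N / 4 ^ K) := by
    intro L δ K hδ hs
    have := (hle α L _ δ hδ (mem_insert _ _) hs N K hN unitRect (mem_insert _ _)).1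
      unitRect_toSet.subset
    rwa [unitRect_toSet, volume_unitSquare, mul_one, inter_eq_left.2 halfSquare_subset] at this
  constructor
  · intro μ hμ
    have hi : Measurable fun p : squareRectangles Ω × Plane => ((p.1 : Rect), p.2) :=
      (measurable_subtype_coe.comp measurable_fst).prodMk measurable_snd
    obtain ⟨P, hP, hPN, hPE⟩ := exists_pointSet α hN
      (A := fun R : squareRectangles Ω => (R : Rect).toSet) (hi measurableSet_mem_rect)
      (measurable_area.comp measurable_subtype_coe) μ
    refine ⟨P, hP, hPN, fun L δ K hδ hs => ?_⟩
    rw [mul_assoc]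
    exact hPE _ (fun R => (hle α L _ δ hδ (mem_insert _ _) hs N K hN R
      (mem_insert_of_mem _ R.2.1)).1 R.2.2) (hunit L δ K hδ hs)
  · intro μ hμ
    have hi : Measurable fun p : torusRectangles Ω × Plane => ((p.1 : Rect), p.2) :=
      (measurable_subtype_coe.comp measurable_fst).prodMk measurable_snd
    obtain ⟨P, hP, hPN, hPE⟩ := exists_pointSet α hN
      (A := fun R : torusRectangles Ω => modIntegers (R : Rect).toSet)
      (hi measurableSet_mem_modIntegers) (measurable_area.comp measurable_subtype_coe) μ
    refine ⟨P, hP, hPN, fun L δ K hδ hs => ?_⟩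
    rw [mul_assoc]
    exact hPE _ (fun R => (hle α L _ δ hδ (mem_insert _ _) hs N K hN R
      (mem_insert_of_mem _ R.2.1)).2 R.2.2) (hunit L δ K hδ hs)

/-! ### Summation of the bounds and conclusion -/

theorem one_le_lg (N : ℕ) : 1 ≤ lg N := le_max_left _ _

theorem natCeil_logb_add_one_le {N : ℕ} (hN : 1 ≤ N) {b : ℝ} (h0 : 0 ≤ b) (h1 : b ≤ 1) :
    (⌈b * Real.logb 2 N⌉₊ : ℝ) + 1 ≤ 3 * lg N := by
  have hl : 0 ≤ Real.logb 2 N := Real.logb_nonneg one_lt_two (by exact_mod_cast hN)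
  have h2 := (Nat.ceil_lt_add_one (mul_nonneg h0 hl)).le
  have h3 : b * Real.logb 2 N ≤ Real.logb 2 N := mul_le_of_le_one_left hl h1
  have h4 : Real.logb 2 N ≤ lg N := le_max_right _ _
  linarith [one_le_lg N]

theorem rpow_le_two_pow_natCeil {N : ℕ} (hN : 1 ≤ N) (b : ℝ) :
    (N : ℝ) ^ b ≤ 2 ^ ⌈b * Real.logb 2 N⌉₊ := by
  have hN0 : (0 : ℝ) < N := by exact_mod_cast hN
  rw [← Real.rpow_natCast, ← Real.logb_le_iff_le_rpow one_lt_two (Real.rpow_pos_of_pos hN0 _),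
    Real.logb_rpow_eq_mul_logb_of_pos hN0]
  exact Nat.le_ceil _

theorem two_pow_natCeil_le {N : ℕ} (hN : 1 ≤ N) {b : ℝ} (h0 : 0 ≤ b) :
    (2 : ℝ) ^ ⌈b * Real.logb 2 N⌉₊ ≤ 2 * (N : ℝ) ^ b := by
  have hN0 : (0 : ℝ) < N := by exact_mod_cast hN
  have hl : 0 ≤ Real.logb 2 N := Real.logb_nonneg one_lt_two (by exact_mod_cast hN)
  have h2 := (Nat.ceil_lt_add_one (mul_nonneg h0 hl)).le
  rw [← Real.rpow_natCast]
  refine (Real.rpow_le_rpow_of_exponent_le one_le_two h2).trans (le_of_eq ?_)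
  rw [Real.rpow_add two_pos, Real.rpow_one, mul_comm, mul_comm b, Real.rpow_mul zero_le_two,
    Real.rpow_logb two_pos (by norm_num) hN0]

theorem div_four_pow_le {N K : ℕ} {a b : ℝ} (hN : 1 ≤ N) (hK : (N : ℝ) ^ b ≤ 2 ^ K)
    (hab : a + 2 * b = 1) : (N : ℝ) / 4 ^ K ≤ (N : ℝ) ^ a := by
  have hN0 : (0 : ℝ) < N := by exact_mod_cast hN
  have hb := Real.rpow_pos_of_pos hN0 b
  have ha := Real.rpow_pos_of_pos hN0 a
  rw [div_le_iff₀ (by positivity)]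
  have h4 : (4 : ℝ) ^ K = (2 ^ K) ^ 2 := by rw [← pow_mul, mul_comm, pow_mul]; norm_num
  have h1 : (N : ℝ) = (N : ℝ) ^ a * ((N : ℝ) ^ b) ^ 2 := by
    rw [← Real.rpow_natCast, ← Real.rpow_mul hN0.le, ← Real.rpow_add hN0]
    rw [show a + b * (2 : ℕ) = 1 by push_cast; linarith, Real.rpow_one]
  rw [h4]
  calc (N : ℝ) = (N : ℝ) ^ a * ((N : ℝ) ^ b) ^ 2 := h1
    _ ≤ _ := by gcongr

/-- The `k`-th term is `(k + 1) ^ (4 * M) / c ^ 2`, there are at most `3 * lg N` terms, and `2 ^ K ≥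
N` leaves at most `1` for the tail. -/
theorem logarithmic_sum_le (M : ℕ) {L c : ℝ} (hc : 0 < c) {N : ℕ} (hN : 1 ≤ N) :
    L ^ 2 + ∑ k ∈ Finset.range (⌈Real.logb 2 N⌉₊ + 1),
        1 / (4 ^ k * (c / (2 ^ k * ((k : ℝ) + 1) ^ (2 * M))) ^ 2) + N / 4 ^ ⌈Real.logb 2 N⌉₊
      ≤ (L ^ 2 + 3 ^ (4 * M + 1) / c ^ 2 + 1) * lg N ^ (4 * M + 1) := by
  have hg := one_le_lg N
  have hg' : 1 ≤ lg N ^ (4 * M + 1) := one_le_pow₀ hg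
  set K := ⌈Real.logb 2 N⌉₊ with hK
  have hK1 : (K : ℝ) + 1 ≤ 3 * lg N := by
    simpa using natCeil_logb_add_one_le hN zero_le_one le_rfl
  have h1 : ∀ k ∈ Finset.range (K + 1), 1 / (4 ^ k * (c / (2 ^ k * ((k : ℝ) + 1) ^ (2 * M))) ^ 2)
      ≤ (3 * lg N) ^ (4 * M) / c ^ 2 := by
    intro k hk
    have hk' : (k : ℝ) + 1 ≤ 3 * lg N := by
      have : (k : ℝ) ≤ K := by exact_mod_cast Nat.lt_succ_iff.1 (Finset.mem_range.1 hk)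
      linarith
    have h4 : (4 : ℝ) ^ k = (2 ^ k) ^ 2 := by rw [← pow_mul, mul_comm, pow_mul]; norm_num
    calc 1 / (4 ^ k * (c / (2 ^ k * ((k : ℝ) + 1) ^ (2 * M))) ^ 2)
        = ((k : ℝ) + 1) ^ (4 * M) / c ^ 2 := by
          rw [h4, show 4 * M = 2 * M * 2 by ring, pow_mul _ (2 * M) 2]
          have : (k : ℝ) + 1 ≠ 0 := by positivity
          field_simp
      _ ≤ _ := by gcongr
  have h2 := Finset.sum_le_sum h1
  rw [Finset.sum_const, Finset.card_range, nsmul_eq_mul] at h2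
  push_cast at h2
  have h3 : ((K : ℝ) + 1) * ((3 * lg N) ^ (4 * M) / c ^ 2)
      ≤ 3 ^ (4 * M + 1) / c ^ 2 * lg N ^ (4 * M + 1) := by
    calc _ ≤ (3 * lg N) * ((3 * lg N) ^ (4 * M) / c ^ 2) := by gcongr
      _ = (3 * lg N) ^ (4 * M + 1) / c ^ 2 := by ring
      _ = _ := by rw [mul_pow]; ring
  have h5 : (N : ℝ) / 4 ^ K ≤ 1 := by
    have h6 := rpow_le_two_pow_natCeil hN 1
    rw [one_mul, ← hK, Real.rpow_one] at h6
    rw [div_le_one (by positivity)]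
    exact h6.trans (pow_le_pow_left₀ zero_le_two (by norm_num) K)
  have h7 : L ^ 2 ≤ L ^ 2 * lg N ^ (4 * M + 1) := le_mul_of_one_le_right (sq_nonneg L) hg'
  linarith

theorem LogCovered.exists_pointSet {M : ℕ} {Ω : Set ℝ} (h : LogCovered M Ω) :
    ∃ C : ℝ, ∀ N : ℕ, 1 ≤ N →
      (∀ μ : Measure (squareRectangles Ω), IsProbabilityMeasure μ →
        ∃ P : Finset Plane, (P : Set Plane) ⊆ unitSquare ∧ P.card = N ∧
          eLpNorm (fun R : squareRectangles Ω => discrepancy P R) 2 μ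
            ≤ ENNReal.ofReal (C * lg N ^ (2 * (M : ℝ) + 1 / 2))) ∧
      (∀ μ : Measure (torusRectangles Ω), IsProbabilityMeasure μ →
        ∃ P : Finset Plane, (P : Set Plane) ⊆ unitSquare ∧ P.card = N ∧
          eLpNorm (fun R : torusRectangles Ω => torusDiscrepancy P R) 2 μ
            ≤ ENNReal.ofReal (C * lg N ^ (2 * (M : ℝ) + 1 / 2))) := by
  obtain ⟨C, hC, hP⟩ := exists_pointSet_rectangles
  obtain ⟨α, L, c, hc, hs⟩ := h.insert_zero.exists_slopeBound
  have hδ : ∀ k : ℕ, 0 < c / (2 ^ k * ((k : ℝ) + 1) ^ (2 * M)) := fun k => by positivity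
  have hD0 : 0 ≤ C * (L ^ 2 + 3 ^ (4 * M + 1) / c ^ 2 + 1) := by positivity
  have hfin : ∀ N : ℕ, 1 ≤ N → ENNReal.ofReal (Real.sqrt (C * (L ^ 2 +
      ∑ k ∈ Finset.range (⌈Real.logb 2 N⌉₊ + 1),
        1 / (4 ^ k * (c / (2 ^ k * ((k : ℝ) + 1) ^ (2 * M))) ^ 2) + N / 4 ^ ⌈Real.logb 2 N⌉₊)))
      ≤ ENNReal.ofReal (Real.sqrt (C * (L ^ 2 + 3 ^ (4 * M + 1) / c ^ 2 + 1))
        * lg N ^ (2 * (M : ℝ) + 1 / 2)) := by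
    intro N hN
    refine ENNReal.ofReal_le_ofReal ?_
    have hg0 : 0 ≤ lg N := zero_le_one.trans (one_le_lg N)
    have e : lg N ^ (2 * (M : ℝ) + 1 / 2) = Real.sqrt (lg N ^ (4 * M + 1)) := by
      rw [Real.sqrt_eq_rpow, ← Real.rpow_natCast, ← Real.rpow_mul hg0]
      congr 1
      push_cast
      ring
    rw [e, ← Real.sqrt_mul hD0, mul_assoc]
    exact Real.sqrt_le_sqrt (mul_le_mul_of_nonneg_left (logarithmic_sum_le M hc hN) hC.le)
  refine ⟨Real.sqrt (C * (L ^ 2 + 3 ^ (4 * M + 1) / c ^ 2 + 1)), fun N hN => ⟨fun μ hμ => ?_, fun μ hμ => ?_⟩⟩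
  · obtain ⟨P, hPs, hPN, hle⟩ := (hP α Ω N hN).1 μ hμ
    exact ⟨P, hPs, hPN, (hle L _ _ hδ hs).trans (hfin N hN)⟩
  · obtain ⟨P, hPs, hPN, hle⟩ := (hP α Ω N hN).2 μ hμ
    exact ⟨P, hPs, hPN, (hle L _ _ hδ hs).trans (hfin N hN)⟩

/-- The `k`-th term is of order `2 ^ (2 * t * k)`. Equating this at `k = K` with `N / 4 ^ K` gives
`2 ^ K ≈ N ^ (1 / (2 * (t + 1)))`. Bounding each term by the largest possible one costs a logarithm,
which also covers `t = 0`. -/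
theorem power_sum_le {L c t : ℝ} (hc : 0 < c) (ht : 0 ≤ t) {N : ℕ} (hN : 1 ≤ N) :
    ∃ K : ℕ, L ^ 2 + ∑ k ∈ Finset.range (K + 1),
        1 / (4 ^ k * (c * ((2 : ℝ) ^ k) ^ (-1 - t)) ^ 2) + N / 4 ^ K
      ≤ (L ^ 2 + 3 * 2 ^ (2 * t) / c ^ 2 + 1) * (lg N * (N : ℝ) ^ (t / (t + 1))) := by
  have hN0 : (0 : ℝ) < N := by exact_mod_cast hN
  have hN1 : (1 : ℝ) ≤ N := by exact_mod_cast hN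
  have ht1 : 0 < t + 1 := by linarith
  set b := 1 / (2 * (t + 1)) with hb
  have hb0 : 0 ≤ b := by positivity
  have hb1 : b ≤ 1 := by
    rw [hb, div_le_one (by positivity)]
    linarith
  have hab : t / (t + 1) + 2 * b = 1 := by rw [hb]; field_simp
  have hbt : b * (2 * t) = t / (t + 1) := by rw [hb]; field_simp
  set K := ⌈b * Real.logb 2 N⌉₊ with hK
  have hK1 := natCeil_logb_add_one_le hN hb0 hb1
  have hK2 := two_pow_natCeil_le hN hb0
  have hK3 := rpow_le_two_pow_natCeil hN b
  rw [← hK] at hK1 hK2 hK3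
  have hg := one_le_lg N
  set P := (N : ℝ) ^ (t / (t + 1)) with hP
  have hP1 : 1 ≤ P := Real.one_le_rpow hN1 (by positivity)
  have hPg : 1 ≤ lg N * P := one_le_mul_of_one_le_of_one_le hg hP1
  refine ⟨K, ?_⟩
  have h1 : ∀ k ∈ Finset.range (K + 1), 1 / (4 ^ k * (c * ((2 : ℝ) ^ k) ^ (-1 - t)) ^ 2)
      ≤ 2 ^ (2 * t) * P / c ^ 2 := by
    intro k hk
    have h4 : (4 : ℝ) ^ k = (2 ^ k) ^ 2 := by rw [← pow_mul, mul_comm, pow_mul]; norm_num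
    have hx : (0 : ℝ) < 2 ^ k := by positivity
    have hkK : (2 : ℝ) ^ k ≤ 2 ^ K :=
      pow_le_pow_right₀ one_le_two (Nat.lt_succ_iff.1 (Finset.mem_range.1 hk))
    calc 1 / (4 ^ k * (c * ((2 : ℝ) ^ k) ^ (-1 - t)) ^ 2)
        = ((2 : ℝ) ^ k) ^ (2 * t) / c ^ 2 := by
          rw [h4]
          generalize (2 : ℝ) ^ k = x at hx ⊢
          rw [show -1 - t = -(1 + t) by ring, Real.rpow_neg hx.le, Real.rpow_add hx, Real.rpow_one,
            mul_comm 2 t, Real.rpow_mul hx.le, Real.rpow_two]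
          have := Real.rpow_pos_of_pos hx t
          field_simp
      _ ≤ (2 * (N : ℝ) ^ b) ^ (2 * t) / c ^ 2 := by
          gcongr
          exact hkK.trans hK2
      _ = 2 ^ (2 * t) * P / c ^ 2 := by
          rw [Real.mul_rpow zero_le_two (by positivity), ← Real.rpow_mul hN0.le, hbt]
  have h2 := Finset.sum_le_sum h1
  rw [Finset.sum_const, Finset.card_range, nsmul_eq_mul] at h2
  push_cast at h2
  have h3 : ((K : ℝ) + 1) * (2 ^ (2 * t) * P / c ^ 2)
      ≤ 3 * 2 ^ (2 * t) / c ^ 2 * (lg N * P) := by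
    calc _ ≤ (3 * lg N) * (2 ^ (2 * t) * P / c ^ 2) := by gcongr
      _ = _ := by ring
  have h5 : (N : ℝ) / 4 ^ K ≤ lg N * P :=
    (div_four_pow_le hN hK3 hab).trans (le_mul_of_one_le_left (by positivity) hg)
  have h7 : L ^ 2 ≤ L ^ 2 * (lg N * P) := le_mul_of_one_le_right (sq_nonneg L) hPg
  linarith

theorem lg_le_rpow {ε : ℝ} (hε : 0 < ε) {N : ℕ} (hN : 1 ≤ N) :
    lg N ≤ (1 + 1 / (ε * Real.log 2)) * (N : ℝ) ^ ε := by
  have hN1 : (1 : ℝ) ≤ N := by exact_mod_cast hN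
  have h2 : 0 < Real.log 2 := Real.log_pos one_lt_two
  have h1 : (1 : ℝ) ≤ (N : ℝ) ^ ε := Real.one_le_rpow hN1 hε.le
  have h3 := Real.log_le_rpow_div (zero_le_one.trans hN1) hε
  have h4 : Real.logb 2 N ≤ 1 / (ε * Real.log 2) * (N : ℝ) ^ ε := by
    rw [Real.logb, div_le_iff₀ h2]
    refine h3.trans (le_of_eq ?_)
    field_simp
  have h5 : 0 < 1 / (ε * Real.log 2) := by positivity
  refine max_le ?_ ?_ <;> nlinarith

/-- Ensures that the infimum defining `upperMinkowskiDim` is taken over a nonempty set, so that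
exponents close to it exist. -/
theorem hasCoveringExponent_one {Ω : Set ℝ} (hΩ : Ω ⊆ Icc 0 (Real.pi / 2)) :
    HasCoveringExponent Ω 1 := by
  refine ⟨3, 1, one_pos, fun δ h0 h1 => ?_⟩
  refine ⟨(Finset.range (⌊2 / δ⌋₊ + 1)).image fun i : ℕ => i * δ, ?_, fun x hx => ?_⟩
  · have hc : (((Finset.range (⌊2 / δ⌋₊ + 1)).image fun i : ℕ => i * δ).card : ℝ) ≤ 2 / δ + 1 := by
      refine (Nat.cast_le.2 Finset.card_image_le).trans ?_
      rw [Finset.card_range]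
      push_cast
      linarith [Nat.floor_le (show 0 ≤ 2 / δ by positivity)]
    refine hc.trans ?_
    rw [Real.rpow_neg_one, div_add_one h0.ne', ← div_eq_mul_inv]
    gcongr
    linarith
  · obtain ⟨hx0, hx1⟩ := hΩ hx
    have hx2 : x ≤ 2 := hx1.trans (by linarith [Real.pi_le_four])
    have h2 := Nat.floor_le (show 0 ≤ x / δ by positivity)
    have h3 := Nat.lt_floor_add_one (x / δ)
    rw [le_div_iff₀ h0] at h2
    rw [div_lt_iff₀ h0] at h3
    refine mem_iUnion₂.2 ⟨⌊x / δ⌋₊ * δ, Finset.mem_image.2 ⟨_, ?_, rfl⟩, h2, by linarith⟩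
    refine Finset.mem_range.2 (Nat.lt_succ_iff.2 (Nat.floor_le_floor ?_))
    gcongr

/-- Exponents close to the upper Minkowski dimension give discrepancy exponents close to the
optimal one. -/
theorem exists_exponent_lt {Ω : Set ℝ} (hΩ : Ω ⊆ Icc 0 (Real.pi / 2)) {d : ℝ}
    (hd : upperMinkowskiDim Ω = d) (hd1 : d < 1) {g : ℝ → ℝ} (hg : ContinuousAt g d) {ε : ℝ}
    (hε : 0 < ε) : ∃ s, 0 ≤ s ∧ s < 1 ∧ HasCoveringExponent Ω s ∧ g s < g d + ε := by
  have hne : {s : ℝ | 0 ≤ s ∧ HasCoveringExponent Ω s}.Nonempty :=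
    ⟨1, zero_le_one, hasCoveringExponent_one hΩ⟩
  obtain ⟨η, hη, hgη⟩ := Metric.continuousAt_iff.1 hg ε hε
  have hlt : sInf {s : ℝ | 0 ≤ s ∧ HasCoveringExponent Ω s} < min 1 (d + η) := by
    rw [← upperMinkowskiDim, hd]
    exact lt_min hd1 (by linarith)
  obtain ⟨s, ⟨hs0, hs⟩, hsl⟩ := exists_lt_of_csInf_lt hne hlt
  have hds : d ≤ s := by
    rw [← hd]
    exact csInf_le ⟨0, fun _ h => h.1⟩ ⟨hs0, hs⟩
  refine ⟨s, hs0, hsl.trans_le (min_le_left _ _), hs, ?_⟩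
  have h1 : dist s d < η := by
    rw [Real.dist_eq, abs_of_nonneg (by linarith)]
    linarith [hsl.trans_le (min_le_right _ _)]
  have h2 := hgη h1
  rw [Real.dist_eq] at h2
  linarith [(abs_lt.1 h2).2]

/-- The infimum `d` need not be attained, so each `ε` uses its own exponent `s` near `d`. Still the
point set precedes `ε`: one `α` works for all `s`, and one shift for all bounds. -/
theorem exists_pointSet_of_upperMinkowskiDim {Ω : Set ℝ} (hΩ : Ω ⊆ Icc 0 (Real.pi / 2)) {d τ : ℝ}
    (hd : upperMinkowskiDim Ω = d) (hd1 : d < 1) (hτ : τ = 2 / (1 - d) ^ 2 - 2) :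
    ∃ C : ℝ → ℝ, ∀ N : ℕ, 1 ≤ N →
      (∀ μ : Measure (squareRectangles Ω), IsProbabilityMeasure μ →
        ∃ P : Finset Plane, (P : Set Plane) ⊆ unitSquare ∧ P.card = N ∧ ∀ ε : ℝ, 0 < ε →
          eLpNorm (fun R : squareRectangles Ω => discrepancy P R) 2 μ
            ≤ ENNReal.ofReal (C ε * (N : ℝ) ^ (τ / (2 * (τ + 1)) + ε))) ∧
      (∀ μ : Measure (torusRectangles Ω), IsProbabilityMeasure μ →
        ∃ P : Finset Plane, (P : Set Plane) ⊆ unitSquare ∧ P.card = N ∧ ∀ ε : ℝ, 0 < ε →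
          eLpNorm (fun R : torusRectangles Ω => torusDiscrepancy P R) 2 μ
            ≤ ENNReal.ofReal (C ε * (N : ℝ) ^ (τ / (2 * (τ + 1)) + ε))) := by
  obtain ⟨C, hC, hP⟩ := exists_pointSet_rectangles
  set t : ℝ → ℝ := fun s => 2 / (1 - s) ^ 2 - 2 with ht
  have ht0 : ∀ s, 0 ≤ s → s < 1 → 0 ≤ t s := by
    intro s h0 h1
    have h2 : (1 - s) ^ 2 ≤ 1 := pow_le_one₀ (by linarith) (by linarith)
    have h3 : 0 < (1 - s) ^ 2 := pow_pos (by linarith) 2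
    have h4 : 2 ≤ 2 / (1 - s) ^ 2 := by rw [le_div_iff₀ h3]; linarith
    simp only [ht]
    linarith
  have hd0 : 0 ≤ d := by
    rw [← hd]
    exact Real.sInf_nonneg fun _ h => h.1
  set g : ℝ → ℝ := fun s => t s / (2 * (t s + 1)) with hg
  have hgd : g d = τ / (2 * (τ + 1)) := by rw [hτ]
  have hcont : ContinuousAt g d := by
    have h1 : ContinuousAt t d :=
      ((continuousAt_const.div ((continuousAt_const.sub continuousAt_id).pow 2)
        (pow_ne_zero 2 (sub_ne_zero.2 hd1.ne'))).sub continuousAt_const)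
    exact h1.div (continuousAt_const.mul (h1.add continuousAt_const))
      (by have := ht0 d hd0 hd1; positivity)
  set S : Set ℝ := {s | 0 ≤ s ∧ s < 1 ∧ HasCoveringExponent Ω s} with hS
  have hSne : S.Nonempty := by
    obtain ⟨s, h0, h1, h2, _⟩ := exists_exponent_lt hΩ hd hd1 hcont one_pos
    exact ⟨s, h0, h1, h2⟩
  obtain ⟨α, hα⟩ := exists_slopeBound_of_powCovered (Ω := insert 0 Ω) (S := S)
    (fun s hs => ⟨hs.1, hs.2.1,
      (powCovered_of_hasCoveringExponent hs.1 hs.2.2).insert_zero hs.1⟩) hSne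
  have key : ∀ ε : ℝ, ∃ D : ℝ, 0 < ε → ∀ N : ℕ, 1 ≤ N → ∃ (L : ℝ) (δ : ℕ → ℝ) (K : ℕ),
      (∀ k, 0 < δ k) ∧ SlopeBound α (insert 0 Ω) L δ ∧
      Real.sqrt (C * (L ^ 2 + ∑ k ∈ Finset.range (K + 1), 1 / (4 ^ k * δ k ^ 2) + N / 4 ^ K))
        ≤ D * (N : ℝ) ^ (τ / (2 * (τ + 1)) + ε) := by
    intro ε
    by_cases hε : 0 < ε
    swap
    · exact ⟨0, fun h => absurd h hε⟩
    -- Under the square root the exponents double: of the available `2 * ε`, passing from `d` to `s`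
    -- uses less than `ε`, and the factor `lg N` uses the other `ε`.
    obtain ⟨s, hs0, hs1, hs, hgs⟩ := exists_exponent_lt hΩ hd hd1 hcont (half_pos hε)
    obtain ⟨L, c, hc, hsl⟩ := hα s ⟨hs0, hs1, hs⟩
    have htp := ht0 s hs0 hs1
    have hexp : 1 - 2 / (1 - s) ^ 2 = -1 - t s := by simp only [ht]; ring
    rw [hexp] at hsl
    set B := L ^ 2 + 3 * 2 ^ (2 * t s) / c ^ 2 + 1 with hB
    have hB0 : 0 ≤ B := by positivity
    set G := 1 + 1 / (ε * Real.log 2) with hG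
    have hG0 : 0 ≤ G := by
      have := Real.log_pos one_lt_two
      positivity
    refine ⟨Real.sqrt (C * B * G), fun _ N hN => ?_⟩
    have hN0 : (0 : ℝ) < N := by exact_mod_cast hN
    have hN1 : (1 : ℝ) ≤ N := by exact_mod_cast hN
    obtain ⟨K, hK⟩ := power_sum_le (L := L) hc htp hN
    refine ⟨L, _, K, fun k => ?_, hsl, ?_⟩
    · positivity
    · have e : (N : ℝ) ^ (τ / (2 * (τ + 1)) + ε)
          = Real.sqrt ((N : ℝ) ^ (2 * (τ / (2 * (τ + 1)) + ε))) := by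
        rw [Real.sqrt_eq_rpow, ← Real.rpow_mul hN0.le]
        congr 1
        ring
      rw [e, ← Real.sqrt_mul (by positivity)]
      refine Real.sqrt_le_sqrt ?_
      have h1 : lg N * (N : ℝ) ^ (t s / (t s + 1))
          ≤ G * (N : ℝ) ^ (2 * (τ / (2 * (τ + 1)) + ε)) := by
        calc lg N * (N : ℝ) ^ (t s / (t s + 1))
            ≤ G * (N : ℝ) ^ ε * (N : ℝ) ^ (t s / (t s + 1)) := by
              gcongr
              exact lg_le_rpow hε hN
          _ = G * (N : ℝ) ^ (ε + t s / (t s + 1)) := by rw [mul_assoc, Real.rpow_add hN0]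
          _ ≤ _ := by
              gcongr 2
              have h2 : t s / (t s + 1) = 2 * g s := by
                simp only [hg]
                field_simp
              rw [h2, ← hgd]
              linarith
      calc _ ≤ C * (B * (lg N * (N : ℝ) ^ (t s / (t s + 1)))) := by gcongr
        _ ≤ C * (B * (G * (N : ℝ) ^ (2 * (τ / (2 * (τ + 1)) + ε)))) := by gcongr
        _ = _ := by ring
  choose D hD using key
  refine ⟨D, fun N hN => ⟨fun μ hμ => ?_, fun μ hμ => ?_⟩⟩
  · obtain ⟨P, hPs, hPN, hle⟩ := (hP α Ω N hN).1 μ hμ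
    refine ⟨P, hPs, hPN, fun ε hε => ?_⟩
    obtain ⟨L, δ, K, hδ, hs, hb⟩ := hD ε hε N hN
    exact (hle L δ K hδ hs).trans (ENNReal.ofReal_le_ofReal hb)
  · obtain ⟨P, hPs, hPN, hle⟩ := (hP α Ω N hN).2 μ hμ
    refine ⟨P, hPs, hPN, fun ε hε => ?_⟩
    obtain ⟨L, δ, K, hδ, hs, hb⟩ := hD ε hε N hN
    exact (hle L δ K hδ hs).trans (ENNReal.ofReal_le_ofReal hb)

theorem theorem2 (Ω : Set ℝ) (hΩ : Ω ⊆ Icc 0 (Real.pi / 2)) :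
    -- lacunary sequences
    ((∃ ω : ℕ → ℝ, IsLacunarySeq ω ∧ Ω = range ω) →
      ∃ C : ℝ, ∀ N : ℕ, 1 ≤ N →
        (∀ μ : Measure (squareRectangles Ω), IsProbabilityMeasure μ →
          ∃ P : Finset Plane, (P : Set Plane) ⊆ unitSquare ∧ P.card = N ∧
            eLpNorm (fun R : squareRectangles Ω => discrepancy P R) 2 μ
              ≤ ENNReal.ofReal (C * lg N ^ (5 / 2 : ℝ))) ∧
        (∀ μ : Measure (torusRectangles Ω), IsProbabilityMeasure μ →
          ∃ P : Finset Plane, (P : Set Plane) ⊆ unitSquare ∧ P.card = N ∧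
            eLpNorm (fun R : torusRectangles Ω => torusDiscrepancy P R) 2 μ
              ≤ ENNReal.ofReal (C * lg N ^ (5 / 2 : ℝ)))) ∧
    -- lacunary sets of order `M`
    (∀ M : ℕ, 1 < M → IsLacunaryOfOrder M Ω →
      ∃ C : ℝ, ∀ N : ℕ, 1 ≤ N →
        (∀ μ : Measure (squareRectangles Ω), IsProbabilityMeasure μ →
          ∃ P : Finset Plane, (P : Set Plane) ⊆ unitSquare ∧ P.card = N ∧
            eLpNorm (fun R : squareRectangles Ω => discrepancy P R) 2 μ
              ≤ ENNReal.ofReal (C * lg N ^ (2 * (M : ℝ) + 1 / 2))) ∧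
        (∀ μ : Measure (torusRectangles Ω), IsProbabilityMeasure μ →
          ∃ P : Finset Plane, (P : Set Plane) ⊆ unitSquare ∧ P.card = N ∧
            eLpNorm (fun R : torusRectangles Ω => torusDiscrepancy P R) 2 μ
              ≤ ENNReal.ofReal (C * lg N ^ (2 * (M : ℝ) + 1 / 2)))) ∧
    -- sets of small upper Minkowski dimension
    (∀ d τ : ℝ, upperMinkowskiDim Ω = d → 0 ≤ d → d < 1 →
      τ = 2 / (1 - d) ^ 2 - 2 → τ < 1 →
      ∃ C : ℝ → ℝ, ∀ N : ℕ, 1 ≤ N →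
        (∀ μ : Measure (squareRectangles Ω), IsProbabilityMeasure μ →
          ∃ P : Finset Plane, (P : Set Plane) ⊆ unitSquare ∧ P.card = N ∧ ∀ ε : ℝ, 0 < ε →
            eLpNorm (fun R : squareRectangles Ω => discrepancy P R) 2 μ
              ≤ ENNReal.ofReal (C ε * (N : ℝ) ^ (τ / (2 * (τ + 1)) + ε))) ∧
        (∀ μ : Measure (torusRectangles Ω), IsProbabilityMeasure μ →
          ∃ P : Finset Plane, (P : Set Plane) ⊆ unitSquare ∧ P.card = N ∧ ∀ ε : ℝ, 0 < ε →
            eLpNorm (fun R : torusRectangles Ω => torusDiscrepancy P R) 2 μ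
              ≤ ENNReal.ofReal (C ε * (N : ℝ) ^ (τ / (2 * (τ + 1)) + ε)))) := by
  refine ⟨?_, fun M _ hM => (logCovered_of_isLacunaryOfOrder M hM).exists_pointSet, ?_⟩
  · rintro ⟨ω, hω, rfl⟩
    have h := (logCovered_of_isLacunarySeq hω).exists_pointSet
    rwa [show 2 * ((1 : ℕ) : ℝ) + 1 / 2 = 5 / 2 by norm_num] at h
  · exact fun d τ hd _ hd1 hτ _ => exists_pointSet_of_upperMinkowskiDim hΩ hd hd1 hτ
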